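/- Let $R$ be a two-dimensional noetherian normal Hensel local domain with residue field $\kappa$ which is a $\kappa$-rational Hirzebruch–Jung singularity: there is a rational minimal resolution $f\colon X\to\operatorname{Spec}R$ whose exceptional locus is a string of curves $E_1,\dots,E_r$ ($r\ge 1$) isomorphic over $\kappa$ to $\mathbb P^1_\kappa$, such that $E_i$ and $E_{i+1}$ intersect scheme-theoretically in a single $\kappa$-rational point and there are no other intersections. Let $m$ be the determinant of the matrix $-(E_i.E_j)_{i,j}$, and suppose that $\kappa$ contains a primitive $m$-th root of unity. Let $E_0\subset X$ be a non-exceptional irreducible curve that intersects $E_1$ scheme-theoretically in a single $\kappa$-rational point and is disjoint from $E_2,\dots,E_r$, let $\mathfrak q\subset R$ be the height one prime of the prime divisor $f_*E_0$, so that $\mathcal O(-l f_*E_0)=\mathfrak q^{(l)}$ (symbolic power), and let $w$ be a generator of $\mathfrak q^{(m)}=\mathcal O(-m f_*E_0)$. Let $$S=\bigoplus_{l=0}^{m-1}\mathcal O(-l f_*E_0)\,t^l,\qquad t^{-m}=w,$$ be the associated cyclic cover of $R$, which is a $\mathbb Z/m$-graded $R$-algebra $S=\bigoplus_{i\in\mathbb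 Z/m}S_i$. Let $\alpha$ be a cyclic field extension $\tilde\kappa/\kappa$ of degree $m$ with a chosen identification of its Galois group with $\mathbb Z/m$, let $\tilde R/R$ be the corresponding finite étale extension with its action of $\mathbb Z/m$, and for an $m$-th root of unity $\omega\in R$ let $\tilde R_\omega=\{b\in\tilde R: 1\cdot b=\omega b\}$ be the eigenspace of the generator $1\in\mathbb Z/m$, so that $\tilde R=\bigoplus_\omega\tilde R_\omega$. The symbol $\Delta=(S,\alpha)$ is the $R$-algebra with underlying $R$-module $S\otimes_R\tilde R$, in which $S$ and $\tilde R$ are subalgebras that satisfy $$ b s=\omega^i\, s b\qquad\text{for } s\in S_i,\ b\in\tilde R_\omega .$$ Then $\Delta$ is a maximal order in a division ring: with $K$ the field of fractions of $R$, $\Delta$ is torsion-free over $R$, $K\otimes_R\Delta$ is a division ring that is finite-dimensional over its center $K$, and $\Delta$ is a maximal $R$-order in $K\otimes_R\Delta$. Furthermore, $\Delta$ is Azumaya in codimension one: $\Delta_{\mathfrak p}$ is an Azumaya $R_{\mathfrak p}$-algebra for every prime $\mathfrak p\subset R$ of height one. -/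

import Mathlib

set_option linter.unusedSectionVars false

/-- The `n`-th symbolic power `qⁿ R_q ∩ R` of a prime ideal `q`. -/
def symbolicPower {R : Type*} [CommRing R] (q : Ideal R) [q.IsPrime] (n : ℕ) : Ideal R :=
  ((q ^ n).map (algebraMap R (Localization.AtPrime q))).comap
    (algebraMap R (Localization.AtPrime q))

section CyclicCover
open Polynomial

variable {R : Type*} [CommRing R] [IsDomain R] (q : Ideal R) [q.IsPrime] (m : ℕ) [NeZero m] (w : R)

theorem mul_mem_symbolicPower {i j : ℕ} {a b : R} (ha : a ∈ symbolicPower q i)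
    (hb : b ∈ symbolicPower q j) : a * b ∈ symbolicPower q (i + j) := by
  simp only [symbolicPower, Ideal.mem_comap, map_mul, pow_add, Ideal.map_mul] at *
  exact Ideal.mul_mem_mul ha hb

/-- If `w` generates `q⁽ᵐ⁾` then `q⁽ᵐ⁺ʲ⁾ ⊆ w q⁽ʲ⁾`. -/
theorem exists_mem_symbolicPower_of_add {m : ℕ} {w : R} (hw : Ideal.span {w} = symbolicPower q m) {j : ℕ} {a : R}
    (ha : a ∈ symbolicPower q (m + j)) : ∃ c ∈ symbolicPower q j, a = w * c := by
  have hle : a ∈ symbolicPower q m := by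
    simp only [symbolicPower, Ideal.mem_comap] at *
    exact Ideal.map_mono (Ideal.pow_le_pow_right (Nat.le_add_right m j)) ha
  rw [← hw, Ideal.mem_span_singleton] at hle
  obtain ⟨c, rfl⟩ := hle
  by_cases hw0 : w = 0
  · exact ⟨0, Ideal.zero_mem _, by simp [hw0]⟩
  refine ⟨c, ?_, rfl⟩
  have hmap : (q ^ m).map (algebraMap R (Localization.AtPrime q)) =
      Ideal.span {algebraMap R (Localization.AtPrime q) w} := by
    rw [← Set.image_singleton, ← Ideal.map_span, hw, symbolicPower,
      IsLocalization.map_under q.primeCompl]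
  simp only [symbolicPower, Ideal.mem_comap, map_mul, pow_add, Ideal.map_mul] at ha ⊢
  rw [hmap, Ideal.mem_span_singleton_mul] at ha
  obtain ⟨z, hz, he⟩ := ha
  have hinj : algebraMap R (Localization.AtPrime q) w ≠ 0 := by
    intro h
    exact hw0 (IsLocalization.injective (Localization.AtPrime q) q.primeCompl_le_nonZeroDivisors
      (by simpa using h))
  have : z = algebraMap R (Localization.AtPrime q) c := mul_left_cancel₀ hinj he
  exact this ▸ hz

/-- The `K`-algebra `K[t]/(t ^ m - w⁻¹)`, where `K` is the field of fractions of `R`. -/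
abbrev KummerAlgebra : Type _ :=
  AdjoinRoot (X ^ m - C (algebraMap R (FractionRing R) w)⁻¹)

/-- The generator `t`. -/
noncomputable abbrev kummerGen : KummerAlgebra m w := AdjoinRoot.root _

/-- The `R`-submodule `q⁽ˡ⁾ tˡ`, where `l` is the representative of `i` with `0 ≤ l < m`. -/
noncomputable def cyclicCoverPiece (i : ZMod m) : Submodule R (KummerAlgebra m w) :=
  Submodule.map (LinearMap.toSpanSingleton R _ (kummerGen m w ^ i.val)) (symbolicPower q i.val)

theorem kummerGen_pow : kummerGen m w ^ m =
    algebraMap (FractionRing R) _ (algebraMap R (FractionRing R) w)⁻¹ := by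
  have := AdjoinRoot.eval₂_root (X ^ m - C (algebraMap R (FractionRing R) w)⁻¹)
  simpa [sub_eq_zero] using this

theorem cyclicCoverPiece_mul {m : ℕ} [NeZero m] {w : R} (hw : Ideal.span {w} = symbolicPower q m)
    {i j : ZMod m} {x y : KummerAlgebra m w}
    (hx : x ∈ cyclicCoverPiece q m w i) (hy : y ∈ cyclicCoverPiece q m w j) :
    x * y ∈ cyclicCoverPiece q m w (i + j) := by
  obtain ⟨a, ha, rfl⟩ := hx
  obtain ⟨b, hb, rfl⟩ := hy
  have hab := mul_mem_symbolicPower q ha hb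
  simp only [LinearMap.toSpanSingleton_apply]
  rw [smul_mul_smul_comm, ← pow_add]
  by_cases h : i.val + j.val < m
  · refine ⟨a * b, ?_, ?_⟩
    · rw [ZMod.val_add_of_lt h]; exact hab
    · rw [LinearMap.toSpanSingleton_apply, ZMod.val_add_of_lt h]
  · push Not at h
    have hv := ZMod.val_add_val_of_le h
    rw [hv, add_comm _ m] at hab ⊢
    obtain ⟨c, hc, he⟩ := exists_mem_symbolicPower_of_add q hw hab
    by_cases hw0 : w = 0
    · rw [he, hw0]; simp
    refine ⟨c, hc, ?_⟩
    rw [LinearMap.toSpanSingleton_apply, pow_add, kummerGen_pow, he,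
      mul_comm w c, mul_smul, Algebra.smul_def w,
      IsScalarTower.algebraMap_apply R (FractionRing R) (KummerAlgebra m w), ← mul_assoc, ← map_mul,
      mul_inv_cancel₀ (by simpa using hw0), map_one, one_mul]

theorem one_mem_cyclicCoverPiece : 1 ∈ cyclicCoverPiece q m w 0 :=
  ⟨1, by simp [symbolicPower, Ideal.map_top], by simp⟩

/-- The cyclic cover `S = ⨁ q⁽ˡ⁾ tˡ` (sum over `0 ≤ l < m`) of `R`, with multiplication given by
`t⁻ᵐ = w`, where `w` generates `q⁽ᵐ⁾`. When `R` is a normal domain and `C` is the prime divisor of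
`q`, the ideal `q⁽ˡ⁾` is `𝒪(-l C)`, so that `S = ⨁ 𝒪(-l C) tˡ`. -/
noncomputable def cyclicCover {m : ℕ} [NeZero m] {w : R} (hw : Ideal.span {w} = symbolicPower q m) :
    Subalgebra R (KummerAlgebra m w) :=
  (⨆ i, cyclicCoverPiece q m w i).toSubalgebra
    (Submodule.mem_iSup_of_mem 0 (one_mem_cyclicCoverPiece q m w))
    (fun x y hx hy => by
      induction hx using Submodule.iSup_induction' with
      | mem i x hx =>
        induction hy using Submodule.iSup_induction' with
        | mem j y hy => exact Submodule.mem_iSup_of_mem _ (cyclicCoverPiece_mul q hw hx hy)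
        | zero => simp
        | add y y' _ _ h h' => rw [mul_add]; exact add_mem h h'
      | zero => simp
      | add x x' _ _ h h' => rw [add_mul]; exact add_mem h h')

/-- The `ℤ/m`-grading of the cyclic cover, with `q⁽ˡ⁾ tˡ` in degree `l`. -/
noncomputable def cyclicCoverGrading {m : ℕ} [NeZero m] {w : R}
    (hw : Ideal.span {w} = symbolicPower q m) (i : ZMod m) : Submodule R (cyclicCover q hw) :=
  (cyclicCoverPiece q m w i).comap (cyclicCover q hw).val.toLinearMap

theorem linearIndependent_kummerGen_pow :
    LinearIndependent (FractionRing R) (fun i : ZMod m => kummerGen m w ^ i.val) := by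
  have hm : (X ^ m - C (algebraMap R (FractionRing R) w)⁻¹).Monic :=
    monic_X_pow_sub_C _ (NeZero.ne m)
  have h := (AdjoinRoot.powerBasis' hm).basis.linearIndependent
  have hdeg : (AdjoinRoot.powerBasis' hm).dim = m := by
    simp [AdjoinRoot.powerBasis'_dim]
  have := h.comp (fun i : ZMod m => (⟨i.val, hdeg.symm ▸ ZMod.val_lt i⟩ : Fin _))
    (fun i j hij => ZMod.val_injective m (by simpa using hij))
  simpa [Function.comp_def] using this

theorem iSupIndep_cyclicCoverPiece : iSupIndep (cyclicCoverPiece q m w) := by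
  have h := linearIndependent_kummerGen_pow m w
  have h' := (h.restrict_scalars (R := R) (by
    intro a b hab
    simpa [Algebra.smul_def] using hab)).iSupIndep_span_singleton
  refine h'.mono fun i => ?_
  rintro _ ⟨a, _, rfl⟩
  exact Submodule.smul_mem _ _ (Submodule.mem_span_singleton_self _)

theorem isInternal_cyclicCoverGrading {m : ℕ} [NeZero m] {w : R}
    (hw : Ideal.span {w} = symbolicPower q m) :
    DirectSum.IsInternal (cyclicCoverGrading q hw) := by
  have hinj : Function.Injective (cyclicCover q hw).val.toLinearMap := Subtype.val_injective
  have hle : ∀ i, cyclicCoverPiece q m w i ≤ LinearMap.range (cyclicCover q hw).val.toLinearMap :=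
    fun i x hx => ⟨⟨x, Submodule.mem_iSup_of_mem i hx⟩, rfl⟩
  have hmap : ∀ i, (cyclicCoverGrading q hw i).map (cyclicCover q hw).val.toLinearMap =
      cyclicCoverPiece q m w i := fun i =>
    Submodule.map_comap_eq_of_le (hle i)
  rw [DirectSum.isInternal_submodule_iff_iSupIndep_and_iSup_eq_top]
  constructor
  · rw [← iSupIndep_map_orderIso_iff (α := Submodule R _) (OrderIso.refl _)]
    intro i
    have h := iSupIndep_cyclicCoverPiece q m w i
    rw [disjoint_iff] at h ⊢
    apply Submodule.map_injective_of_injective hinj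
    rw [Submodule.map_bot, eq_bot_iff, ← h]
    refine (Submodule.map_inf_le _).trans ?_
    simp only [Submodule.map_iSup]
    simp only [Function.comp_apply, OrderIso.refl_apply, hmap]
    rfl
  · apply Submodule.map_injective_of_injective hinj
    rw [Submodule.map_iSup]
    simp only [hmap]
    ext x
    constructor
    · exact fun hx => ⟨⟨x, hx⟩, trivial, rfl⟩
    · rintro ⟨y, -, rfl⟩; exact y.2

noncomputable instance {m : ℕ} [NeZero m] {w : R} (hw : Ideal.span {w} = symbolicPower q m) :
    GradedAlgebra (cyclicCoverGrading q hw) :=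
  { (isInternal_cyclicCoverGrading q hw).chooseDecomposition with
    one_mem := one_mem_cyclicCoverPiece q m w
    mul_mem := fun _ _ _ _ hx hy => cyclicCoverPiece_mul q hw hx hy }
end CyclicCover

section SymbolAlgebra

open TensorProduct


variable {R S B : Type*} [CommRing R] [CommRing S] [CommRing B] [Algebra R S] [Algebra R B]
  {m : ℕ} [NeZero m] (𝒜 : ZMod m → Submodule R S) [GradedAlgebra 𝒜]
  (ρ : Multiplicative (ZMod m) →* (B ≃ₐ[R] B))

/-- The multiplication of the symbol: for `s'` homogeneous of degree `j`,
`(s ⊗ b) (s' ⊗ b') = s s' ⊗ ρ(j)(b) b'`. -/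
noncomputable def symbolMul : S ⊗[R] B →ₗ[R] S ⊗[R] B →ₗ[R] S ⊗[R] B :=
  ∑ j : ZMod m, TensorProduct.map₂ ((LinearMap.mul R S).compl₂ (GradedAlgebra.proj 𝒜 j))
    ((LinearMap.mul R B).comp (ρ (Multiplicative.ofAdd j)).toLinearMap)

theorem symbolMul_tmul {j : ZMod m} (s : S) {s' : S} (hs' : s' ∈ 𝒜 j) (b b' : B) :
    symbolMul 𝒜 ρ (s ⊗ₜ b) (s' ⊗ₜ b') = (s * s') ⊗ₜ (ρ (Multiplicative.ofAdd j) b * b') := by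
  classical
  have h : ∀ k : ZMod m, TensorProduct.map₂ ((LinearMap.mul R S).compl₂ (GradedAlgebra.proj 𝒜 k))
      ((LinearMap.mul R B).comp (ρ (Multiplicative.ofAdd k)).toLinearMap) (s ⊗ₜ b) (s' ⊗ₜ b') =
      (s * (DirectSum.decompose 𝒜 s' k : S)) ⊗ₜ (ρ (Multiplicative.ofAdd k) b * b') :=
    fun k => rfl
  simp only [symbolMul, LinearMap.sum_apply, h]
  rw [Finset.sum_eq_single j]
  · rw [DirectSum.decompose_of_mem_same _ hs']
  · intro k _ hk
    rw [DirectSum.decompose_of_mem_ne _ hs' hk.symm]; simp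
  · simp

/-- To prove a property of tensors it is enough to treat `s ⊗ b` with `s` homogeneous. -/
theorem homogeneous_tensor_induction {P : S ⊗[R] B → Prop} (h0 : P 0)
    (h1 : ∀ (j : ZMod m) (s : S) (b : B), s ∈ 𝒜 j → P (s ⊗ₜ b))
    (hadd : ∀ x y, P x → P y → P (x + y)) (x : S ⊗[R] B) : P x := by
  induction x with
  | zero => exact h0
  | add x y hx hy => exact hadd x y hx hy
  | tmul s b =>
    induction s using DirectSum.Decomposition.inductionOn 𝒜 with
    | zero => simpa using h0
    | homogeneous s => exact h1 _ _ _ s.2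
    | add s s' hs hs' => rw [TensorProduct.add_tmul]; exact hadd _ _ hs hs'

theorem symbolMul_assoc (x y z : S ⊗[R] B) :
    symbolMul 𝒜 ρ (symbolMul 𝒜 ρ x y) z = symbolMul 𝒜 ρ x (symbolMul 𝒜 ρ y z) := by
  induction x using homogeneous_tensor_induction 𝒜 with
  | h0 => simp
  | hadd x x' hx hx' => simp [hx, hx']
  | h1 i s b hs =>
    induction y using homogeneous_tensor_induction 𝒜 with
    | h0 => simp
    | hadd y y' hy hy' => simp [hy, hy']
    | h1 j s' b' hs' =>
      induction z using homogeneous_tensor_induction 𝒜 with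
      | h0 => simp
      | hadd z z' hz hz' => simp [hz, hz']
      | h1 k s'' b'' hs'' =>
        rw [symbolMul_tmul 𝒜 ρ s hs', symbolMul_tmul 𝒜 ρ _ hs'', symbolMul_tmul 𝒜 ρ _ hs'',
          symbolMul_tmul 𝒜 ρ s (SetLike.mul_mem_graded hs' hs''), add_comm j k, ofAdd_add]
        simp [mul_assoc]

theorem symbolMul_one_left (x : S ⊗[R] B) : symbolMul 𝒜 ρ (1 ⊗ₜ 1) x = x := by
  induction x using homogeneous_tensor_induction 𝒜 with
  | h0 => simp
  | hadd x y hx hy => simp [hx, hy]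
  | h1 j s b hs => rw [symbolMul_tmul 𝒜 ρ _ hs]; simp

theorem symbolMul_one_right (x : S ⊗[R] B) : symbolMul 𝒜 ρ x (1 ⊗ₜ 1) = x := by
  induction x using homogeneous_tensor_induction 𝒜 with
  | h0 => simp
  | hadd x y hx hy => simp [hx, hy]
  | h1 j s b hs =>
    rw [symbolMul_tmul 𝒜 ρ _ (SetLike.one_mem_graded 𝒜)]; simp

/-- The symbol of a `ℤ/m`-graded `R`-algebra `S` and an `R`-algebra `B` on which `ℤ/m` acts. The
underlying `R`-module is `S ⊗[R] B`. Both `S` and `B` are subalgebras, and they skew-commute: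
`b s = ω ^ i s b` for `s` homogeneous of degree `i` and `b` in the `ω`-eigenspace
`{b | ρ(1)(b) = ω b}` of `B`; see `SymbolAlgebra.skew_comm`. -/
def SymbolAlgebra (_𝒜 : ZMod m → Submodule R S) (_ρ : Multiplicative (ZMod m) →* (B ≃ₐ[R] B)) :=
  S ⊗[R] B

noncomputable instance : AddCommGroup (SymbolAlgebra 𝒜 ρ) :=
  inferInstanceAs (AddCommGroup (S ⊗[R] B))

noncomputable instance : Module R (SymbolAlgebra 𝒜 ρ) :=
  inferInstanceAs (Module R (S ⊗[R] B))

noncomputable instance : Ring (SymbolAlgebra 𝒜 ρ) :=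
  { (inferInstance : AddCommGroup (SymbolAlgebra 𝒜 ρ)) with
    mul := fun x y => symbolMul 𝒜 ρ x y
    one := (1 : S) ⊗ₜ[R] (1 : B)
    mul_assoc := symbolMul_assoc 𝒜 ρ
    one_mul := symbolMul_one_left 𝒜 ρ
    mul_one := symbolMul_one_right 𝒜 ρ
    left_distrib := fun x y z => map_add (symbolMul 𝒜 ρ x) y z
    right_distrib := fun x y z => LinearMap.map_add₂ (symbolMul 𝒜 ρ) x y z
    zero_mul := fun x => LinearMap.map_zero₂ (symbolMul 𝒜 ρ) x
    mul_zero := fun x => map_zero (symbolMul 𝒜 ρ x) }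

noncomputable instance : Algebra R (SymbolAlgebra 𝒜 ρ) :=
  Algebra.ofModule (fun a x y => LinearMap.map_smul₂ (symbolMul 𝒜 ρ) a x y)
    (fun a x y => map_smul (symbolMul 𝒜 ρ x) a y)

/-- The element `s ⊗ b` of the symbol. -/
noncomputable def SymbolAlgebra.tmul (s : S) (b : B) : SymbolAlgebra 𝒜 ρ := s ⊗ₜ[R] b

/-- In the symbol, `s` and `b` multiply to `s ⊗ b`. -/
theorem SymbolAlgebra.mul_eq_tmul (s : S) (b : B) :
    tmul 𝒜 ρ s 1 * tmul 𝒜 ρ 1 b = tmul 𝒜 ρ s b := by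
  refine (symbolMul_tmul 𝒜 ρ s (SetLike.one_mem_graded 𝒜) 1 b).trans ?_
  simp [tmul]

theorem SymbolAlgebra.left_mul (s s' : S) :
    tmul 𝒜 ρ s 1 * tmul 𝒜 ρ s' 1 = tmul 𝒜 ρ (s * s') 1 := by
  induction s' using DirectSum.Decomposition.inductionOn 𝒜 with
  | zero =>
    have h : tmul 𝒜 ρ (0 : S) 1 = 0 := TensorProduct.zero_tmul S (1 : B)
    rw [mul_zero, h, mul_zero]
  | homogeneous s' =>
    refine (symbolMul_tmul 𝒜 ρ s s'.2 1 1).trans ?_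
    simp [tmul]
  | add a b ha hb =>
    have h : ∀ x y : S, tmul 𝒜 ρ (x + y) 1 = tmul 𝒜 ρ x 1 + tmul 𝒜 ρ y 1 :=
      fun x y => TensorProduct.add_tmul x y 1
    rw [mul_add, h, h, mul_add, ha, hb]

theorem SymbolAlgebra.right_mul (b b' : B) :
    tmul 𝒜 ρ 1 b * tmul 𝒜 ρ 1 b' = tmul 𝒜 ρ 1 (b * b') := by
  refine (symbolMul_tmul 𝒜 ρ 1 (SetLike.one_mem_graded 𝒜) b b').trans ?_
  simp [tmul]

/-- The skew-commutation relation of the symbol. -/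
theorem SymbolAlgebra.skew_comm (ω : R) {i : ZMod m} {s : S} (hs : s ∈ 𝒜 i) {b : B}
    (hb : ρ (Multiplicative.ofAdd 1) b = ω • b) :
    tmul 𝒜 ρ 1 b * tmul 𝒜 ρ s 1 = ω ^ i.val • (tmul 𝒜 ρ s 1 * tmul 𝒜 ρ 1 b) := by
  have key : ∀ n : ℕ, ρ (Multiplicative.ofAdd (n : ZMod m)) b = ω ^ n • b := by
    intro n
    induction n with
    | zero => simp
    | succ n ih =>
      rw [Nat.cast_succ, ofAdd_add, map_mul, AlgEquiv.mul_apply, hb, map_smul, ih, smul_smul,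
        pow_succ']
  have h2 := key i.val
  rw [ZMod.natCast_zmod_val] at h2
  rw [mul_eq_tmul]
  refine (symbolMul_tmul 𝒜 ρ 1 hs b 1).trans ?_
  rw [h2, one_mul, mul_one]
  exact TensorProduct.tmul_smul _ s b

end SymbolAlgebra

section Resolution

open CategoryTheory Limits AlgebraicGeometry

universe u

/-- The projective line over a field. -/
noncomputable def projectiveLine (k : Type u) [Field k] : Scheme.{u} :=
  letI := MvPolynomial.gradedAlgebra (σ := Fin 2) (R := k)
  Proj (MvPolynomial.homogeneousSubmodule (Fin 2) k)

/-- The structure morphism of the projective line. -/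
noncomputable def projectiveLine.toSpec (k : Type u) [Field k] :
    projectiveLine k ⟶ Spec (CommRingCat.of k) :=
  letI := MvPolynomial.gradedAlgebra (σ := Fin 2) (R := k)
  Proj.toSpecZero (MvPolynomial.homogeneousSubmodule (Fin 2) k) ≫
    Spec.map (CommRingCat.ofHom
      (algebraMap k (MvPolynomial.homogeneousSubmodule (Fin 2) k 0)))

/-- The dimension over `k` of `𝒪_{P, x} / (a)`, for a `k`-scheme `P` and `a ∈ 𝒪_{P, x}`. When `P` is
an integral curve and `a ≠ 0`, this is `[κ(x) : k]` times the order of vanishing of `a` at `x`. -/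
noncomputable def localDegree {k : Type u} [Field k] {P : Scheme.{u}}
    (g : P ⟶ Spec (CommRingCat.of k)) (x : P) (a : P.presheaf.stalk x) : ℕ :=
  letI := ((Scheme.ΓSpecIso (CommRingCat.of k)).inv ≫ g.appTop ≫
    P.presheaf.germ ⊤ x trivial).hom.toAlgebra
  Module.finrank k (P.presheaf.stalk x ⧸ Ideal.span {a})

/-- `E² = n` for a proper integral curve `E` over `k`, embedded by `ι` in the regular surface `X`.
Choose a rational function `h` on `X` with a simple zero along `E`, and at each point `x` of `E` a
local equation `π` of `E`. Then `h = π a / b` with `a`, `b` regular at `x` and not vanishing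
identically on `E`. So `h` restricts to a rational section of the invertible sheaf `𝒪_X(-E)|_E`,
whose order at `x` is the order of `a / b` on `E`. The degree of this sheaf is the sum of these
orders, weighted by the residue degrees, and `n` is minus this degree. In other words,
`div h = E + D` where `E` is not a component of `D`, and `n = - D.E`. -/
def HasSelfIntersection {k : Type u} [Field k] {E X : Scheme.{u}} [IsIntegral X]
    (g : E ⟶ Spec (CommRingCat.of k)) (ι : E ⟶ X) (n : ℤ) : Prop :=
  ∃ (h : X.functionField) (π a b : ∀ x : E, X.presheaf.stalk (ι x)),
    (∀ x, RingHom.ker (ι.stalkMap x).hom = Ideal.span {π x}) ∧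
    (∀ x, (ι.stalkMap x).hom (a x) ≠ 0 ∧ (ι.stalkMap x).hom (b x) ≠ 0 ∧
      h * algebraMap _ X.functionField (b x) = algebraMap _ X.functionField (π x * a x)) ∧
    n = -∑ᶠ x : E, ((localDegree g x ((ι.stalkMap x).hom (a x)) : ℤ) -
      localDegree g x ((ι.stalkMap x).hom (b x)))

/-- The complement of the closed point in the spectrum of a local ring. -/
noncomputable def puncturedSpec (R : Type u) [CommRing R] [IsLocalRing R] : (Spec (CommRingCat.of R)).Opens :=
  ⟨{IsLocalRing.closedPoint R}ᶜ, (IsLocalRing.isClosed_singleton_closedPoint R).isOpen_compl⟩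

/-- The cohomology group `H¹(X, 𝒪_X)`. -/
abbrev structureSheafH1 (X : Scheme.{u}) : Type u :=
  ((sheafCompose _ (forget₂ CommRingCat.{u} RingCat.{u} ⋙
    forget₂ RingCat.{u} AddCommGrpCat.{u})).obj X.sheaf).H 1

/-- A resolution exhibiting a two-dimensional normal local ring `R` with residue field `κ` as a
`κ`-rational Hirzebruch-Jung singularity: a rational minimal resolution `f : X ⟶ Spec R` whose
exceptional locus is a string of curves `E 0, …, E r` isomorphic to the projective line over `κ`,
consecutive ones meeting (scheme-theoretically) in one `κ`-rational point. -/
structure HirzebruchJungResolution (R : Type u) [CommRing R] [IsLocalRing R] where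
  /-- The resolution. -/
  X : Scheme.{u}
  /-- The resolution morphism. -/
  f : X ⟶ Spec (CommRingCat.of R)
  isIntegral : IsIntegral X
  isProper : IsProper f
  isRegular : ∀ x : X, IsRegularLocalRing (X.presheaf.stalk x)
  /-- `f` is an isomorphism away from the closed point. -/
  isIso_restrict : IsIso (f ∣_ puncturedSpec R)
  /-- The resolution is rational. -/
  isRational : Subsingleton (structureSheafH1 X)
  /-- The number of exceptional curves is `r + 1`. -/
  r : ℕ
  /-- The exceptional curves, as closed embeddings of the projective line in `X`. -/
  E : Fin (r + 1) → (projectiveLine (IsLocalRing.ResidueField R) ⟶ X)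
  isClosedImmersion_E : ∀ i, IsClosedImmersion (E i)
  /-- The `E i` lie over the closed point, and the isomorphism with the projective line is one of
  schemes over `κ`. -/
  E_comp_f : ∀ i, E i ≫ f = projectiveLine.toSpec (IsLocalRing.ResidueField R) ≫
    Spec.map (CommRingCat.ofHom (IsLocalRing.residue R))
  /-- The `E i` cover the fibre over the closed point. -/
  exists_mem_E : ∀ x : X, f x = IsLocalRing.closedPoint R → ∃ i, x ∈ Set.range (E i)
  /-- `E i ∩ E (i + 1)` is a single reduced `κ`-rational point. -/
  isIso_inter : ∀ i : Fin r, IsIso (pullback.fst (E i.castSucc) (E i.succ) ≫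
    projectiveLine.toSpec (IsLocalRing.ResidueField R))
  /-- There are no other intersections. -/
  disjoint : ∀ i j : Fin (r + 1), i.val + 1 < j.val → Disjoint (Set.range (E i)) (Set.range (E j))
  /-- The self-intersection numbers `E i ²`. -/
  selfInt : Fin (r + 1) → ℤ
  hasSelfInt : ∀ i, HasSelfIntersection (projectiveLine.toSpec (IsLocalRing.ResidueField R))
    (E i) (selfInt i)
  /-- The resolution is minimal: there are no `(-1)`-curves. -/
  isMinimal : ∀ i, selfInt i ≠ -1

namespace HirzebruchJungResolution

variable {R : Type u} [CommRing R] [IsLocalRing R] (𝓧 : HirzebruchJungResolution R)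

/-- The determinant of the negative of the intersection matrix of the exceptional curves. -/
def det : ℤ :=
  Matrix.det (-(Matrix.of fun i j : Fin (𝓧.r + 1) =>
    if i = j then 𝓧.selfInt i else if i.val + 1 = j.val ∨ j.val + 1 = i.val then 1 else 0))

/-- An irreducible curve `E₀` on the resolution which is not exceptional, which meets the first
exceptional curve (scheme-theoretically) in a single `κ`-rational point, and which is disjoint
from the other ones. -/
structure TransversalCurve where
  /-- The curve. -/
  E₀ : Scheme.{u}
  /-- The embedding of the curve in the resolution. -/
  ι : E₀ ⟶ 𝓧.X
  isIntegral : IsIntegral E₀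
  isClosedImmersion : IsClosedImmersion ι
  /-- The image of `E₀` in the spectrum of `R` is a prime divisor. -/
  height_eq_one : Ideal.height
    (PrimeSpectrum.asIdeal (𝓧.f (ι (genericPoint E₀)) : PrimeSpectrum R)) = 1
  isIso_inter : IsIso (pullback.snd ι (𝓧.E 0) ≫
    projectiveLine.toSpec (IsLocalRing.ResidueField R))
  disjoint : ∀ i, i ≠ 0 → Disjoint (Set.range ι) (Set.range (𝓧.E i))

/-- The height one prime ideal of `R` whose prime divisor is `f_* E₀`. -/
noncomputable def TransversalCurve.prime {𝓧 : HirzebruchJungResolution R} (C : 𝓧.TransversalCurve) : Ideal R :=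
  haveI := C.isIntegral
  PrimeSpectrum.asIdeal (𝓧.f (C.ι (genericPoint C.E₀)) : PrimeSpectrum R)

instance {𝓧 : HirzebruchJungResolution R} (C : 𝓧.TransversalCurve) : C.prime.IsPrime :=
  PrimeSpectrum.isPrime _

end HirzebruchJungResolution

end Resolution

section CyclicExtension

/-- The cyclic étale extension `B` of a Henselian local ring `R` that corresponds to the cyclic
extension `L` of degree `m` of the residue field `κ` of `R`, with the action `τ` of `ℤ/m` on `L`:
`B` is a finite étale `R`-algebra with an action `ρ` of `ℤ/m`, with an equivariant
isomorphism of `κ ⊗ B` with `L`, induced by the surjection `red`. -/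
structure IsCyclicEtaleLift {R : Type*} [CommRing R] [IsLocalRing R] {m : ℕ}
    {L : Type*} [Field L] [Algebra (IsLocalRing.ResidueField R) L] [Algebra R L]
    (τ : Multiplicative (ZMod m) ≃* (L ≃ₐ[IsLocalRing.ResidueField R] L))
    {B : Type*} [CommRing B] [Algebra R B] (ρ : Multiplicative (ZMod m) →* (B ≃ₐ[R] B))
    (red : B →ₐ[R] L) : Prop where
  finite : Module.Finite R B
  etale : Algebra.Etale R B
  surjective : Function.Surjective red
  ker_eq : RingHom.ker red = (IsLocalRing.maximalIdeal R).map (algebraMap R B)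
  equivariant : ∀ g b, red (ρ g b) = τ g (red b)

end CyclicExtension

section Orders

open TensorProduct

/-- `A` is an `R`-order in the `K`-algebra `Q`, where `K` is the field of fractions of `R`. -/
def IsROrder (R K : Type*) {Q : Type*} [CommRing R] [Field K] [Ring Q] [Algebra R Q]
    [Algebra K Q] (A : Subalgebra R Q) : Prop :=
  A.toSubmodule.FG ∧ Submodule.span K (A : Set Q) = ⊤

/-- `A` is a maximal `R`-order in the `K`-algebra `Q`. -/
def IsMaximalROrder (R K : Type*) {Q : Type*} [CommRing R] [Field K] [Ring Q] [Algebra R Q]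
    [Algebra K Q] (A : Subalgebra R Q) : Prop :=
  IsROrder R K A ∧ ∀ A₁ : Subalgebra R Q, IsROrder R K A₁ → A ≤ A₁ → A₁ = A

/-- The `R`-algebra `A` is a maximal order in a division ring: it is torsion-free over `R`,
`Q = K ⊗ A` is a division ring, finite-dimensional over its center `K`, where `K` is the field of
fractions of `R`, and `A` is a maximal `R`-order in `Q`. -/
structure IsMaximalOrderInDivisionRing (R A : Type*) [CommRing R] [IsDomain R] [Ring A]
    [Algebra R A] : Prop where
  nontrivial : Nontrivial (FractionRing R ⊗[R] A)
  exists_inv : ∀ x : FractionRing R ⊗[R] A, x ≠ 0 → ∃ y, x * y = 1 ∧ y * x = 1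
  isCentral : Algebra.IsCentral (FractionRing R) (FractionRing R ⊗[R] A)
  finiteDimensional : FiniteDimensional (FractionRing R) (FractionRing R ⊗[R] A)
  injective : Function.Injective
    (Algebra.TensorProduct.includeRight : A →ₐ[R] FractionRing R ⊗[R] A)
  isMaximal : IsMaximalROrder R (FractionRing R)
    (Algebra.TensorProduct.includeRight : A →ₐ[R] FractionRing R ⊗[R] A).range

/-- The `R`-algebra `A` is Azumaya in codimension one: its localization at each prime ideal of
height one is an Azumaya algebra. -/
def IsAzumayaInCodimOne (R A : Type*) [CommRing R] [Ring A] [Algebra R A] : Prop :=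
  ∀ (p : Ideal R) [p.IsPrime], p.height = 1 →
    IsAzumaya (Localization.AtPrime p) (Localization.AtPrime p ⊗[R] A)

end Orders

/-! ### Roots of unity and eigenprojections of conjugation -/

section Conjugation

/-! Over the field of fractions `K` the algebra is a symbol algebra. Kummer theory over `κ` and
Hensel's lemma give `R̃ = R[b]` with `b ^ m = u` a unit of `R`, so that `K ⊗ Δ` has the basis `tⁱ
bᵏ` with `t ^ m = w⁻¹` and `b t = ζ t b` (`IsCyclicEtaleLift.exists_kummerGenerator`,
`exists_generic_isSymbolPair`). Since `m` is invertible in `R`, averaging conjugates under powers of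
`t` and `b` extracts the terms of an element in this basis. This device carries linear independence,
the Azumaya property and maximality.

Azumaya in codimension one: at a height one prime the symbolic powers of `q` become the powers of a
single element `π`. Hence `Δ` becomes the symbol algebra on `x = π t` and `b`, where `x ^ m = π ^ m
/ w` and `b ^ m = u` are both units. Such an algebra is Azumaya (`IsSymbolPair.isAzumaya`).

Maximality: let an order contain `Δ`, and let `c tⁱ bᵏ` be a term of one of its elements. The order
contains the part of this element of degree `i` in `t`. Multiply it by `a t ^ (m - i)` with `a` in
`q⁽ᵐ⁻ⁱ⁾` and by `b⁻ᵏ`. The result is an integral element of `K[b]` with constant term `a c / w`, and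
this term is then integral, so in `R` by normality. Letting `a` vary gives `c ∈ q⁽ⁱ⁾`, as can be
checked at the height one primes (`IsSymbolPair.mem_of_mem_order`).

Division ring: it suffices that `K ⊗ Δ`, being finite-dimensional over `K`, has no zero divisors.
This follows from a discrete valuation of `K` with uniformizer `w` over whose residue field the
powers `1, …, α ^ (m - 1)` of an `m`-th root `α` of `u` remain independent: one slot is then totally
ramified and the other unramified of full degree, and leading terms multiply without cancellation
(`IsSymbolPair.noZeroDivisors`).

The valuation is that of the last exceptional curve. Its residue field is the function field of the
projective line over `κ`, over which `α` keeps its degree. To see that `w` vanishes to order one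
along this curve, note that the zeros of `w` on the resolution lie on `E₀`, with order `m`, and on
the exceptional curves, with orders `a i`. A principal divisor has degree zero on each exceptional
curve (`HasSelfIntersection.mul_add_finsum_eq_zero`). So the negative `M` of the intersection matrix
satisfies `M a = m e` with `e` the first unit vector, and `det M = m` makes the last entry of `a` a
cofactor of `M`. Its minor is triangular with `-1` on the diagonal, and with the sign it equals `1`
(`last_eq_one_of_string`). The degree computation needs the theory of divisors on the projective
line (`ProjectiveLineCharts.hasDegreeZero`), the transversality of the curves
(`MeetsInRationalPoint.exists_eq_add`) and a factorization of `w` at each point of an exceptional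
curve (`exists_factorization`). -/

/-- `ζ` is an `m`-th root of unity in `R` that satisfies the character sum relations,
and `m` is invertible in `R`. -/
structure IsCharRoot {R : Type*} [CommRing R] (m : ℕ) (ζ : R) : Prop where
  isUnit : IsUnit (m : R)
  pow_eq : ζ ^ m = 1
  sum_eq : ∀ k : ℕ, ¬ m ∣ k → ∑ j ∈ Finset.range m, ζ ^ (j * k) = 0

/-- Primitivity of a root of unity can be lost under a ring homomorphism, but the character sum
relations persist. This is the reason for the notion. -/
theorem IsCharRoot.map {R S : Type*} [CommRing R] [CommRing S] {m : ℕ} {ζ : R}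
    (h : IsCharRoot m ζ) (f : R →+* S) : IsCharRoot m (f ζ) where
  isUnit := by simpa using h.isUnit.map f
  pow_eq := by rw [← map_pow, h.pow_eq, map_one]
  sum_eq k hk := by simpa using congrArg f (h.sum_eq k hk)

theorem IsCharRoot.of_isPrimitiveRoot {R : Type*} [CommRing R] [IsDomain R] {m : ℕ} {ζ : R}
    (h : IsPrimitiveRoot ζ m) (hm : IsUnit (m : R)) : IsCharRoot m ζ where
  isUnit := hm
  pow_eq := h.pow_eq_one
  sum_eq k hk := by
    have h1 : ζ ^ k ≠ 1 := fun h' => hk (h.dvd_of_pow_eq_one k h')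
    have h2 := mul_neg_geom_sum (ζ ^ k) m
    rw [← pow_mul, mul_comm k m, pow_mul, h.pow_eq_one, one_pow, sub_self] at h2
    have := (mul_eq_zero.mp h2).resolve_left (sub_ne_zero.mpr h1.symm)
    simpa [← pow_mul, mul_comm] using this

variable {R A : Type*} [CommRing R] [Ring A] [Algebra R A] {m : ℕ} {ζ : R}

/-- The projection onto the `ζ ^ n`-eigenspace of conjugation by `g`. -/
noncomputable def conjProj (h : IsCharRoot m ζ) (g : Aˣ) (n : ℕ) (z : A) : A :=
  ((h.isUnit.unit⁻¹ : Rˣ) : R) • ∑ j ∈ Finset.range m,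
    ζ ^ (j * (m - n)) • ((g ^ j : Aˣ) * z * ((g ^ j)⁻¹ : Aˣ))

theorem conj_pow_eq {g : Aˣ} {z : A} {c : R} (h : g * z = c • (z * g)) (j : ℕ) :
    (g ^ j : Aˣ) * z * ((g ^ j)⁻¹ : Aˣ) = c ^ j • z := by
  rw [Units.mul_inv_eq_iff_eq_mul]
  induction j with
  | zero => simp
  | succ j ih =>
    rw [pow_succ, Units.val_mul, mul_assoc, h, mul_smul_comm, ← mul_assoc, ih, pow_succ']
    simp [mul_assoc, mul_smul]

/-- Orthogonality of characters. In `conjProj` the exponent `m - n` plays the role of `-n`, as `ζ ^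
m = 1`. -/
theorem conjProj_sum (h : IsCharRoot m ζ) (g : Aˣ) (z : Fin m → A)
    (hz : ∀ i, g * z i = ζ ^ (i : ℕ) • (z i * g)) (n : Fin m) :
    conjProj h g n (∑ i, z i) = z n := by
  have hm : ∑ j ∈ Finset.range m, ζ ^ (j * (m - n)) • ((g ^ j : Aˣ) * (∑ i, z i) * ((g ^ j)⁻¹ : Aˣ)) =
      (m : R) • z n := by
    simp only [Finset.mul_sum, Finset.sum_mul, Finset.smul_sum]
    rw [Finset.sum_comm, Finset.sum_eq_single n]
    · have : ∀ j ∈ Finset.range m, ζ ^ (j * (m - n)) • (((g ^ j : Aˣ) : A) * z n * ((g ^ j)⁻¹ : Aˣ)) = z n := by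
        intro j _
        rw [conj_pow_eq (hz n), smul_smul, ← pow_mul, mul_comm (n : ℕ) j, ← pow_add, ← mul_add,
          Nat.sub_add_cancel n.2.le, mul_comm, pow_mul, h.pow_eq, one_pow, one_smul]
      rw [Finset.sum_congr rfl this]
      simp [Nat.cast_smul_eq_nsmul]
    · intro i _ hi
      have : ∀ j ∈ Finset.range m, ζ ^ (j * (m - n)) • (((g ^ j : Aˣ) : A) * z i * ((g ^ j)⁻¹ : Aˣ)) =
          ζ ^ (j * (m - n + i)) • z i := by
        intro j _
        rw [conj_pow_eq (hz i), smul_smul, ← pow_mul, mul_comm (i : ℕ) j, ← pow_add, ← mul_add]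
      rw [Finset.sum_congr rfl this, ← Finset.sum_smul, h.sum_eq, zero_smul]
      -- The number `m - n + i` lies strictly between `0` and `2 * m`. If it is a multiple of `m`,
      -- it is `m` itself, and then `i = n`.
      rintro ⟨c, hc⟩
      have h1 := n.2
      have h2 := i.2
      apply hi
      ext
      have hc0 : c ≠ 0 := by rintro rfl; omega
      have hc2 : c < 2 := by
        by_contra hc2
        have : m * 2 ≤ m * c := Nat.mul_le_mul_left m (by omega)
        omega
      have : c = 1 := by omega
      subst this
      omega
    · simp
  rw [conjProj, hm, smul_smul]
  simp

end Conjugation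

/-! ### Symbol algebras with unit slots are Azumaya -/

section Symbol

variable {R A : Type*} [CommRing R] [Ring A] [Algebra R A] {m : ℕ} {ζ : R}

/-- `x` and `y` are units of `A` that generate `A` as a symbol algebra of degree `m`. -/
structure IsSymbolPair (m : ℕ) (ζ : R) (x y : Aˣ) : Prop where
  charRoot : IsCharRoot m ζ
  comm : (y * x : A) = ζ • (x * y : A)
  span : ⊤ ≤ Submodule.span R (Set.range fun p : Fin m × Fin m => (x ^ (p.1 : ℕ) * y ^ (p.2 : ℕ) : A))

theorem pow_mul_eq_smul {x y : A} {c : R} (h : y * x = c • (x * y)) (j : ℕ) :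
    y ^ j * x = c ^ j • (x * y ^ j) := by
  induction j with
  | zero => simp
  | succ j ih =>
    rw [pow_succ', mul_assoc, ih, mul_smul_comm, ← mul_assoc, h, smul_mul_assoc, smul_smul,
      ← pow_succ, mul_assoc]

theorem mul_pow_eq_smul {x y : A} {c : R} (h : y * x = c • (x * y)) (j : ℕ) :
    y * x ^ j = c ^ j • (x ^ j * y) := by
  induction j with
  | zero => simp
  | succ j ih =>
    rw [pow_succ, ← mul_assoc, ih, smul_mul_assoc, mul_assoc, h, mul_smul_comm, smul_smul,
      ← pow_succ, ← mul_assoc]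

namespace IsSymbolPair

variable {x y : Aˣ} (h : IsSymbolPair m ζ x y)
include h

theorem exists_coeff (z : A) : ∃ c : Fin m × Fin m → R,
    z = ∑ p, c p • (x ^ (p.1 : ℕ) * y ^ (p.2 : ℕ) : A) := by
  have := h.span (Submodule.mem_top : z ∈ ⊤)
  obtain ⟨c, hc⟩ := (Submodule.mem_span_range_iff_exists_fun R).mp this
  exact ⟨c, hc.symm⟩

/-- The monomials are common eigenvectors of conjugation by `y` and by `x⁻¹`, with eigenvalues `ζ ^
i` and `ζ ^ k`. So the two families of projections together isolate a single monomial. -/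
theorem conj_y (i k : ℕ) : (y : A) * (x ^ i * y ^ k) = ζ ^ i • ((x ^ i * y ^ k) * y) := by
  rw [← mul_assoc, mul_pow_eq_smul h.comm, smul_mul_assoc, mul_assoc, mul_assoc,
    ← pow_succ, ← pow_succ']

theorem conj_x (i k : ℕ) :
    ((x⁻¹ : Aˣ) : A) * (x ^ i * y ^ k) = ζ ^ k • ((x ^ i * y ^ k) * (x⁻¹ : Aˣ)) := by
  rw [Units.inv_mul_eq_iff_eq_mul, mul_smul_comm, ← mul_assoc, ← smul_mul_assoc,
    Units.eq_mul_inv_iff_mul_eq, mul_assoc, pow_mul_eq_smul h.comm, mul_smul_comm, ← mul_assoc,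
    ← mul_assoc, ← pow_succ, ← pow_succ']

theorem conjProj_y (c : Fin m × Fin m → R) (i : Fin m) :
    conjProj h.charRoot y i (∑ p, c p • (x ^ (p.1 : ℕ) * y ^ (p.2 : ℕ) : A)) =
      ∑ k : Fin m, c (i, k) • (x ^ (i : ℕ) * y ^ (k : ℕ) : A) := by
  rw [Fintype.sum_prod_type]
  refine conjProj_sum h.charRoot y (fun i => ∑ k, c (i, k) • (x ^ (i : ℕ) * y ^ (k : ℕ) : A)) ?_ i
  intro i
  simp only [Finset.mul_sum, Finset.sum_mul, Finset.smul_sum, mul_smul_comm, smul_mul_assoc, h.conj_y]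
  refine Finset.sum_congr rfl fun k _ => ?_
  rw [smul_comm]

theorem conjProj_x (c : Fin m → R) (i : ℕ) (k : Fin m) :
    conjProj h.charRoot x⁻¹ k (∑ k : Fin m, c k • (x ^ i * y ^ (k : ℕ) : A)) =
      c k • (x ^ i * y ^ (k : ℕ) : A) := by
  refine conjProj_sum h.charRoot x⁻¹ (fun k => c k • (x ^ i * y ^ (k : ℕ) : A)) ?_ k
  intro k
  rw [mul_smul_comm, h.conj_x, smul_mul_assoc, smul_comm]

/-- The two projections isolate one term of a linear relation. The monomial in it is a unit, so its
coefficient acts as zero on `1`. -/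
theorem linearIndependent [FaithfulSMul R A] :
    LinearIndependent R (fun p : Fin m × Fin m => (x ^ (p.1 : ℕ) * y ^ (p.2 : ℕ) : A)) := by
  rw [Fintype.linearIndependent_iff]
  rintro c hc ⟨i, k⟩
  have h1 := h.conjProj_y c i
  have h2 := h.conjProj_x (fun k => c (i, k)) i k
  rw [← h1, hc] at h2
  have h3 : c (i, k) • (x ^ (i : ℕ) * y ^ (k : ℕ) : A) = 0 := by
    rw [← h2]; simp [conjProj]
  have h4 : c (i, k) • (1 : A) = 0 := by
    have := congrArg (· * (((x ^ (i : ℕ) * y ^ (k : ℕ))⁻¹ : Aˣ) : A)) h3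
    simpa [← Units.val_pow_eq_pow_val, ← Units.val_mul] using this
  rwa [← Algebra.algebraMap_eq_smul_one, FaithfulSMul.algebraMap_eq_zero_iff] at h4

/-- The basis `xⁱ yᵏ`. -/
noncomputable def basis [FaithfulSMul R A] : Module.Basis (Fin m × Fin m) R A :=
  Module.Basis.mk h.linearIndependent h.span

theorem basis_apply [FaithfulSMul R A] (p : Fin m × Fin m) :
    h.basis p = (x ^ (p.1 : ℕ) * y ^ (p.2 : ℕ) : A) := Module.Basis.mk_apply _ _ _

/-- Extracting a term is a combination of two-sided multiplications. This is what places every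
endomorphism of `A` in the image of `A ⊗ Aᵐᵒᵖ`. -/
theorem basis_repr_conj [FaithfulSMul R A] (z : A) (i k : Fin m) :
    conjProj h.charRoot x⁻¹ k (conjProj h.charRoot y i z) =
      h.basis.repr z (i, k) • (x ^ (i : ℕ) * y ^ (k : ℕ) : A) := by
  conv_lhs => rw [← h.basis.sum_repr z]
  simp only [basis_apply]
  rw [h.conjProj_y, h.conjProj_x]

open TensorProduct in
-- An endomorphism `f` is the sum over the basis monomials `e` of the extraction of the `e`-term
-- followed by left multiplication by `f(e) e⁻¹`, so `A ⊗ Aᵐᵒᵖ` maps onto `End A`. Injectivity is a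
-- rank count.
theorem isAzumaya [FaithfulSMul R A] : IsAzumaya R A := by
  have : Module.Finite R A := Module.Finite.of_basis h.basis
  have : Module.Free R A := Module.Free.of_basis h.basis
  let T := (AlgHom.mulLeftRight R A).range
  have hL : ∀ a b : A, (LinearMap.mulLeft R a ∘ₗ LinearMap.mulRight R b : Module.End R A) ∈ T := by
    intro a b
    refine ⟨a ⊗ₜ MulOpposite.op b, ?_⟩
    ext z
    simp [AlgHom.mulLeftRight_apply, mul_assoc]
  have hconj : ∀ (g : Aˣ) (n : ℕ) , ∃ f ∈ T, ∀ z, f z = conjProj h.charRoot g n z := by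
    intro g n
    refine ⟨((h.charRoot.isUnit.unit⁻¹ : Rˣ) : R) • ∑ j ∈ Finset.range m,
      ζ ^ (j * (m - n)) • (LinearMap.mulLeft R ((g ^ j : Aˣ) : A) ∘ₗ
        LinearMap.mulRight R (((g ^ j)⁻¹ : Aˣ) : A)), ?_, ?_⟩
    · exact T.smul_mem (sum_mem fun j _ => T.smul_mem (hL _ _) _) _
    · intro z
      simp [conjProj, mul_assoc]
  choose F hFT hF using hconj
  have hsurj : Function.Surjective (AlgHom.mulLeftRight R A) := by
    intro f
    suffices f ∈ T from this
    have : f = ∑ p : Fin m × Fin m,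
        (LinearMap.mulLeft R (f (h.basis p) * (((x ^ (p.1 : ℕ) * y ^ (p.2 : ℕ))⁻¹ : Aˣ) : A)) ∘ₗ
          LinearMap.mulRight R 1) * (F x⁻¹ p.2 * F y p.1) := by
      ext z
      rw [LinearMap.sum_apply]
      conv_lhs => rw [← h.basis.sum_repr z, map_sum]
      refine Finset.sum_congr rfl fun p _ => ?_
      simp only [Module.End.mul_apply, hF, LinearMap.comp_apply, h.basis_repr_conj]
      simp only [map_smul, LinearMap.mulLeft_apply, LinearMap.mulRight_apply, mul_one]
      simp [← Units.val_pow_eq_pow_val, ← Units.val_mul, mul_assoc]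
    rw [this]
    exact sum_mem fun p _ => mul_mem (hL _ _) (mul_mem (hFT _ _) (hFT _ _))
  refine { bij := ⟨?_, hsurj⟩ }
  let b1 : Module.Basis ((Fin m × Fin m) × (Fin m × Fin m)) R (A ⊗[R] Aᵐᵒᵖ) :=
    h.basis.tensorProduct (h.basis.map (MulOpposite.opLinearEquiv R))
  let b2 : Module.Basis ((Fin m × Fin m) × (Fin m × Fin m)) R (Module.End R A) :=
    (Matrix.stdBasis R (Fin m × Fin m) (Fin m × Fin m)).map (LinearMap.toMatrix h.basis h.basis).symm
  -- Both modules are free with bases indexed by the same set. The surjection thus becomes a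
  -- surjective endomorphism of a finite module, which is injective.
  let e : Module.End R A ≃ₗ[R] A ⊗[R] Aᵐᵒᵖ := b2.equiv b1 (Equiv.refl _)
  have : Module.Finite R (A ⊗[R] Aᵐᵒᵖ) := Module.Finite.of_basis b1
  have hs : Function.Surjective (e.toLinearMap ∘ₗ (AlgHom.mulLeftRight R A).toLinearMap) := by
    simpa using e.surjective.comp hsurj
  have hi := OrzechProperty.injective_of_surjective_endomorphism _ hs
  intro a b hab
  apply hi
  simp only [LinearMap.comp_apply]
  exact congrArg _ hab

end IsSymbolPair

end Symbol

/-! ### Inverting a slot of a symbol algebra -/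

section Symbol

variable {R A : Type*} [CommRing R] [Ring A] [Algebra R A] {m : ℕ} {ζ : R}

theorem pow_mul_pow_eq_smul {x y : A} {c : R} (h : y * x = c • (x * y)) (j k : ℕ) :
    y ^ j * x ^ k = c ^ (j * k) • (x ^ k * y ^ j) := by
  rw [pow_mul]
  exact mul_pow_eq_smul (pow_mul_eq_smul h j) k

theorem IsCharRoot.of_mul_eq_one {ζ' : R} (h : IsCharRoot m ζ) (h' : ζ * ζ' = 1) :
    IsCharRoot m ζ' where
  isUnit := h.isUnit
  pow_eq := by
    have := congrArg (· ^ m) h'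
    simpa [mul_pow, h.pow_eq] using this
  sum_eq k hk := by
    rcases Nat.eq_zero_or_pos m with rfl | hm
    · simp
    -- Here `ζ'` is the inverse of `ζ`, and `m * k - k` represents `-k` modulo `m` by a natural
    -- number.
    have hinv : ∀ j, ζ' ^ (j * k) = ζ ^ (j * (m * k - k)) := by
      intro j
      have h1 : ζ ^ (j * k) * ζ' ^ (j * k) = 1 := by rw [← mul_pow, h', one_pow]
      have h2 : ζ ^ (j * k) * ζ ^ (j * (m * k - k)) = 1 := by
        rw [← pow_add, ← mul_add, Nat.add_sub_cancel' (Nat.le_mul_of_pos_left k hm),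
          mul_left_comm, pow_mul, h.pow_eq, one_pow]
      calc ζ' ^ (j * k) = ζ' ^ (j * k) * (ζ ^ (j * k) * ζ ^ (j * (m * k - k))) := by rw [h2, mul_one]
        _ = (ζ ^ (j * k) * ζ' ^ (j * k)) * ζ ^ (j * (m * k - k)) := by ring
        _ = _ := by rw [h1, one_mul]
    simp only [hinv]
    refine h.sum_eq _ fun hd => hk ?_
    have := Nat.dvd_sub (Dvd.intro k rfl : m ∣ m * k) hd
    rwa [Nat.sub_sub_self (Nat.le_mul_of_pos_left k hm)] at this

/-- The cover is defined by `t⁻ᵐ = w`, so the slot whose `m`-th power is the uniformizer `w` is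
`t⁻¹` rather than `t`. -/
theorem IsSymbolPair.inv_left [NeZero m] {x y : Aˣ} (h : IsSymbolPair m ζ x y) {ζ' : R}
    (h' : ζ * ζ' = 1) {u : R} (hu : (x ^ m : A) = algebraMap R A u) :
    IsSymbolPair m ζ' x⁻¹ y where
  charRoot := h.charRoot.of_mul_eq_one h'
  comm := by
    rw [← mul_smul_comm, Units.eq_inv_mul_iff_mul_eq, ← mul_assoc, Units.mul_inv_eq_iff_eq_mul,
      smul_mul_assoc, h.comm, smul_smul, mul_comm, h', one_smul]
  span := by
    refine h.span.trans (Submodule.span_le.mpr ?_)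
    rintro _ ⟨⟨i, k⟩, rfl⟩
    by_cases hi : (i : ℕ) = 0
    · refine Submodule.subset_span ⟨(i, k), ?_⟩
      simp [hi]
    -- A positive power of `x` is traded for a power of `x⁻¹` through `xⁱ = x ^ m x ^ (-(m - i))`.
    -- The exponent `i = 0` is separate because `m - 0` is out of range.
    · have hx : (x : A) ^ (i : ℕ) = u • ((x⁻¹ : Aˣ) : A) ^ (m - i) := by
        have h1 : ((x ^ (i : ℕ) : Aˣ) : A) = (x ^ m : Aˣ) * ((x⁻¹) ^ (m - (i : ℕ)) : Aˣ) := by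
          rw [← Units.val_mul]
          congr 1
          rw [inv_pow, eq_mul_inv_iff_mul_eq, ← pow_add, Nat.add_sub_cancel' i.2.le]
        rw [Units.val_pow_eq_pow_val, Units.val_pow_eq_pow_val, Units.val_pow_eq_pow_val, hu] at h1
        rw [h1, Algebra.smul_def]
      change (x : A) ^ (i : ℕ) * y ^ (k : ℕ) ∈ _
      rw [hx, smul_mul_assoc]
      exact Submodule.smul_mem _ _ (Submodule.subset_span
        ⟨(⟨m - i, by have := i.2; omega⟩, k), rfl⟩)

end Symbol

/-! ### Symbol algebras over a discretely valued field have no zero divisors -/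

section Division

variable {K A D : Type*} [Field K] [Ring A] [Algebra K A] [CommRing D]
  {m : ℕ} {V : Subring K} (ψ : V →+* D) {w u ζ : V} (y' : D) {τ y : Aˣ}

/-- The graph of reduction modulo `τ`, for the order generated over `V` by `τ` and `y`. -/
def symbolReduction (τ y : Aˣ) : AddSubgroup (A × D) :=
  AddSubgroup.closure (Set.range fun p : V × ℕ × ℕ =>
    ((p.1 : K) • (τ ^ p.2.1 * y ^ p.2.2 : A), ψ p.1 * 0 ^ p.2.1 * y' ^ p.2.2))

variable {y'}

/-- Reordering `yᵏ τᵉ` costs a power of `ζ`. This factor is invisible in the second coordinate: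
either `e = 0` and it is `1`, or the factor `0 ^ e` vanishes. -/
theorem symbolReduction_mul (hcomm : (y * τ : A) = (ζ : K) • (τ * y : A)) {a b : A × D}
    (ha : a ∈ symbolReduction ψ y' τ y) (hb : b ∈ symbolReduction ψ y' τ y) :
    a * b ∈ symbolReduction ψ y' τ y := by
  induction ha using AddSubgroup.closure_induction with
  | zero => rw [zero_mul]; exact zero_mem _
  | add a a' _ _ h h' => rw [add_mul]; exact add_mem h h'
  | neg a _ h => rw [neg_mul]; exact neg_mem h
  | mem a ha =>
    induction hb using AddSubgroup.closure_induction with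
    | zero => rw [mul_zero]; exact zero_mem _
    | add a a' _ _ h h' => rw [mul_add]; exact add_mem h h'
    | neg a _ h => rw [mul_neg]; exact neg_mem h
    | mem b hb =>
      obtain ⟨⟨v, e, k⟩, rfl⟩ := ha
      obtain ⟨⟨v', e', k'⟩, rfl⟩ := hb
      refine AddSubgroup.subset_closure ⟨(v * v' * ζ ^ (k * e'), e + e', k + k'), ?_⟩
      refine Prod.ext ?_ ?_
      · simp only [Prod.fst_mul]
        rw [smul_mul_smul_comm, mul_assoc ((τ : A) ^ e), ← mul_assoc ((y : A) ^ k),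
          pow_mul_pow_eq_smul hcomm]
        simp only [Subring.coe_mul, Subring.coe_pow, smul_mul_assoc, mul_smul_comm, smul_smul,
          pow_add, mul_assoc]
      · simp only [Prod.snd_mul, map_mul, map_pow]
        rcases Nat.eq_zero_or_pos e' with rfl | he'
        · simp [pow_add]; ring
        · simp [he'.ne']

/-- The relation is single-valued. After reduction of the exponents modulo `m`, both coordinates are
given by the same coefficients in `V`, and the first coordinate determines them because the
monomials are independent. -/
theorem symbolReduction_eq_zero [NeZero m] (h : IsSymbolPair m (ζ : K) τ y)
    (hτ : (τ ^ m : A) = algebraMap K A w) (hy : (y ^ m : A) = algebraMap K A u)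
    (hw : ψ w = 0) (hy' : y' ^ m = ψ u) [Nontrivial A]
    {d : D} (hd : ((0 : A), d) ∈ symbolReduction ψ y' τ y) : d = 0 := by
  have key : ∀ a ∈ symbolReduction ψ y' τ y, ∃ c : Fin m × Fin m → V,
      a.1 = ∑ p, (c p : K) • (τ ^ (p.1 : ℕ) * y ^ (p.2 : ℕ) : A) ∧
      a.2 = ∑ p, ψ (c p) * 0 ^ (p.1 : ℕ) * y' ^ (p.2 : ℕ) := by
    intro a ha
    induction ha using AddSubgroup.closure_induction with
    | zero => exact ⟨0, by simp, by simp⟩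
    | add a a' _ _ h h' =>
      obtain ⟨c, h1, h2⟩ := h
      obtain ⟨c', h1', h2'⟩ := h'
      refine ⟨c + c', ?_, ?_⟩
      · simp [h1, h1', add_smul, Finset.sum_add_distrib]
      · simp [h2, h2', add_mul, Finset.sum_add_distrib]
    | neg a _ h =>
      obtain ⟨c, h1, h2⟩ := h
      exact ⟨-c, by simp [h1], by simp [h2]⟩
    | mem a ha =>
      obtain ⟨⟨v, e, k⟩, rfl⟩ := ha
      have hm := Nat.pos_of_ne_zero (NeZero.ne m)
      -- The relations `τ ^ m = w` and `y ^ m = u` move full periods of the exponents into the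
      -- coefficient. This is compatible with `τ ↦ 0` because `ψ w = 0`.
      refine ⟨Pi.single (⟨e % m, Nat.mod_lt _ hm⟩, ⟨k % m, Nat.mod_lt _ hm⟩)
        (v * w ^ (e / m) * u ^ (k / m)), ?_, ?_⟩
      · rw [Finset.sum_eq_single (⟨e % m, Nat.mod_lt _ hm⟩, ⟨k % m, Nat.mod_lt _ hm⟩)]
        · simp only [Pi.single_eq_same]
          conv_lhs => rw [← Nat.div_add_mod e m, ← Nat.div_add_mod k m]
          rw [pow_add, pow_add, pow_mul, pow_mul, hτ, hy, ← map_pow, ← map_pow,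
            ← Algebra.smul_def, ← Algebra.smul_def, smul_mul_smul_comm, smul_smul]
          simp [mul_assoc]
        · intro p _ hp
          simp [Pi.single_eq_of_ne hp]
        · simp
      · rw [Finset.sum_eq_single (⟨e % m, Nat.mod_lt _ hm⟩, ⟨k % m, Nat.mod_lt _ hm⟩)]
        · simp only [Pi.single_eq_same]
          conv_lhs => rw [← Nat.div_add_mod e m, ← Nat.div_add_mod k m]
          rw [pow_add, pow_add, pow_mul, pow_mul, hy', zero_pow hm.ne']
          simp only [map_mul, map_pow, hw]
          ring
        · intro p _ hp
          simp [Pi.single_eq_of_ne hp]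
        · simp
  obtain ⟨c, h1, h2⟩ := key _ hd
  have h3 := Fintype.linearIndependent_iff.mp h.linearIndependent (fun p => (c p : K)) h1.symm
  have h4 : ∀ p, c p = 0 := fun p => Subtype.ext (h3 p)
  simpa [h4] using h2

/-- Every nonzero element has a nonzero leading term. With `τ` of value `1` and `w` of value `m`,
the term `c τⁱ yᵏ` has value `m n + i` where `n` is the order of `c`. Multiplying by a power of `τ`
brings the least value to zero, and only terms of least value survive reduction. -/
theorem exists_mul_mem_symbolReduction [NeZero m] (h : IsSymbolPair m (ζ : K) τ y)
    (hτ : (τ ^ m : A) = algebraMap K A w) 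
    (hw0 : (w : K) ≠ 0)
    (hV : ∀ z : K, z ≠ 0 → ∃ (n : ℤ) (v : V), ψ v ≠ 0 ∧ z = (w : K) ^ n * v)
    (hli : ∀ g : Fin m → V, ∑ k, ψ (g k) * y' ^ (k : ℕ) = 0 → ∀ k, ψ (g k) = 0)
    {z : A} (hz : z ≠ 0) : ∃ (N : ℤ) (d : D), d ≠ 0 ∧
      (((τ ^ N : Aˣ) : A) * z, d) ∈ symbolReduction ψ y' τ y := by
  classical
  obtain ⟨c, hc⟩ := h.exists_coeff z
  have hV' : ∀ z : K, ∃ (n : ℤ) (v : V), z = (w : K) ^ n * v ∧ (z ≠ 0 → ψ v ≠ 0) ∧ (z = 0 → v = 0) := by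
    intro z
    by_cases hz : z = 0
    · exact ⟨0, 0, by simp [hz], by simp [hz], by simp⟩
    · obtain ⟨n, v, h1, h2⟩ := hV z hz
      exact ⟨n, v, h2, fun _ => h1, fun h => absurd h hz⟩
  choose n v hnv hv hv0 using fun p => hV' (c p)
  let s : Finset (Fin m × Fin m) := Finset.univ.filter fun p => c p ≠ 0
  have hs : s.Nonempty := by
    by_contra hs
    rw [Finset.not_nonempty_iff_eq_empty, Finset.filter_eq_empty_iff] at hs
    apply hz
    rw [hc]
    exact Finset.sum_eq_zero fun p hp => by simp [not_not.mp (hs hp)]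
  let e : Fin m × Fin m → ℤ := fun p => m * n p + p.1
  obtain ⟨p₀, hp₀, hmin⟩ := Finset.exists_min_image s e hs
  have hτz : ∀ k : ℤ, ((τ ^ ((m : ℤ) * k) : Aˣ) : A) = algebraMap K A ((w : K) ^ k) := by
    intro k
    have h1 : τ ^ m = Units.map (algebraMap K A).toMonoidHom (Units.mk0 (w : K) hw0) :=
      Units.ext (by simpa using hτ)
    rw [zpow_mul, zpow_natCast, h1, ← map_zpow, Units.coe_map, Units.val_zpow_eq_zpow_val]
    rfl
  have hterm : ∀ p, ((τ ^ (-e p₀) : Aˣ) : A) * (c p • (τ ^ (p.1 : ℕ) * y ^ (p.2 : ℕ) : A)) =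
      (v p : K) • (((τ ^ (e p - e p₀) : Aˣ) : A) * y ^ (p.2 : ℕ)) := by
    intro p
    have h1 : τ ^ (e p - e p₀) = τ ^ ((m : ℤ) * n p) * (τ ^ (-e p₀) * τ ^ (p.1 : ℕ)) := by
      rw [← zpow_natCast, ← zpow_add, ← zpow_add]
      congr 1
      simp only [e]
      ring
    rw [h1, Units.val_mul, hτz, ← Algebra.smul_def, smul_mul_assoc, smul_smul, mul_comm _ ((w : K) ^ n p),
      ← hnv p, mul_smul_comm]
    simp [mul_assoc]
  let d : Fin m × Fin m → D := fun p =>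
    if c p ≠ 0 then ψ (v p) * 0 ^ (e p - e p₀).toNat * y' ^ (p.2 : ℕ) else 0
  have hmem : ∀ p, (((τ ^ (-e p₀) : Aˣ) : A) * (c p • (τ ^ (p.1 : ℕ) * y ^ (p.2 : ℕ) : A)), d p) ∈
      symbolReduction ψ y' τ y := by
    intro p
    by_cases hp : c p = 0
    · have : d p = 0 := by simp [d, hp]
      rw [this, hp, zero_smul, mul_zero]
      exact zero_mem _
    · refine AddSubgroup.subset_closure ⟨(v p, (e p - e p₀).toNat, p.2), ?_⟩
      have hle : e p₀ ≤ e p := hmin p (by simpa [s] using hp)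
      simp only [d, hp, ne_eq, not_false_eq_true, if_true, hterm, Prod.mk.injEq, and_true]
      congr 2
      rw [← Units.val_pow_eq_pow_val]
      congr 1
      rw [← zpow_natCast, Int.toNat_of_nonneg (by omega)]
  refine ⟨-e p₀, ∑ p, d p, ?_, ?_⟩
  · intro h0
    -- Terms of equal value have the same exponent of `τ`, namely the value modulo `m`. Only one row
    -- therefore contributes to the leading term, and `hli` applies to that row.
    have hdi : ∀ i k, i ≠ p₀.1 → d (i, k) = 0 := by
      intro i k hi
      simp only [d]
      split_ifs with hp
      · have hne : e (i, k) ≠ e p₀ := by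
          intro he
          simp only [e] at he
          have h1 : (i : ℤ) = p₀.1 := by
            have a1 : ((m : ℤ) * n (i, k) + (i : ℕ)) % m = (i : ℕ) := by
              rw [Int.add_comm, Int.add_mul_emod_self_left]
              exact Int.emod_eq_of_lt (by omega) (by have := i.2; omega)
            have a2 : ((m : ℤ) * n p₀ + (p₀.1 : ℕ)) % m = (p₀.1 : ℕ) := by
              rw [Int.add_comm, Int.add_mul_emod_self_left]
              exact Int.emod_eq_of_lt (by omega) (by have := p₀.1.2; omega)
            rw [← a1, ← a2, he]
          exact hi (Fin.ext (by exact_mod_cast h1))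
        have hle : e p₀ ≤ e (i, k) := hmin _ (by simpa [s] using hp)
        have : (e (i, k) - e p₀).toNat ≠ 0 := by omega
        rw [zero_pow this]
        simp
      · rfl
    rw [Fintype.sum_prod_type, Finset.sum_eq_single p₀.1 (fun i _ hi =>
      Finset.sum_eq_zero fun k _ => hdi i k hi) (by simp)] at h0
    let g : Fin m → V := fun k => if c (p₀.1, k) ≠ 0 ∧ e (p₀.1, k) = e p₀ then v (p₀.1, k) else 0
    have hg : ∀ k, d (p₀.1, k) = ψ (g k) * y' ^ (k : ℕ) := by
      intro k
      simp only [d, g]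
      by_cases h1 : c (p₀.1, k) ≠ 0
      · by_cases h2 : e (p₀.1, k) = e p₀
        · simp [h1, h2]
        · have hle : e p₀ ≤ e (p₀.1, k) := hmin _ (by simpa [s] using h1)
          have : (e (p₀.1, k) - e p₀).toNat ≠ 0 := by omega
          simp [h1, h2, this]
      · simp [h1]
    simp only [hg] at h0
    have h5 := hli g h0 p₀.2
    have h6 : c p₀ ≠ 0 := by simpa [s] using hp₀
    simp only [g, Prod.mk.eta, h6, ne_eq, not_false_eq_true, and_self, if_true] at h5
    exact hv p₀ h6 h5
  · conv => enter [2, 1]; rw [hc, Finset.mul_sum]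
    rw [show ((∑ p, ((τ ^ (-e p₀) : Aˣ) : A) * (c p • (τ ^ (p.1 : ℕ) * y ^ (p.2 : ℕ) : A)), ∑ p, d p) : A × D) =
      ∑ p, (((τ ^ (-e p₀) : Aˣ) : A) * (c p • (τ ^ (p.1 : ℕ) * y ^ (p.2 : ℕ) : A)), d p) from
      Prod.ext (by simp [Prod.fst_sum]) (by simp [Prod.snd_sum])]
    exact sum_mem fun p _ => hmem p

/-- A symbol algebra is a domain if one of its slots is a uniformizer of a discrete valuation and
the other one generates an unramified field extension of the same degree. -/
theorem IsSymbolPair.noZeroDivisors [NeZero m] [IsDomain D] [Nontrivial A]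
    (h : IsSymbolPair m (ζ : K) τ y)
    (hτ : (τ ^ m : A) = algebraMap K A w) (hy : (y ^ m : A) = algebraMap K A u)
    (hw0 : (w : K) ≠ 0) (hw : ψ w = 0) (hy' : y' ^ m = ψ u)
    (hV : ∀ z : K, z ≠ 0 → ∃ (n : ℤ) (v : V), ψ v ≠ 0 ∧ z = (w : K) ^ n * v)
    (hli : ∀ g : Fin m → V, ∑ k, ψ (g k) * y' ^ (k : ℕ) = 0 → ∀ k, ψ (g k) = 0) :
    NoZeroDivisors A where
  eq_zero_or_eq_zero_of_mul_eq_zero := by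
    intro a b hab
    by_contra! hne
    obtain ⟨N, d, hd, hmem⟩ := exists_mul_mem_symbolReduction ψ h hτ hw0 hV hli hne.2
    -- The twist by `τ ^ (-N)` cancels the normalizing factor `τ ^ N` of `b`, so that the product of
    -- the normalized elements is `τ ^ N' * (a * b)`.
    obtain ⟨N', d', hd', hmem'⟩ := exists_mul_mem_symbolReduction ψ h hτ hw0 hV hli
      (z := a * ((τ ^ (-N : ℤ) : Aˣ) : A)) (by simpa using hne.1)
    have hmul := symbolReduction_mul ψ h.comm hmem' hmem
    rw [Prod.mk_mul_mk] at hmul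
    have h0 : ((τ ^ N' : Aˣ) : A) * (a * ((τ ^ (-N : ℤ) : Aˣ) : A)) * (((τ ^ N : Aˣ) : A) * b) = 0 := by
      have : ((τ ^ (-N : ℤ) : Aˣ) : A) * (((τ ^ N : Aˣ) : A) * b) = b := by
        rw [zpow_neg, Units.inv_mul_cancel_left]
      rw [mul_assoc, mul_assoc a, this, hab, mul_zero]
    rw [h0] at hmul
    exact mul_ne_zero hd' hd (symbolReduction_eq_zero ψ h hτ hy hw hy' hmul)

end Division

/-! ### Symbolic powers and local generators -/

section SymbolicPower

variable {R : Type*} [CommRing R]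

theorem mem_symbolicPower_iff {q : Ideal R} [q.IsPrime] {n : ℕ} {a : R} :
    a ∈ symbolicPower q n ↔ ∃ s ∉ q, s * a ∈ q ^ n := by
  rw [symbolicPower, Ideal.mem_comap, IsLocalization.algebraMap_mem_map_algebraMap_iff q.primeCompl]
  rfl

theorem pow_le_symbolicPower {q : Ideal R} [q.IsPrime] {n : ℕ} : q ^ n ≤ symbolicPower q n :=
  Ideal.le_comap_map

theorem pow_mem_symbolicPower {q : Ideal R} [q.IsPrime] {π : R} (hπ : π ∈ q) (n : ℕ) :
    π ^ n ∈ symbolicPower q n := pow_le_symbolicPower (Ideal.pow_mem_pow hπ n)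

theorem exists_mul_eq_pow_mul {q : Ideal R} {π r : R} (h : ∀ p ∈ q, ∃ t, r * p = π * t) (n : ℕ) :
    ∀ a ∈ q ^ n, ∃ t, r ^ n * a = π ^ n * t := by
  induction n with
  | zero => exact fun a _ => ⟨a, by simp⟩
  | succ n ih =>
    intro a ha
    rw [pow_succ] at ha
    induction ha using Submodule.mul_induction_on' with
    | mem_mul_mem a ha b hb =>
      obtain ⟨t, ht⟩ := ih a ha
      obtain ⟨t', ht'⟩ := h b hb
      exact ⟨t * t', by linear_combination (r * b) * ht + π ^ n * t * ht'⟩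
    | add a _ b _ h h' =>
      obtain ⟨t, ht⟩ := h
      obtain ⟨t', ht'⟩ := h'
      exact ⟨t + t', by rw [mul_add, ht, ht', mul_add]⟩

theorem eq_of_le_of_height_eq_one {p q : Ideal R} [p.IsPrime] [q.IsPrime] (hp : p.height = 1)
    (hq : q.height = 1) (h : q ≤ p) : q = p := by
  by_contra hne
  have := Ideal.height_add_one_le_of_lt_of_isPrime (lt_of_le_of_ne h hne)
  rw [hp, hq] at this
  exact absurd this (by decide)

/-- Any prime between `(π)` and `P` misses `r` and so contains `P`. Thus `P` is minimal over `(π)`,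
and Krull's principal ideal theorem applies. -/
theorem height_eq_one_of_local_generator [IsDomain R] [IsNoetherianRing R] {P : Ideal R} [P.IsPrime] {π r : R} (hπ : π ∈ P)
    (hr : r ∉ P) (h : ∀ p ∈ P, ∃ t, r * p = π * t) (hP : P ≠ ⊥) : P.height = 1 := by
  refine le_antisymm ?_ ?_
  · refine Ideal.height_le_one_of_isPrincipal_of_mem_minimalPrimes (Ideal.span {π}) P ?_
    refine ⟨⟨‹_›, by simpa [Ideal.span_le] using hπ⟩, fun Q ⟨hQ, hπQ⟩ hQP p hp => ?_⟩
    obtain ⟨t, ht⟩ := h p hp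
    have : r * p ∈ Q := by
      rw [ht]
      exact Q.mul_mem_right _ (hπQ (Ideal.mem_span_singleton_self π))
    exact (hQ.mem_or_mem this).resolve_left fun h => hr (hQP h)
  · rw [Order.one_le_iff_ne_zero, Ne, Ideal.height_eq_zero_iff]
    rw [IsDomain.minimalPrimes_eq_singleton_bot]
    simpa using hP

end SymbolicPower

/-! ### Height one primes of a normal noetherian domain -/

section NormalDomain

variable {R : Type*} [CommRing R] [IsDomain R] [IsNoetherianRing R] [IsIntegrallyClosed R]

/-- An associated prime of a principal ideal in a normal noetherian domain is locally principal. -/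
theorem exists_local_generator_of_isAssociatedPrime {b : R} (hb : b ≠ 0) {P : Ideal R}
    (hP : IsAssociatedPrime P (R ⧸ Ideal.span {b})) :
    ∃ π ∈ P, ∃ r ∉ P, ∀ p ∈ P, ∃ t, r * p = π * t := by
  obtain ⟨hprime, x, hx⟩ := isAssociatedPrime_iff.mp hP
  obtain ⟨a, rfl⟩ := Ideal.Quotient.mk_surjective x
  have hmem : ∀ r, r ∈ P ↔ b ∣ r * a := by
    intro r
    rw [hx, Submodule.mem_colon_singleton, Submodule.mem_bot, ← Ideal.mem_span_singleton,
      ← Ideal.Quotient.eq_zero_iff_mem]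
    rfl
  have hba : ¬ b ∣ a := by
    intro h
    exact hprime.ne_top ((Ideal.eq_top_iff_one _).mpr ((hmem 1).mpr (by simpa using h)))
  -- So `f r = r a / b`. If some `f r` is outside `P`, then `r` generates `P` locally, since `f r *
  -- p = r * f p`. Otherwise `a / b` maps the finitely generated ideal `P` to itself and is
  -- integral, so that `b ∣ a` by normality, which is excluded.
  choose f hf using fun r : P => (hmem r).mp r.2
  by_contra! hcon
  have hfP : ∀ r : P, f r ∈ P := by
    intro r
    by_contra hr
    obtain ⟨p, hp, hne⟩ := hcon r r.2 (f r) hr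
    refine hne (f ⟨p, hp⟩) (mul_left_cancel₀ hb ?_)
    rw [← mul_assoc, ← hf r, mul_left_comm b, ← hf ⟨p, hp⟩]
    ring
  let K := FractionRing R
  have hb' : algebraMap R K b ≠ 0 := by simpa using hb
  let N : Submodule R K := Submodule.map (Algebra.linearMap R K) P
  have hbP : b ∈ P := (hmem b).mpr (dvd_mul_right _ _)
  have hint : IsIntegral R (algebraMap R K a / algebraMap R K b) := by
    refine isIntegral_of_smul_mem_submodule N ?_ ((IsNoetherian.noetherian P).map _) _ ?_
    · rw [Submodule.ne_bot_iff]
      exact ⟨_, ⟨b, hbP, rfl⟩, hb'⟩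
    · rintro _ ⟨r, hr, rfl⟩
      refine ⟨f ⟨r, hr⟩, hfP _, ?_⟩
      have := congrArg (algebraMap R K) (hf ⟨r, hr⟩)
      simp only [map_mul] at this
      simp only [Algebra.linearMap_apply, smul_eq_mul]
      rw [div_mul_eq_mul_div, eq_div_iff hb', mul_comm, ← this, mul_comm]
  obtain ⟨c, hc⟩ := IsIntegrallyClosed.isIntegral_iff.mp hint
  rw [eq_div_iff hb', ← map_mul, (IsFractionRing.injective R K).eq_iff] at hc
  exact hba ⟨c, by rw [← hc, mul_comm]⟩

/-- A height one prime of a normal noetherian domain is locally principal. -/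
theorem exists_local_generator_of_height_eq_one {P : Ideal R} [P.IsPrime] (hP : P.height = 1) :
    ∃ π ∈ P, ∃ r ∉ P, ∀ p ∈ P, ∃ t, r * p = π * t := by
  have hbot := P.ne_bot_of_height_eq_one hP
  obtain ⟨b, hb, hb0⟩ := P.ne_bot_iff.mp hbot
  refine exists_local_generator_of_isAssociatedPrime hb0
    (Module.associatedPrimes.minimalPrimes_annihilator_subset_associatedPrimes R (R ⧸ Ideal.span {b}) ?_)
  rw [Ideal.annihilator_quotient]
  refine ⟨⟨‹_›, by simpa [Ideal.span_le] using hb⟩, fun Q ⟨hQ, hbQ⟩ hQP => ?_⟩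
  by_contra hPQ
  have hlt : Q < P := lt_of_le_not_ge hQP hPQ
  have h0 : Q ≠ ⊥ := by
    rintro rfl
    exact hb0 (by simpa using hbQ (Ideal.mem_span_singleton_self b))
  have h1 : (1 : ℕ∞) ≤ Q.height := by
    rw [Order.one_le_iff_ne_zero, Ne, Ideal.height_eq_zero_iff, IsDomain.minimalPrimes_eq_singleton_bot]
    simpa using h0
  have := Ideal.height_add_one_le_of_lt_of_isPrime hlt
  rw [hP] at this
  have h2 := (add_le_add_left h1 1).trans this
  exact absurd h2 (by decide)

/-- A normal noetherian domain is the intersection of its localizations at the height one primes. -/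
theorem exists_algebraMap_eq_of_forall_height_eq_one {K : Type*} [Field K] [Algebra R K] [IsFractionRing R K]
    (c : K) (h : ∀ (p : Ideal R) [p.IsPrime], p.height = 1 →
      ∃ s ∉ p, ∃ r, algebraMap R K s * c = algebraMap R K r) :
    ∃ r, algebraMap R K r = c := by
  obtain ⟨a, b, hb, rfl⟩ := IsFractionRing.div_surjective (A := R) c
  have hb0 : b ≠ 0 := nonZeroDivisors.ne_zero hb
  have hb' : algebraMap R K b ≠ 0 := by simpa using hb0
  by_cases hba : b ∣ a
  · obtain ⟨t, rfl⟩ := hba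
    exact ⟨t, by rw [map_mul, mul_div_cancel_left₀ _ hb']⟩
  exfalso
  -- The ideal of denominators `(b : a)` lies in an associated prime `P` of `(b)`. Such a prime is
  -- locally principal, hence of height one, and the hypothesis at `P` supplies a denominator
  -- outside `P`.
  obtain ⟨P, hP, hle⟩ := exists_le_isAssociatedPrime_of_isNoetherianRing R
    (Ideal.Quotient.mk (Ideal.span {b}) a)
    (by rwa [Ne, Ideal.Quotient.eq_zero_iff_mem, Ideal.mem_span_singleton])
  have hmem : ∀ r, b ∣ r * a → r ∈ P := by
    intro r hr
    refine hle ?_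
    rw [Submodule.mem_colon_singleton, Submodule.mem_bot]
    exact Ideal.Quotient.eq_zero_iff_mem.mpr (Ideal.mem_span_singleton.mpr hr)
  have := hP.isPrime
  obtain ⟨π, hπ, r, hr, hgen⟩ := exists_local_generator_of_isAssociatedPrime hb0 hP
  have hPb : P ≠ ⊥ := by
    rw [Submodule.ne_bot_iff]
    exact ⟨b, hmem b (dvd_mul_right _ _), hb0⟩
  obtain ⟨s, hs, t, hst⟩ := h P (height_eq_one_of_local_generator hπ hr hgen hPb)
  refine hs (hmem s ⟨t, ?_⟩)
  rw [mul_div_assoc', div_eq_iff hb', ← map_mul, ← map_mul, (IsFractionRing.injective R K).eq_iff] at hst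
  rw [hst, mul_comm]

/-- Symbolic powers of a height one prime are locally powers of a principal ideal. -/
theorem exists_local_generator_symbolicPower {q : Ideal R} [q.IsPrime] (hq : q.height = 1)
    (p : Ideal R) [p.IsPrime] (hp : p.height = 1) :
    ∃ π ∈ q, π ≠ 0 ∧ ∀ n, ∀ a ∈ symbolicPower q n, ∃ s ∉ p, ∃ t, s * a = π ^ n * t := by
  by_cases hpq : q = p
  · subst hpq
    obtain ⟨π, hπ, r, hr, h⟩ := exists_local_generator_of_height_eq_one hq
    refine ⟨π, hπ, ?_, fun n a ha => ?_⟩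
    · rintro rfl
      obtain ⟨b, hb, hb0⟩ := q.ne_bot_iff.mp (q.ne_bot_of_height_eq_one hq)
      obtain ⟨t, ht⟩ := h b hb
      rw [zero_mul, mul_eq_zero] at ht
      exact hr (by rw [ht.resolve_right hb0]; exact q.zero_mem)
    · obtain ⟨s, hs, hsa⟩ := mem_symbolicPower_iff.mp ha
      obtain ⟨t, ht⟩ := exists_mul_eq_pow_mul h n _ hsa
      refine ⟨r ^ n * s, fun hmem => ?_, t, by rw [mul_assoc, ht]⟩
      exact ((‹q.IsPrime›.mem_or_mem hmem).elim (fun h => hr (‹q.IsPrime›.mem_of_pow_mem _ h)) hs)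
  -- If `p ≠ q`, any element of `q` outside `p` serves, since its powers are invertible at `p`.
  · have : ¬ q ≤ p := fun h => hpq (eq_of_le_of_height_eq_one hp hq h)
    obtain ⟨π, hπ, hπp⟩ := SetLike.not_le_iff_exists.mp this
    refine ⟨π, hπ, ?_, fun n a _ => ⟨π ^ n, fun h => hπp (‹p.IsPrime›.mem_of_pow_mem _ h), a, rfl⟩⟩
    rintro rfl
    exact hπp p.zero_mem

/-- The divisorial ideals `q⁽ⁱ⁾` and `q⁽ᵐ⁻ⁱ⁾` are dual with respect to `w R = q⁽ᵐ⁾`. This is evident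
where `q` is generated by one element, so at each height one prime, and normality globalizes it. -/
theorem exists_mem_symbolicPower_of_forall_mul {K : Type*} [Field K] [Algebra R K] [IsFractionRing R K]
    {q : Ideal R} [q.IsPrime] (hq : q.height = 1) {m i : ℕ} (hi : i ≤ m) {w : R}
    (hw : Ideal.span {w} = symbolicPower q m) (c : K)
    (hc : ∀ a ∈ symbolicPower q (m - i), ∃ r, algebraMap R K a * c = algebraMap R K (w * r)) :
    ∃ r ∈ symbolicPower q i, algebraMap R K r = c := by
  have key : ∀ (p : Ideal R) [p.IsPrime], p.height = 1 → ∃ π ∈ q, ∃ s ∉ p, ∃ t,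
      algebraMap R K s * c = algebraMap R K (π ^ i * t) := by
    intro p _ hp
    obtain ⟨π, hπ, hπ0, h⟩ := exists_local_generator_symbolicPower hq p hp
    obtain ⟨r, hr⟩ := hc _ (pow_mem_symbolicPower hπ (m - i))
    obtain ⟨s, hs, t, hst⟩ := h m w (hw ▸ Ideal.mem_span_singleton_self w)
    refine ⟨π, hπ, s, hs, t * r, ?_⟩
    have hπ' : algebraMap R K (π ^ (m - i)) ≠ 0 := by simpa using fun h => absurd h hπ0
    refine mul_left_cancel₀ hπ' ?_
    rw [mul_left_comm, hr, ← map_mul, ← map_mul, ← mul_assoc s, hst,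
      ← Nat.sub_add_cancel hi, pow_add, Nat.add_sub_cancel]
    congr 1
    ring
  obtain ⟨r, hr⟩ := exists_algebraMap_eq_of_forall_height_eq_one c fun p _ hp => by
    obtain ⟨π, _, s, hs, t, h⟩ := key p hp
    exact ⟨s, hs, _, h⟩
  refine ⟨r, ?_, hr⟩
  obtain ⟨π, hπ, s, hs, t, h⟩ := key q hq
  rw [← hr, ← map_mul, (IsFractionRing.injective R K).eq_iff] at h
  exact mem_symbolicPower_iff.mpr ⟨s, hs, h ▸ Ideal.mul_mem_right _ _ (Ideal.pow_mem_pow hπ i)⟩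

end NormalDomain

/-! ### Kummer generators over the residue field and over the Henselian ring -/

section Kummer

theorem isPrimitiveRoot_of_forall_pow_eq_one {M : Type*} [CommMonoid M] {ω : M} {m : ℕ}
    (h : ω ^ m = 1) (h' : ∀ k : ℕ, ω ^ k = 1 → m ∣ k) : IsPrimitiveRoot ω m := ⟨h, h'⟩

/-- Kummer theory, with the action on the Kummer generator. -/
theorem exists_kummerGenerator {k L : Type*} [Field k] [Field L] [Algebra k L]
    [FiniteDimensional k L] [IsGalois k L] {m : ℕ} [NeZero m]
    (τ : Multiplicative (ZMod m) ≃* (L ≃ₐ[k] L)) (hζ : ∃ ζ : k, IsPrimitiveRoot ζ m) :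
    ∃ (α : L) (ω : k), α ≠ 0 ∧ IsPrimitiveRoot ω m ∧ τ (Multiplicative.ofAdd 1) α = ω • α ∧
      LinearIndependent k (fun i : Fin m => α ^ (i : ℕ)) ∧
      ⊤ ≤ Submodule.span k (Set.range fun i : Fin m => α ^ (i : ℕ)) := by
  have hcard : Module.finrank k L = m := by
    rw [← IsGalois.card_aut_eq_finrank, ← Nat.card_congr τ.toEquiv]
    simp
  have : IsCyclic (L ≃ₐ[k] L) := isCyclic_of_surjective τ τ.surjective
  obtain ⟨ζ, hζ⟩ := hζ
  obtain ⟨α, ⟨a, ha⟩, htop⟩ := exists_root_adjoin_eq_top_of_isCyclic k L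
    ⟨ζ, (mem_primitiveRoots Module.finrank_pos).mpr (hcard.symm ▸ hζ)⟩
  rw [hcard] at ha
  have hfix : ∀ σ : L ≃ₐ[k] L, σ α = α → σ = 1 := by
    intro σ hσ
    have h1 : IntermediateField.adjoin k {α} ≤ IntermediateField.fixedField (Subgroup.zpowers σ) := by
      rw [IntermediateField.adjoin_simple_le_iff]
      rintro ⟨_, n, rfl⟩
      have : σ ∈ MulAction.stabilizer (L ≃ₐ[k] L) α := hσ
      exact Subgroup.zpow_mem _ this n
    rw [htop] at h1
    ext x
    exact h1 (IntermediateField.mem_top : x ∈ ⊤) ⟨σ, Subgroup.mem_zpowers σ⟩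
  have hτ : ∀ n : ℕ, τ (Multiplicative.ofAdd 1) ^ n = 1 → m ∣ n := by
    intro n hn
    rw [← map_pow, MulEquiv.map_eq_one_iff, ← ofAdd_nsmul, ofAdd_eq_one, nsmul_one] at hn
    exact (ZMod.natCast_eq_zero_iff n m).mp hn
  -- As only the identity fixes `α`, the value `0` is possible only for `m = 1`, and then `1` is a
  -- nonzero generator.
  by_cases hα : α = 0
  · have h1 := hτ 1 (by rw [pow_one]; exact hfix _ (by rw [hα, map_zero]))
    have hm1 : m = 1 := Nat.dvd_one.mp h1
    subst hm1
    have hli : LinearIndependent k (fun i : Fin 1 => (1 : L) ^ (i : ℕ)) := by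
      rw [linearIndependent_unique_iff]; simp
    refine ⟨1, 1, one_ne_zero, IsPrimitiveRoot.one, ?_, hli, ?_⟩
    · simp
    · exact (hli.span_eq_top_of_card_eq_finrank (by simp [hcard])).ge
  · have hroot : (τ (Multiplicative.ofAdd 1) α / α) ^ m = 1 := by
      rw [div_pow, ← map_pow, ← ha, AlgEquiv.commutes, div_self]
      rw [ha]
      exact pow_ne_zero _ hα
    obtain ⟨j, _, hj⟩ := (hζ.map_of_injective (algebraMap k L).injective).eq_pow_of_pow_eq_one hroot
    have hω : τ (Multiplicative.ofAdd 1) α = ζ ^ j • α := by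
      rw [Algebra.smul_def, map_pow, hj, div_mul_cancel₀ _ hα]
    have hiter : ∀ n : ℕ, (τ (Multiplicative.ofAdd 1) ^ n) α = (ζ ^ j) ^ n • α := by
      intro n
      induction n with
      | zero => simp
      | succ n ih => rw [pow_succ, AlgEquiv.mul_apply, hω, map_smul, ih, smul_smul, pow_succ']
    -- The generator of the Galois group has order `m`, and it is determined by its action on `α`.
    -- So its eigenvalue also has order `m`.
    have hprim : IsPrimitiveRoot (ζ ^ j) m := by
      refine isPrimitiveRoot_of_forall_pow_eq_one ?_ fun n hn => hτ n (hfix _ ?_)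
      · rw [← pow_mul, mul_comm, pow_mul, hζ.pow_eq_one, one_pow]
      · rw [hiter, hn, one_smul]
    have hli : LinearIndependent k (fun i : Fin m => α ^ (i : ℕ)) := by
      refine Module.End.eigenvectors_linearIndependent'
        (τ (Multiplicative.ofAdd 1)).toLinearMap (fun i : Fin m => (ζ ^ j) ^ (i : ℕ)) ?_ _ ?_
      · intro a b hab
        exact Fin.ext (hprim.pow_inj a.2 b.2 hab)
      · intro i
        rw [Module.End.hasEigenvector_iff]
        refine ⟨Module.End.mem_eigenspace_iff.mpr ?_, pow_ne_zero _ hα⟩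
        simp [hω, smul_pow]
    exact ⟨α, ζ ^ j, hα, hprim, hω, hli, (hli.span_eq_top_of_card_eq_finrank (by simp [hcard])).ge⟩

open Polynomial in
-- Hensel's lemma for `X ^ m - 1`. A primitive `m`-th root in the residue field forces `m ≠ 0`
-- there, so the roots are simple.
theorem exists_isPrimitiveRoot_residue_eq {R : Type*} [CommRing R] [HenselianLocalRing R] {m : ℕ}
    [NeZero m] {ω : IsLocalRing.ResidueField R} (hω : IsPrimitiveRoot ω m) :
    ∃ ζ : R, IsPrimitiveRoot ζ m ∧ IsLocalRing.residue R ζ = ω := by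
  obtain ⟨z, rfl⟩ := IsLocalRing.residue_surjective ω
  have hm : (m : IsLocalRing.ResidueField R) ≠ 0 := hω.neZero'.ne
  have hz : z ^ m - 1 ∈ IsLocalRing.maximalIdeal R := by
    rw [← IsLocalRing.residue_eq_zero_iff, map_sub, map_pow, hω.pow_eq_one, map_one, sub_self]
  obtain ⟨a, ha, haz⟩ := HenselianLocalRing.is_henselian (X ^ m - 1 : R[X])
    (by simpa using monic_X_pow_sub_C (1 : R) (NeZero.ne m)) z (by simpa using hz) (by
      rw [← IsLocalRing.notMem_maximalIdeal, ← IsLocalRing.residue_eq_zero_iff]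
      simp only [derivative_sub, derivative_X_pow, derivative_one, sub_zero, eval_mul, eval_pow,
        eval_X, map_mul, map_pow, map_natCast]
      exact mul_ne_zero (by simpa using hm) (pow_ne_zero _ (hω.ne_zero (NeZero.ne m))))
  have hres : IsLocalRing.residue R a = IsLocalRing.residue R z := by
    rwa [← sub_eq_zero, ← map_sub, IsLocalRing.residue_eq_zero_iff]
  refine ⟨a, ⟨?_, fun n hn => hω.dvd_of_pow_eq_one n ?_⟩, hres⟩
  · simpa [sub_eq_zero] using ha
  · rw [← hres, ← map_pow, hn, map_one]

/-- A Kummer generator of the cyclic étale extension `B` of a Henselian local ring. -/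
theorem IsCyclicEtaleLift.exists_kummerGenerator {R : Type*} [CommRing R] [IsDomain R]
    [HenselianLocalRing R] {m : ℕ} [NeZero m]
    (hζ : ∃ ζ : IsLocalRing.ResidueField R, IsPrimitiveRoot ζ m)
    {L : Type*} [Field L] [Algebra (IsLocalRing.ResidueField R) L] [Algebra R L]
    [IsScalarTower R (IsLocalRing.ResidueField R) L]
    [FiniteDimensional (IsLocalRing.ResidueField R) L] [IsGalois (IsLocalRing.ResidueField R) L]
    {τ : Multiplicative (ZMod m) ≃* (L ≃ₐ[IsLocalRing.ResidueField R] L)}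
    {B : Type*} [CommRing B] [Algebra R B] {ρ : Multiplicative (ZMod m) →* (B ≃ₐ[R] B)}
    {red : B →ₐ[R] L} (hB : IsCyclicEtaleLift τ ρ red) :
    ∃ (ζ u : R) (b : B) (α : L), IsCharRoot m ζ ∧ IsUnit u ∧ b ^ m = algebraMap R B u ∧
      ρ (Multiplicative.ofAdd 1) b = ζ • b ∧
      ⊤ ≤ Submodule.span R (Set.range fun i : Fin m => b ^ (i : ℕ)) ∧
      α ^ m = algebraMap _ L (IsLocalRing.residue R u) ∧
      LinearIndependent (IsLocalRing.ResidueField R) (fun i : Fin m => α ^ (i : ℕ)) := by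
  obtain ⟨α, ω, hα0, hω, hτα, hli, hspan⟩ := _root_.exists_kummerGenerator τ hζ
  obtain ⟨ζ, hζ, rfl⟩ := exists_isPrimitiveRoot_residue_eq hω
  have hm : IsUnit (m : R) := by
    rw [← IsLocalRing.notMem_maximalIdeal, ← IsLocalRing.residue_eq_zero_iff, map_natCast]
    exact hω.neZero'.ne
  have hchar := IsCharRoot.of_isPrimitiveRoot hζ hm
  have hsmul : ∀ (r : R) (l : L), IsLocalRing.residue R r • l = r • l := by
    intro r l
    rw [← IsLocalRing.ResidueField.algebraMap_eq, algebraMap_smul]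
  obtain ⟨b₀, hb₀⟩ := hB.surjective α
  let g : Multiplicative (ZMod m) := Multiplicative.ofAdd 1
  have hgm : g ^ m = 1 := by
    rw [← ofAdd_nsmul, nsmul_one, ZMod.natCast_self, ofAdd_zero]
  let μ : R := ((hm.unit⁻¹ : Rˣ) : R)
  have hμ : μ * m = 1 := by simp [μ]
  -- The projection of an arbitrary lift of `α` to the `ζ`-eigenspace; `m - 1` stands for `-1` in
  -- the exponent. Since `α` is already an eigenvector, `b` still lifts `α`.
  let b : B := μ • ∑ j ∈ Finset.range m, ζ ^ (j * (m - 1)) • ρ (g ^ j) b₀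
  have h1m : 1 ≤ m := NeZero.one_le
  have hρb : ρ g b = ζ • b := by
    have hl : ρ g b = μ • ∑ j ∈ Finset.range m, ζ ^ (j * (m - 1)) • ρ (g ^ (j + 1)) b₀ := by
      simp only [b, map_smul, map_sum]
      congr 1
      refine Finset.sum_congr rfl fun j _ => ?_
      rw [← AlgEquiv.mul_apply, ← map_mul, ← pow_succ']
    have hr : ζ • b = μ • ∑ j ∈ Finset.range m, ζ ^ (j * (m - 1) + 1) • ρ (g ^ j) b₀ := by
      rw [smul_comm, Finset.smul_sum]
      congr 1
      refine Finset.sum_congr rfl fun j _ => ?_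
      rw [smul_smul, ← pow_succ']
    rw [hl, hr]
    congr 1
    have hs := Finset.sum_range_succ' (fun j => ζ ^ (j * (m - 1) + 1) • ρ (g ^ j) b₀) m
    rw [Finset.sum_range_succ] at hs
    have hend : ζ ^ (m * (m - 1) + 1) • ρ (g ^ m) b₀ = ζ ^ (0 * (m - 1) + 1) • ρ (g ^ 0) b₀ := by
      rw [hgm, pow_succ, pow_mul, hζ.pow_eq_one]; simp
    rw [hend, add_left_inj] at hs
    rw [hs]
    refine Finset.sum_congr rfl fun j _ => ?_
    congr 1
    have : (j + 1) * (m - 1) + 1 = j * (m - 1) + m := by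
      rw [add_mul, one_mul, add_assoc, Nat.sub_add_cancel h1m]
    rw [this, pow_add _ _ m, hζ.pow_eq_one, mul_one]
  have hτj : ∀ j : ℕ, τ (g ^ j) α = ζ ^ j • α := by
    intro j
    induction j with
    | zero => simp
    | succ j ih =>
      rw [pow_succ, map_mul, AlgEquiv.mul_apply, hτα, map_smul, ih, hsmul, smul_smul, pow_succ']
  have hredb : red b = α := by
    simp only [b, map_smul, map_sum, hB.equivariant, hb₀, hτj, smul_smul, ← pow_add]
    have : ∀ j ∈ Finset.range m, ζ ^ (j * (m - 1) + j) • α = α := by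
      intro j _
      have : j * (m - 1) + j = m * j := by
        rw [← Nat.mul_succ, Nat.succ_eq_add_one, Nat.sub_add_cancel h1m, mul_comm]
      rw [this, pow_mul, hζ.pow_eq_one, one_pow, one_smul]
    rw [Finset.sum_congr rfl this, Finset.sum_const, Finset.card_range, ← Nat.cast_smul_eq_nsmul R,
      smul_smul, hμ, one_smul]
  have := hB.finite
  -- Nakayama's lemma: the powers of `b` span `B` because those of `α` span `L`.
  have hspanB : ⊤ ≤ Submodule.span R (Set.range fun i : Fin m => b ^ (i : ℕ)) := by
    refine Submodule.le_of_le_smul_of_le_jacobson_bot Module.Finite.fg_top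
      (IsLocalRing.maximalIdeal_le_jacobson _) ?_
    intro z _
    obtain ⟨c, hc⟩ := (Submodule.mem_span_range_iff_exists_fun _).mp
      (hspan (Submodule.mem_top : red z ∈ ⊤))
    choose c' hc' using fun i => IsLocalRing.residue_surjective (c i)
    have hker : z - ∑ i, c' i • b ^ (i : ℕ) ∈ RingHom.ker red := by
      rw [RingHom.mem_ker, map_sub, map_sum, ← hc, sub_eq_zero]
      refine Finset.sum_congr rfl fun i _ => ?_
      rw [map_smul, map_pow, hredb, ← hc', hsmul]
    rw [← sub_add_cancel z (∑ i, c' i • b ^ (i : ℕ)), add_comm]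
    refine Submodule.add_mem_sup (Submodule.sum_mem _ fun i _ =>
      Submodule.smul_mem _ _ (Submodule.subset_span ⟨i, rfl⟩)) ?_
    rw [hB.ker_eq] at hker
    rw [Ideal.smul_top_eq_map]
    exact hker
  have hρj : ∀ j : ℕ, ρ (g ^ j) b = ζ ^ j • b := by
    intro j
    induction j with
    | zero => simp
    | succ j ih =>
      rw [pow_succ, map_mul, AlgEquiv.mul_apply, hρb, map_smul, ih, smul_smul, pow_succ']
  obtain ⟨u, hu⟩ : ∃ u, b ^ m = algebraMap R B u := by
    obtain ⟨c, hc⟩ := (Submodule.mem_span_range_iff_exists_fun _).mp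
      (hspanB (Submodule.mem_top : b ^ m ∈ ⊤))
    refine ⟨c 0, ?_⟩
    have h1 : ∀ j, ρ (g ^ j) (b ^ m) = b ^ m := by
      intro j
      rw [map_pow, hρj, smul_pow, ← pow_mul, mul_comm, pow_mul, hζ.pow_eq_one, one_pow, one_smul]
    -- The power `b ^ m` is invariant, so it equals its average over the group, and averaging kills
    -- every `bⁱ` with `0 < i < m`.
    have h2 : (m : R) • b ^ m = (m : R) • algebraMap R B (c 0) := by
      calc (m : R) • b ^ m = ∑ j ∈ Finset.range m, ρ (g ^ j) (b ^ m) := by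
            rw [Finset.sum_congr rfl fun j _ => h1 j, Finset.sum_const, Finset.card_range,
              Nat.cast_smul_eq_nsmul]
        _ = ∑ i : Fin m, c i • (∑ j ∈ Finset.range m, ζ ^ (j * i)) • b ^ (i : ℕ) := by
            rw [← hc]
            simp only [map_sum, Finset.sum_smul, Finset.smul_sum]
            rw [Finset.sum_comm]
            refine Finset.sum_congr rfl fun i _ => Finset.sum_congr rfl fun j _ => ?_
            rw [map_smul, map_pow (ρ (g ^ j)) b, hρj, smul_pow, ← pow_mul]
        _ = _ := by
            rw [Finset.sum_eq_single 0]
            · simp [Algebra.algebraMap_eq_smul_one, smul_comm (c 0)]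
            · intro i _ hi
              rw [hchar.sum_eq, zero_smul, smul_zero]
              intro hd
              exact hi (Fin.ext (by simpa using Nat.eq_zero_of_dvd_of_lt hd i.2))
            · simp
    have h3 := congrArg (μ • ·) h2
    simpa [smul_smul, hμ] using h3
  have hαu : α ^ m = algebraMap _ L (IsLocalRing.residue R u) := by
    rw [← hredb, ← map_pow, hu, AlgHom.commutes, ← IsLocalRing.ResidueField.algebraMap_eq,
      ← IsScalarTower.algebraMap_apply]
  refine ⟨ζ, u, b, α, hchar, ?_, hu, hρb, hspanB, hαu, hli⟩
  rw [← IsLocalRing.notMem_maximalIdeal, ← IsLocalRing.residue_eq_zero_iff]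
  intro h0
  rw [h0, map_zero] at hαu
  exact pow_ne_zero m hα0 hαu

end Kummer

open TensorProduct

/-! ### Rescaled slots, and bases from Kummer generators -/

section Rescale

variable {R A : Type*} [CommRing R] [Ring A] [Algebra R A] {m : ℕ} {ζ : R}

theorem IsSymbolPair.smul_left {x x' y : Aˣ} (h : IsSymbolPair m ζ x y) (c : Rˣ)
    (hx : (x' : A) = (c : R) • (x : A)) : IsSymbolPair m ζ x' y where
  charRoot := h.charRoot
  comm := by rw [hx, mul_smul_comm, h.comm, smul_mul_assoc, smul_comm]
  span := by
    refine h.span.trans (Submodule.span_le.mpr ?_)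
    rintro _ ⟨p, rfl⟩
    have : (x : A) ^ (p.1 : ℕ) * (y : A) ^ (p.2 : ℕ) =
        ((c⁻¹ ^ (p.1 : ℕ) : Rˣ) : R) • ((x' : A) ^ (p.1 : ℕ) * (y : A) ^ (p.2 : ℕ)) := by
      rw [hx, smul_pow, smul_mul_assoc, smul_smul, ← Units.val_pow_eq_pow_val (a := c), ← Units.val_mul,
        inv_pow, inv_mul_cancel, Units.val_one, one_smul]
    simp only [this]
    exact Submodule.smul_mem _ _ (Submodule.subset_span ⟨p, rfl⟩)

end Rescale

/-- `b` is a Kummer generator of the `R`-algebra `B` with the action `ρ` of `ℤ/m`. -/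
structure IsKummerGenerator {R B : Type*} [CommRing R] [CommRing B] [Algebra R B] {m : ℕ}
    (ρ : Multiplicative (ZMod m) →* (B ≃ₐ[R] B)) (ζ u : R) (b : B) : Prop where
  charRoot : IsCharRoot m ζ
  isUnit : IsUnit u
  pow_eq : b ^ m = algebraMap R B u
  act : ρ (Multiplicative.ofAdd 1) b = ζ • b
  span : ⊤ ≤ Submodule.span R (Set.range fun i : Fin m => b ^ (i : ℕ))

namespace IsKummerGenerator

variable {R B : Type*} [CommRing R] [CommRing B] [Algebra R B] {m : ℕ} [NeZero m]
    {ρ : Multiplicative (ZMod m) →* (B ≃ₐ[R] B)} {ζ u : R} {b : B}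
    (h : IsKummerGenerator ρ ζ u b)
include h

theorem act_pow (j k : ℕ) : ρ (Multiplicative.ofAdd 1 ^ j) (b ^ k) = ζ ^ (j * k) • b ^ k := by
  have : ρ (Multiplicative.ofAdd 1 ^ j) b = ζ ^ j • b := by
    induction j with
    | zero => simp
    | succ j ih =>
      rw [pow_succ, map_mul, AlgEquiv.mul_apply, h.act, map_smul, ih, smul_smul, pow_succ']
  rw [map_pow (ρ (Multiplicative.ofAdd 1 ^ j)) b, this, smul_pow, ← pow_mul]

theorem isUnit_generator : IsUnit b :=
  (isUnit_pow_iff (NeZero.ne m)).mp (h.pow_eq ▸ h.isUnit.map (algebraMap R B))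

/-- Orthogonality of characters for the action of `ℤ/m`: each power of `b` spans its own eigenspace,
and `b` is a unit. -/
theorem linearIndependent [FaithfulSMul R B] :
    LinearIndependent R (fun i : Fin m => b ^ (i : ℕ)) := by
  rw [Fintype.linearIndependent_iff]
  intro c hc n
  have key : (m : R) • c n • b ^ (n : ℕ) = 0 := by
    calc (m : R) • c n • b ^ (n : ℕ)
        = ∑ i : Fin m, (∑ j ∈ Finset.range m, ζ ^ (j * (m - n + i))) • c i • b ^ (i : ℕ) := by
          rw [Finset.sum_eq_single n]
          · congr 1
            rw [Nat.sub_add_cancel n.2.le]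
            simp [mul_comm _ m, pow_mul, h.charRoot.pow_eq]
          · intro i _ hi
            rw [h.charRoot.sum_eq, zero_smul]
            rintro ⟨c, hc⟩
            have h1 := n.2
            have h2 := i.2
            apply hi
            ext
            have hc0 : c ≠ 0 := by rintro rfl; omega
            have hc2 : c < 2 := by
              by_contra hc2
              have : m * 2 ≤ m * c := Nat.mul_le_mul_left m (by omega)
              omega
            have : c = 1 := by omega
            subst this
            omega
          · simp
      _ = ∑ j ∈ Finset.range m, ζ ^ (j * (m - n)) •
            ρ (Multiplicative.ofAdd 1 ^ j) (∑ i : Fin m, c i • b ^ (i : ℕ)) := by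
          simp only [Finset.sum_smul, map_sum, Finset.smul_sum]
          rw [Finset.sum_comm]
          refine Finset.sum_congr rfl fun j _ => Finset.sum_congr rfl fun i _ => ?_
          rw [map_smul, h.act_pow, smul_comm (c i), mul_add, pow_add, mul_smul]
      _ = 0 := by simp [hc]
  rw [(h.charRoot.isUnit).smul_eq_zero] at key
  have h2 : algebraMap R B (c n) * b ^ (n : ℕ) = 0 := by rwa [← Algebra.smul_def]
  rw [(h.isUnit_generator.pow (n : ℕ)).mul_left_eq_zero] at h2
  exact (FaithfulSMul.algebraMap_eq_zero_iff R B).mp h2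

/-- The basis of powers of the Kummer generator. -/
noncomputable def basis [FaithfulSMul R B] : Module.Basis (Fin m) R B :=
  Module.Basis.mk h.linearIndependent h.span

end IsKummerGenerator

/-! ### Monomials in the cyclic cover -/

section Cover

variable {R : Type*} [CommRing R] [IsDomain R] {q : Ideal R} [q.IsPrime] {m : ℕ} [NeZero m] {w : R}
  (hw : Ideal.span {w} = symbolicPower q m) (hw0 : w ≠ 0)

include hw0 in
theorem smul_kummerGen_pow_self : w • kummerGen m w ^ m = 1 := by
  rw [kummerGen_pow, Algebra.smul_def w,
    IsScalarTower.algebraMap_apply R (FractionRing R) (KummerAlgebra m w), ← map_mul,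
    mul_inv_cancel₀ (by simpa using hw0), map_one]

include hw hw0 in
-- The graded pieces are given by exponents below `m`. Larger exponents reduce to these by `q⁽ᵐ⁺ᵏ⁾ ⊆
-- w q⁽ᵏ⁾` and `w t ^ m = 1`.
theorem smul_kummerGen_pow_mem (n : ℕ) {a : R} (ha : a ∈ symbolicPower q n) :
    a • kummerGen m w ^ n ∈ cyclicCoverPiece q m w n := by
  induction n using Nat.strong_induction_on generalizing a with
  | _ n ih =>
    rcases lt_or_ge n m with hn | hn
    · refine ⟨a, ?_, ?_⟩
      · rwa [ZMod.val_natCast_of_lt hn]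
      · rw [LinearMap.toSpanSingleton_apply, ZMod.val_natCast_of_lt hn]
    · obtain ⟨k, rfl⟩ := Nat.exists_eq_add_of_le hn
      obtain ⟨c, hc, rfl⟩ := exists_mem_symbolicPower_of_add q hw ha
      have hm := Nat.pos_of_ne_zero (NeZero.ne m)
      have := ih k (by omega) hc
      have heq : (w * c) • kummerGen m w ^ (m + k) = c • kummerGen m w ^ k := by
        rw [mul_smul, pow_add, smul_comm, ← smul_mul_assoc, smul_kummerGen_pow_self hw0, one_mul]
      rw [heq]
      simpa using this

/-- The element `a tⁿ` of the cyclic cover, for `a` in the `n`-th symbolic power. -/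
noncomputable def coverMonomial (n : ℕ) (a : symbolicPower q n) : cyclicCover q hw :=
  ⟨(a : R) • kummerGen m w ^ n, Submodule.mem_iSup_of_mem _ (smul_kummerGen_pow_mem hw hw0 n a.2)⟩

theorem coverMonomial_mem (n : ℕ) (a : symbolicPower q n) :
    coverMonomial hw hw0 n a ∈ cyclicCoverGrading q hw (n : ZMod m) :=
  smul_kummerGen_pow_mem hw hw0 n a.2

theorem exists_coverMonomial_eq (i : ZMod m) {s : cyclicCover q hw}
    (hs : s ∈ cyclicCoverGrading q hw i) : ∃ a, s = coverMonomial hw hw0 i.val a := by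
  obtain ⟨a, ha, h⟩ := hs
  exact ⟨⟨a, ha⟩, Subtype.ext h.symm⟩

theorem smul_coverMonomial (n : ℕ) (r : R) (a : symbolicPower q n) :
    r • coverMonomial hw hw0 n a = coverMonomial hw hw0 n (r • a) := by
  refine Subtype.ext ?_
  simp [coverMonomial, mul_smul]

theorem coverMonomial_pow (n : ℕ) (a : symbolicPower q 1) :
    coverMonomial hw hw0 1 a ^ n = coverMonomial hw hw0 n
      ⟨(a : R) ^ n, by
        have := a.2
        rw [mem_symbolicPower_iff] at this ⊢
        obtain ⟨s, hs, h⟩ := this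
        refine ⟨s ^ n, fun h' => hs (‹q.IsPrime›.mem_of_pow_mem _ h'), ?_⟩
        rw [pow_one] at h
        rw [← mul_pow]
        exact Ideal.pow_mem_pow h n⟩ := by
  refine Subtype.ext ?_
  simp [coverMonomial, smul_pow]

theorem coverMonomial_period {c : R} (a : symbolicPower q m) (h : w * c = a) :
    coverMonomial hw hw0 m a = algebraMap R _ c := by
  refine Subtype.ext ?_
  simp only [coverMonomial, Subalgebra.coe_algebraMap]
  rw [← h, mul_comm w c, mul_smul, smul_kummerGen_pow_self hw0]
  exact (Algebra.algebraMap_eq_smul_one c).symm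

instance : Module.IsTorsionFree R (cyclicCover q hw) := by
  have : Module.IsTorsionFree R (FractionRing R) := inferInstance
  have : Module.IsTorsionFree R (KummerAlgebra m w) := Module.IsTorsionFree.trans_faithfulSMul R (FractionRing R) _
  infer_instance

end Cover

/-! ### Arithmetic in the symbol -/

section SymbolAlgebra

variable {R S B : Type*} [CommRing R] [CommRing S] [CommRing B] [Algebra R S] [Algebra R B]
  {m : ℕ} [NeZero m] (𝒜 : ZMod m → Submodule R S) [GradedAlgebra 𝒜]
  (ρ : Multiplicative (ZMod m) →* (B ≃ₐ[R] B))

theorem SymbolAlgebra.tmul_mul_tmul {j : ZMod m} (s : S) {s' : S} (hs' : s' ∈ 𝒜 j) (b b' : B) :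
    tmul 𝒜 ρ s b * tmul 𝒜 ρ s' b' = tmul 𝒜 ρ (s * s') (ρ (Multiplicative.ofAdd j) b * b') :=
  symbolMul_tmul 𝒜 ρ s hs' b b'

theorem SymbolAlgebra.left_pow (s : S) (n : ℕ) : tmul 𝒜 ρ s 1 ^ n = tmul 𝒜 ρ (s ^ n) 1 := by
  induction n with
  | zero => rw [pow_zero, pow_zero]; rfl
  | succ n ih => rw [pow_succ, ih, left_mul, pow_succ]

theorem SymbolAlgebra.right_pow (b : B) (n : ℕ) : tmul 𝒜 ρ 1 b ^ n = tmul 𝒜 ρ 1 (b ^ n) := by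
  induction n with
  | zero => rw [pow_zero, pow_zero]; rfl
  | succ n ih => rw [pow_succ, ih, right_mul, pow_succ]

theorem SymbolAlgebra.smul_tmul (r : R) (s : S) (b : B) :
    r • tmul 𝒜 ρ s b = tmul 𝒜 ρ (r • s) b := TensorProduct.smul_tmul' r s b

theorem SymbolAlgebra.tmul_smul (r : R) (s : S) (b : B) :
    tmul 𝒜 ρ s (r • b) = r • tmul 𝒜 ρ s b := TensorProduct.tmul_smul r s b

theorem SymbolAlgebra.one_def : (1 : SymbolAlgebra 𝒜 ρ) = tmul 𝒜 ρ 1 1 := rfl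

theorem SymbolAlgebra.algebraMap_eq (r : R) :
    algebraMap R (SymbolAlgebra 𝒜 ρ) r = tmul 𝒜 ρ (algebraMap R S r) 1 := by
  rw [Algebra.algebraMap_eq_smul_one, one_def, smul_tmul, Algebra.algebraMap_eq_smul_one]

theorem SymbolAlgebra.algebraMap_eq' (r : R) :
    algebraMap R (SymbolAlgebra 𝒜 ρ) r = tmul 𝒜 ρ 1 (algebraMap R B r) := by
  rw [Algebra.algebraMap_eq_smul_one, one_def, Algebra.algebraMap_eq_smul_one, tmul_smul]

end SymbolAlgebra

/-! ### Symbol pairs after localization -/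

section Localization

variable {R C Δ ι : Type*} [CommRing R] [CommRing C] [Algebra R C] [Ring Δ] [Algebra R Δ]
  (M : Submonoid R) [IsLocalization M C]

/-- Elements `X` and `Y` of `Δ` whose `m`-th powers become units of `C` become units themselves, and
their monomials span once every generator of `Δ` is such a monomial up to denominators. The last
clause keeps track of these denominators for the comparison of `Δ` with its image. -/
theorem IsSymbolPair.of_localization {m : ℕ} [NeZero m] {g : ι → Δ}
    (hg : ⊤ ≤ Submodule.span R (Set.range g)) {X Y : Δ} {ζ c u : R} (hζ : IsCharRoot m ζ)
    (hX : X ^ m = algebraMap R Δ c) (hY : Y ^ m = algebraMap R Δ u) (hYX : Y * X = ζ • (X * Y))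
    (hc : IsUnit (algebraMap R C c)) (hu : IsUnit u)
    (hgen : ∀ j, ∃ s ∈ M, ∃ (t : R) (i k : Fin m), s • g j = t • (X ^ (i : ℕ) * Y ^ (k : ℕ))) :
    ∃ x y : (C ⊗[R] Δ)ˣ, (x : C ⊗[R] Δ) = (Algebra.TensorProduct.includeRight : Δ →ₐ[R] C ⊗[R] Δ) X ∧
      (y : C ⊗[R] Δ) = (Algebra.TensorProduct.includeRight : Δ →ₐ[R] C ⊗[R] Δ) Y ∧
      IsSymbolPair m (algebraMap R C ζ) x y ∧
      (x ^ m : C ⊗[R] Δ) = algebraMap C _ (algebraMap R C c) ∧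
      (y ^ m : C ⊗[R] Δ) = algebraMap C _ (algebraMap R C u) ∧
      ∀ (d : Δ) (s t : R) (n k : ℕ), s • d = t • (X ^ n * Y ^ k) →
        s • (Algebra.TensorProduct.includeRight : Δ →ₐ[R] C ⊗[R] Δ) d = t • (x ^ n * y ^ k) := by
  set f : Δ →ₐ[R] C ⊗[R] Δ := Algebra.TensorProduct.includeRight with hf
  have hf' : ∀ r : R, f (algebraMap R _ r) = algebraMap C _ (algebraMap R C r) := by
    intro r
    rw [AlgHom.commutes, ← IsScalarTower.algebraMap_apply]
  have hXu : IsUnit (f X) := by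
    rw [← isUnit_pow_iff (NeZero.ne m), ← map_pow, hX, hf']
    exact hc.map _
  have hYu : IsUnit (f Y) := by
    rw [← isUnit_pow_iff (NeZero.ne m), ← map_pow, hY, hf']
    exact (hu.map _).map _
  refine ⟨hXu.unit, hYu.unit, rfl, rfl, ⟨hζ.map _, ?_, ?_⟩, ?_, ?_, ?_⟩
  · simp only [IsUnit.unit_spec]
    rw [← map_mul, hYX, map_smul, map_mul, algebraMap_smul]
  · simp only [IsUnit.unit_spec]
    set N := Submodule.span C (Set.range fun p : Fin m × Fin m => f X ^ (p.1 : ℕ) * f Y ^ (p.2 : ℕ))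
    have h1 : ∀ z, f z ∈ N := by
      intro z
      have hle : Submodule.span R (Set.range g) ≤ (N.restrictScalars R).comap f.toLinearMap := by
        rw [Submodule.span_le]
        rintro _ ⟨j, rfl⟩
        obtain ⟨s, hs, t, i, k, h⟩ := hgen j
        have h6 := congrArg f h
        rw [map_smul, map_smul, ← algebraMap_smul C s, ← algebraMap_smul C t, map_mul, map_pow,
          map_pow] at h6
        have h7 : f (g j) = (((IsLocalization.map_units C ⟨s, hs⟩).unit⁻¹ : Cˣ) : C) •
            algebraMap R C t • (f X ^ (i : ℕ) * f Y ^ (k : ℕ)) := by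
          rw [← h6, smul_smul]
          simp
        change f (g j) ∈ N
        rw [h7]
        exact Submodule.smul_mem _ _ (Submodule.smul_mem _ _ (Submodule.subset_span ⟨(i, k), rfl⟩))
      exact hle (hg trivial)
    intro z _
    induction z with
    | zero => exact zero_mem _
    | add a b ha hb => exact add_mem (ha trivial) (hb trivial)
    | tmul c z =>
      rw [← mul_one c, ← smul_eq_mul, ← TensorProduct.smul_tmul']
      exact Submodule.smul_mem _ _ (h1 z)
  · rw [IsUnit.unit_spec, ← map_pow, hX, hf']
  · rw [IsUnit.unit_spec, ← map_pow, hY, hf']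
  · intro d s t n k hd
    rw [IsUnit.unit_spec, IsUnit.unit_spec, ← map_smul, hd, map_smul, map_mul, map_pow, map_pow]

end Localization

/-! ### The localized symbol of the cyclic cover as a symbol algebra -/

section CoverSymbol

variable {R : Type*} [CommRing R] [IsDomain R] {q : Ideal R} [q.IsPrime] {m : ℕ} [NeZero m] {w : R}
  (hw : Ideal.span {w} = symbolicPower q m) (hw0 : w ≠ 0)
  {B : Type*} [CommRing B] [Algebra R B] {ρ : Multiplicative (ZMod m) →* (B ≃ₐ[R] B)}
  {ζ u : R} {b : B} (h : IsKummerGenerator ρ ζ u b)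

open SymbolAlgebra

/-- The element `a tⁿ bᵏ` of the symbol. -/
noncomputable def symbolMonomial (ρ : Multiplicative (ZMod m) →* (B ≃ₐ[R] B)) (b : B)
    (n : ℕ) (a : symbolicPower q n) (k : ℕ) :
    SymbolAlgebra (cyclicCoverGrading q hw) ρ :=
  tmul _ ρ (coverMonomial hw hw0 n a) (b ^ k)

theorem smul_symbolMonomial_eq {π : R} (hπ : π ∈ symbolicPower q 1) (n : ℕ) (a : symbolicPower q n)
    (k : ℕ) {s t : R} (hst : s * a = π ^ n * t) :
    s • symbolMonomial hw hw0 ρ b n a k =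
      t • (tmul _ ρ (coverMonomial hw hw0 1 ⟨π, hπ⟩) 1 ^ n * tmul _ ρ 1 b ^ k) := by
  rw [SymbolAlgebra.left_pow, SymbolAlgebra.right_pow, mul_eq_tmul, coverMonomial_pow, symbolMonomial,
    SymbolAlgebra.smul_tmul, SymbolAlgebra.smul_tmul, smul_coverMonomial, smul_coverMonomial]
  congr 2
  exact Subtype.ext (hst.trans (mul_comm _ _))

include h in
theorem span_symbolMonomial : ⊤ ≤ Submodule.span R (Set.range
    fun p : Σ i : Fin m, symbolicPower q (i : ℕ) × Fin m =>
      symbolMonomial hw hw0 ρ b p.1 p.2.1 p.2.2) := by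
  intro z _
  induction z using homogeneous_tensor_induction (cyclicCoverGrading q hw) with
  | h0 => exact zero_mem _
  | hadd x y hx hy => exact add_mem (hx trivial) (hy trivial)
  | h1 j s b' hs =>
    obtain ⟨a, rfl⟩ := exists_coverMonomial_eq hw hw0 j hs
    obtain ⟨c, rfl⟩ := (Submodule.mem_span_range_iff_exists_fun _).mp
      (h.span (Submodule.mem_top : b' ∈ ⊤))
    rw [TensorProduct.tmul_sum]
    refine Submodule.sum_mem _ fun k _ => ?_
    rw [TensorProduct.tmul_smul]
    refine Submodule.smul_mem _ _ (Submodule.subset_span ⟨⟨⟨j.val, ZMod.val_lt j⟩, a, k⟩, rfl⟩)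

include h in
-- The basis of `B` makes the symbol a direct sum of copies of the cyclic cover, which is
-- torsion-free.
theorem symbolAlgebra_eq_zero_of_smul [FaithfulSMul R B] {r : R} (hr : r ≠ 0)
    {z : SymbolAlgebra (cyclicCoverGrading q hw) ρ} (hz : r • z = 0) : z = 0 := by
  have : ∀ z : cyclicCover q hw ⊗[R] B, r • z = 0 → z = 0 := by
    intro z hz
    let e := TensorProduct.equivFinsuppOfBasisRight (R := R) (M := cyclicCover q hw) h.basis
    have h1 : r • e z = 0 := by rw [← map_smul, hz, map_zero]
    rw [← e.map_eq_zero_iff]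
    ext k : 1
    exact (smul_eq_zero.mp (DFunLike.congr_fun h1 k)).resolve_left hr
  exact this z hz

include h in
theorem nontrivial_symbolAlgebra [FaithfulSMul R B] :
    Nontrivial (SymbolAlgebra (cyclicCoverGrading q hw) ρ) := by
  let e := TensorProduct.equivFinsuppOfBasisRight (R := R) (M := cyclicCover q hw) h.basis
  have h1 : Nontrivial (KummerAlgebra m w) := ⟨_, _, (linearIndependent_kummerGen_pow m w).ne_zero 0⟩
  have h2 : Nontrivial (cyclicCover q hw) := inferInstance
  exact e.toEquiv.nontrivial

include h hw in
theorem symbolAlgebra_finite [IsNoetherianRing R] :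
    Module.Finite R (SymbolAlgebra (cyclicCoverGrading q hw) ρ) := by
  have hB : Module.Finite R B := ⟨Submodule.fg_def.mpr
    ⟨_, Set.finite_range _, le_antisymm le_top h.span⟩⟩
  have hS : Module.Finite R (cyclicCover q hw) := by
    have h1 : ∀ i, (cyclicCoverPiece q m w i).FG := fun i => (IsNoetherian.noetherian _).map _
    have h2 : (⨆ i, cyclicCoverPiece q m w i).FG := Submodule.fg_iSup _ h1
    exact Module.Finite.iff_fg.mpr h2
  exact inferInstanceAs (Module.Finite R (cyclicCover q hw ⊗[R] B))

variable {C : Type*} [CommRing C] [Algebra R C] (M : Submonoid R) [IsLocalization M C]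

include h in
theorem includeRight_injective_symbolAlgebra [FaithfulSMul R B] (hM : M ≤ nonZeroDivisors R) :
    Function.Injective (Algebra.TensorProduct.includeRight :
      SymbolAlgebra (cyclicCoverGrading q hw) ρ →ₐ[R] C ⊗[R] _) := by
  rw [injective_iff_map_eq_zero]
  intro z hz
  have := (IsLocalizedModule.eq_zero_iff M
    (TensorProduct.mk R C (SymbolAlgebra (cyclicCoverGrading q hw) ρ) 1)).mp hz
  obtain ⟨s, hs⟩ := this
  exact symbolAlgebra_eq_zero_of_smul hw h (nonZeroDivisors.ne_zero (hM s.2)) hs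

include h M in
theorem faithfulSMul_symbolAlgebra [FaithfulSMul R B] :
    FaithfulSMul C (C ⊗[R] SymbolAlgebra (cyclicCoverGrading q hw) ρ) := by
  have := nontrivial_symbolAlgebra hw h
  have : Module.Flat R C := IsLocalization.flat C M
  have hinj : Function.Injective (algebraMap R (SymbolAlgebra (cyclicCoverGrading q hw) ρ)) := by
    rw [injective_iff_map_eq_zero]
    intro r hr
    by_contra hr0
    exact one_ne_zero (symbolAlgebra_eq_zero_of_smul hw h hr0
      ((Algebra.algebraMap_eq_smul_one r).symm.trans hr))
  exact (faithfulSMul_iff_algebraMap_injective C _).mpr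
    (Algebra.TensorProduct.includeLeft_injective (S := R) (A := C) hinj)

include h in
/-- The localization of the symbol is generated by a symbol pair, if the symbolic powers of `q`
become powers of a principal ideal. -/
theorem exists_isSymbolPair {π : R} (hπ : π ∈ q)
    (hgen : ∀ n, ∀ a ∈ symbolicPower q n, ∃ s ∈ M, ∃ t, s * a = π ^ n * t) :
    ∃ (x y : (C ⊗[R] SymbolAlgebra (cyclicCoverGrading q hw) ρ)ˣ) (c : R),
      w * c = π ^ m ∧ IsUnit (algebraMap R C c) ∧
      IsSymbolPair m (algebraMap R C ζ) x y ∧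
      (x ^ m : C ⊗[R] SymbolAlgebra (cyclicCoverGrading q hw) ρ) =
        algebraMap C _ (algebraMap R C c) ∧
      (y ^ m : C ⊗[R] SymbolAlgebra (cyclicCoverGrading q hw) ρ) =
        algebraMap C _ (algebraMap R C u) ∧
      ∀ (n : ℕ) (a : symbolicPower q n) (k : ℕ),
        π ^ n • (Algebra.TensorProduct.includeRight (symbolMonomial hw hw0 ρ b n a k) :
          C ⊗[R] SymbolAlgebra (cyclicCoverGrading q hw) ρ) = (a : R) • (x ^ n * y ^ k) := by
  have hπ1 : π ∈ symbolicPower q 1 := by simpa using pow_mem_symbolicPower hπ 1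
  have hπm : π ^ m ∈ symbolicPower q m := pow_mem_symbolicPower hπ m
  -- The slot will be `x = π t`, and `c = π ^ m / w` is its `m`-th power.
  obtain ⟨c, hc⟩ : ∃ c, w * c = π ^ m := by
    rw [← hw, Ideal.mem_span_singleton] at hπm
    exact ⟨_, hπm.choose_spec.symm⟩
  -- Some `s` in `M` satisfies `s w = π ^ m * t`, so `s = c * t` and `c` divides a unit of the
  -- localization.
  have hcu : IsUnit (algebraMap R C c) := by
    obtain ⟨s, hs, t, hst⟩ := hgen m w (hw ▸ Ideal.mem_span_singleton_self w)
    rw [← hc, mul_comm, mul_assoc] at hst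
    have : s = c * t := mul_left_cancel₀ hw0 hst
    exact isUnit_of_dvd_unit (Dvd.intro (algebraMap R C t) (by rw [← map_mul, ← this]))
      (IsLocalization.map_units C ⟨s, hs⟩)
  have hmon := fun n a k s t => smul_symbolMonomial_eq hw hw0 (ρ := ρ) (b := b) hπ1 n a k (s := s) (t := t)
  have hX : tmul (cyclicCoverGrading q hw) ρ (coverMonomial hw hw0 1 ⟨π, hπ1⟩) 1 ^ m = algebraMap R _ c := by
    rw [SymbolAlgebra.left_pow, coverMonomial_pow, coverMonomial_period hw hw0 _ hc]
    exact (SymbolAlgebra.algebraMap_eq _ _ _).symm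
  have hY : tmul (cyclicCoverGrading q hw) ρ 1 b ^ m = algebraMap R _ u := by
    rw [SymbolAlgebra.right_pow, h.pow_eq]
    exact (SymbolAlgebra.algebraMap_eq' _ _ _).symm
  have hYX : tmul (cyclicCoverGrading q hw) ρ 1 b * tmul _ ρ (coverMonomial hw hw0 1 ⟨π, hπ1⟩) 1 =
      ζ • (tmul _ ρ (coverMonomial hw hw0 1 ⟨π, hπ1⟩) 1 * tmul _ ρ 1 b) := by
    rw [mul_eq_tmul, tmul_mul_tmul _ _ _ (coverMonomial_mem hw hw0 1 _), one_mul, mul_one,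
      Nat.cast_one, h.act, SymbolAlgebra.tmul_smul]
  obtain ⟨x, y, -, -, hpair, hxm, hym, hval⟩ := IsSymbolPair.of_localization (C := C) M
    (span_symbolMonomial hw hw0 h) h.charRoot hX hY hYX hcu h.isUnit (by
      rintro ⟨i, a, k⟩
      obtain ⟨s, hs, t, hst⟩ := hgen i a a.2
      exact ⟨s, hs, t, i, k, hmon i a k s t hst⟩)
  exact ⟨x, y, c, hc, hcu, hpair, hxm, hym, fun n a k => hval _ _ _ _ _ (hmon n a k _ _ rfl)⟩

end CoverSymbol

/-! ### Integrality of coefficients in a symbol algebra -/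

section Integrality

variable {R K A : Type*} [CommRing R] [Field K] [Algebra R K] [Ring A]
  [Algebra K A] [Algebra R A] [IsScalarTower R K A] {m : ℕ} [NeZero m] {ζ : R}

theorem isIntegral_conj {g : Aˣ} {x : A} (hx : IsIntegral R x) :
    IsIntegral R ((g : A) * x * (g⁻¹ : Aˣ)) := by
  have := hx.map (MulSemiringAction.toAlgHom R A (ConjAct.toConjAct g))
  simpa [ConjAct.units_smul_def] using this

/-- Conjugation by powers of `t⁻¹` multiplies `yᵏ` by powers of `ζ ^ k`, so the sum of the
conjugates is `m` times the constant term. The conjugates are integral and lie in the commutative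
algebra `K[y]`, where sums of integral elements are integral; in `A` itself this could fail. -/
theorem IsSymbolPair.isIntegral_coeff {t y : Aˣ} (h : IsSymbolPair m (algebraMap R K ζ) t y)
    (hζ : IsCharRoot m ζ) [Nontrivial A] (d : Fin m → K)
    (hd : IsIntegral R (∑ k, d k • (y ^ (k : ℕ) : A))) : IsIntegral R (d 0) := by
  let S := Algebra.adjoin K {(y : A)}
  have hyS : ∀ k : ℕ, (y ^ k : A) ∈ S := fun k => pow_mem (Algebra.self_mem_adjoin_singleton K (y : A)) k
  have hcomm : IsMulCommutative S := Algebra.isMulCommutative_adjoin K (by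
    rintro a ha b hb
    rw [Set.mem_singleton_iff.mp ha, Set.mem_singleton_iff.mp hb])
  let _ : CommRing S := { (inferInstance : Ring S) with mul_comm := hcomm.is_comm.comm }
  let e : ℕ → S := fun j => ∑ k : Fin m, (algebraMap R K ζ ^ ((k : ℕ) * j) * d k) • ⟨y ^ (k : ℕ), hyS k⟩
  have he : ∀ j, ((e j : S) : A) =
      ((t⁻¹ ^ j : Aˣ) : A) * (∑ k, d k • (y ^ (k : ℕ) : A)) * (((t⁻¹ ^ j)⁻¹ : Aˣ) : A) := by
    intro j
    simp only [e, Finset.mul_sum, Finset.sum_mul]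
    rw [AddSubmonoidClass.coe_finsetSum]
    refine Finset.sum_congr rfl fun k _ => ?_
    have := h.conj_x 0 k
    rw [pow_zero, one_mul] at this
    rw [mul_smul_comm, smul_mul_assoc, conj_pow_eq this, smul_smul, ← pow_mul, mul_comm (d k)]
    rfl
  have hint : ∀ j, IsIntegral R (e j) := by
    intro j
    rw [← isIntegral_algHom_iff (S.val.restrictScalars R) Subtype.val_injective]
    change IsIntegral R ((e j : S) : A)
    rw [he]
    exact isIntegral_conj hd
  have hsum : ∑ j ∈ Finset.range m, e j = algebraMap K S (m * d 0) := by
    simp only [e]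
    rw [Finset.sum_comm, Finset.sum_eq_single 0]
    · refine Subtype.ext ?_
      simp [Algebra.algebraMap_eq_smul_one, Nat.cast_smul_eq_nsmul, mul_smul]
    · intro k _ hk
      rw [← Finset.sum_smul, ← Finset.sum_mul]
      have := (hζ.map (algebraMap R K)).sum_eq k (fun hd =>
        hk (Fin.ext (by simpa using Nat.eq_zero_of_dvd_of_lt hd k.2)))
      simp only [mul_comm (k : ℕ), this, zero_mul, zero_smul]
    · simp
  have h1 : IsIntegral R (algebraMap K S (m * d 0)) := hsum ▸ IsIntegral.sum _ fun j _ => hint j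
  have h2 : IsIntegral R ((m : K) * d 0) :=
    (isIntegral_algebraMap_iff (algebraMap K S).injective).mp h1
  have h3 := h2.smul ((hζ.isUnit.unit⁻¹ : Rˣ) : R)
  have h4 : ((hζ.isUnit.unit⁻¹ : Rˣ) : R) • ((m : K) * d 0) = d 0 := by
    rw [← map_natCast (algebraMap R K), ← Algebra.smul_def, smul_smul]
    simp
  rwa [h4] at h3

/-- The averaging has coefficients in `R`, because `m` is already invertible there. An order
containing `g` and `g⁻¹` is therefore stable under it. -/
theorem conjProj_mem (hζ : IsCharRoot m ζ) {A₁ : Subalgebra R A} {g : Aˣ} (hg : (g : A) ∈ A₁)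
    (hg' : ((g⁻¹ : Aˣ) : A) ∈ A₁) (h : IsCharRoot m (algebraMap R K ζ)) (n : ℕ) {z : A} (hz : z ∈ A₁) :
    conjProj h g n z ∈ A₁ := by
  have hμ : ((h.isUnit.unit⁻¹ : Kˣ) : K) = algebraMap R K ((hζ.isUnit.unit⁻¹ : Rˣ) : R) := by
    rw [Units.inv_eq_of_mul_eq_one_right]
    rw [IsUnit.unit_spec, ← map_natCast (algebraMap R K), ← map_mul]
    simp
  rw [conjProj, hμ, algebraMap_smul]
  refine A₁.smul_mem (sum_mem fun j _ => ?_) _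
  rw [← map_pow, algebraMap_smul]
  refine A₁.smul_mem (mul_mem (mul_mem ?_ hz) ?_) _
  · rw [Units.val_pow_eq_pow_val]
    exact pow_mem hg j
  · rw [← inv_pow, Units.val_pow_eq_pow_val]
    exact pow_mem hg' j

/-- Recovers `t = x / π` from the local slot `x = π t`; the dependence on `π` disappears. -/
theorem IsSymbolPair.exists_rescale {ζ : K} {x y : Aˣ} (h : IsSymbolPair m ζ x y) {π w c : R}
    (hπ : algebraMap R K π ≠ 0) (hw : algebraMap R K w ≠ 0) (hc : w * c = π ^ m)
    (hx : (x ^ m : A) = algebraMap K A (algebraMap R K c)) :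
    ∃ t : Aˣ, IsSymbolPair m ζ t y ∧ (t ^ m : A) = algebraMap K A (algebraMap R K w)⁻¹ ∧
      ∀ (z : A) (n : ℕ) (a : R) (k : ℕ), π ^ n • z = a • (x ^ n * y ^ k : A) →
        z = algebraMap R K a • (t ^ n * y ^ k : A) := by
  let v : Kˣ := (Units.mk0 _ hπ)⁻¹
  have hv : (v : K) = (algebraMap R K π)⁻¹ := by simp [v]
  let t : Aˣ := Units.map (algebraMap K A).toMonoidHom v * x
  have ht : (t : A) = (v : K) • (x : A) := by
    rw [Algebra.smul_def]
    rfl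
  refine ⟨t, h.smul_left v ht, ?_, fun z n a k hz => ?_⟩
  · have hc0 : algebraMap R K c ≠ 0 := by
      intro h0
      have := congrArg (algebraMap R K) hc
      rw [map_mul, h0, mul_zero, map_pow] at this
      exact pow_ne_zero m hπ this.symm
    have hvc : (v : K) ^ m * algebraMap R K c = (algebraMap R K w)⁻¹ := by
      rw [hv, inv_pow, ← map_pow, ← hc, map_mul]
      field_simp
    rw [ht, smul_pow, hx, Algebra.smul_def, ← map_mul, hvc]
  · have hπn : algebraMap R K π ^ n ≠ 0 := pow_ne_zero n hπ
    rw [← algebraMap_smul K (π ^ n), ← algebraMap_smul K a, map_pow] at hz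
    rw [ht, smul_pow, smul_mul_assoc, smul_comm, ← hz, smul_smul, hv, inv_pow, inv_mul_cancel₀ hπn,
      one_smul]

end Integrality

/-! ### Azumaya in codimension one, and the generic symbol pair -/

section CoverSymbol

variable {R : Type*} [CommRing R] [IsDomain R] {q : Ideal R} [q.IsPrime] {m : ℕ} [NeZero m] {w : R}
  (hw : Ideal.span {w} = symbolicPower q m) (hw0 : w ≠ 0)
  {B : Type*} [CommRing B] [Algebra R B] {ρ : Multiplicative (ZMod m) →* (B ≃ₐ[R] B)}
  {ζ u : R} {b : B} (h : IsKummerGenerator ρ ζ u b)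

include h hw0 in
theorem isAzumayaInCodimOne_symbol [IsNoetherianRing R] [IsIntegrallyClosed R] [FaithfulSMul R B]
    (hq : q.height = 1) : IsAzumayaInCodimOne R (SymbolAlgebra (cyclicCoverGrading q hw) ρ) := by
  intro p _ hp
  obtain ⟨π, hπ, -, hgen⟩ := exists_local_generator_symbolicPower hq p hp
  obtain ⟨x, y, c, -, -, hpair, -⟩ := exists_isSymbolPair hw hw0 h (C := Localization.AtPrime p)
    p.primeCompl hπ hgen
  have := faithfulSMul_symbolAlgebra hw h (C := Localization.AtPrime p) p.primeCompl
  exact hpair.isAzumaya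

include h in
theorem exists_generic_isSymbolPair (hq : q ≠ ⊥) :
    ∃ (t y : (FractionRing R ⊗[R] SymbolAlgebra (cyclicCoverGrading q hw) ρ)ˣ),
      IsSymbolPair m (algebraMap R (FractionRing R) ζ) t y ∧
      (t ^ m : FractionRing R ⊗[R] SymbolAlgebra (cyclicCoverGrading q hw) ρ) =
        algebraMap (FractionRing R) _ (algebraMap R (FractionRing R) w)⁻¹ ∧
      (y ^ m : FractionRing R ⊗[R] SymbolAlgebra (cyclicCoverGrading q hw) ρ) =
        algebraMap (FractionRing R) _ (algebraMap R (FractionRing R) u) ∧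
      ∀ (n : ℕ) (a : symbolicPower q n) (k : ℕ),
        (Algebra.TensorProduct.includeRight (symbolMonomial hw hw0 ρ b n a k) :
          FractionRing R ⊗[R] SymbolAlgebra (cyclicCoverGrading q hw) ρ) =
        algebraMap R (FractionRing R) a • (t ^ n * y ^ k) := by
  obtain ⟨π, hπ, hπ0⟩ := q.ne_bot_iff.mp hq
  -- Over the field of fractions any nonzero element of `q` may serve as `π`, since its powers are
  -- allowed as denominators.
  obtain ⟨x, y, c, hc, -, hpair, hx, hy, hmon⟩ := exists_isSymbolPair hw hw0 h (C := FractionRing R)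
    (nonZeroDivisors R) hπ (fun n a _ => ⟨π ^ n, pow_mem (mem_nonZeroDivisors_of_ne_zero hπ0) n, a, rfl⟩)
  obtain ⟨t, ht, htm, hval⟩ := hpair.exists_rescale (π := π) (w := w) (by simpa using hπ0)
    (by simpa using hw0) hc hx
  exact ⟨t, y, ht, htm, hy, fun n a k => hval _ _ _ _ (hmon n a k)⟩

end CoverSymbol

/-! ### Maximality of the order -/

section Maximal

variable {R K A : Type*} [CommRing R] [IsDomain R] [IsNoetherianRing R] [IsIntegrallyClosed R]
  [Field K] [Algebra R K] [IsFractionRing R K] [Ring A]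
  [Algebra K A] [Algebra R A] [IsScalarTower R K A] {m : ℕ} [NeZero m] {ζ u w : R} {q : Ideal R}
  [q.IsPrime]

/-- An order that contains the monomials `a tⁿ yᵏ` with `a` in the `n`-th symbolic power of `q` is
spanned by these monomials. -/
theorem IsSymbolPair.mem_of_mem_order {t y : Aˣ} (h : IsSymbolPair m (algebraMap R K ζ) t y)
    (hζ : IsCharRoot m ζ) [Nontrivial A] (hq : q.height = 1) (hw : Ideal.span {w} = symbolicPower q m)
    (hw0 : w ≠ 0) (hu : IsUnit u)
    (ht : (t ^ m : A) = algebraMap K A (algebraMap R K w)⁻¹)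
    (hy : (y ^ m : A) = algebraMap K A (algebraMap R K u)) {A₁ : Subalgebra R A}
    (hfg : A₁.toSubmodule.FG) (D : Submodule R A)
    (hD : ∀ (n : ℕ), ∀ a ∈ symbolicPower q n, ∀ k : ℕ, algebraMap R K a • (t ^ n * y ^ k : A) ∈ D)
    (hDA : ∀ z ∈ D, z ∈ A₁) {z : A} (hz : z ∈ A₁) : z ∈ D := by
  have hone : (1 : R) ∈ symbolicPower q 0 := by simp [symbolicPower, Ideal.map_top]
  have hyA : ∀ k : ℕ, (y ^ k : A) ∈ A₁ := by
    intro k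
    have := hDA _ (hD 0 1 hone k)
    simpa using this
  have hy' : ((y⁻¹ : Aˣ) : A) ∈ A₁ := by
    -- As `y ^ m = u` is a unit of `R`, the inverse of `y` is a multiple of `y ^ (m - 1)` and
    -- belongs to the order.
    have h1 : ((y⁻¹ : Aˣ) : A) = ((hu.unit⁻¹ : Rˣ) : R) • (y ^ (m - 1) : A) := by
      rw [← Units.mul_right_inj y, Units.mul_inv, mul_smul_comm, ← pow_succ',
        Nat.sub_add_cancel NeZero.one_le, hy, ← IsScalarTower.algebraMap_apply,
        Algebra.algebraMap_eq_smul_one, smul_smul]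
      simp
    rw [h1]
    exact A₁.smul_mem (hyA _) _
  obtain ⟨c, hc⟩ := h.exists_coeff z
  have hrow : ∀ i : Fin m, ∑ k : Fin m, c (i, k) • (t ^ (i : ℕ) * y ^ (k : ℕ) : A) ∈ A₁ := by
    intro i
    -- Conjugation by `y` preserves the order, so the part of degree `i` in `t` stays in it.
    -- Conjugation by `t` is not available in the same way, which is why the remaining coefficients
    -- are treated by integrality.
    rw [← h.conjProj_y c i, ← hc]
    exact conjProj_mem hζ (by simpa using hyA 1) hy' _ _ hz
  rw [hc]
  refine Submodule.sum_mem _ ?_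
  rintro ⟨i, k₀⟩ -
  suffices ∃ r ∈ symbolicPower q (i : ℕ), algebraMap R K r = c (i, k₀) by
    obtain ⟨r, hr, hrc⟩ := this
    rw [← hrc]
    exact hD i r hr k₀
  refine exists_mem_symbolicPower_of_forall_mul hq i.2.le hw _ fun a ha => ?_
  have hm1 : (t ^ (m - (i : ℕ)) * t ^ (i : ℕ) : A) = algebraMap K A (algebraMap R K w)⁻¹ := by
    rw [← pow_add, Nat.sub_add_cancel i.2.le, ht]
  -- The left factor turns `tⁱ` into `t ^ m = w⁻¹`, and `y ^ (-k₀)` moves the coefficient at `k₀` to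
  -- the constant term.
  have hmem : (algebraMap R K a • (t ^ (m - (i : ℕ)) * y ^ 0 : A)) *
      (∑ k : Fin m, c (i, k) • (t ^ (i : ℕ) * y ^ (k : ℕ) : A)) * (y⁻¹ ^ (k₀ : ℕ) : Aˣ) ∈ A₁ := by
    refine mul_mem (mul_mem (hDA _ (hD _ a ha 0)) (hrow i)) ?_
    rw [Units.val_pow_eq_pow_val]
    exact pow_mem hy' _
  have hu0 : algebraMap R K u ≠ 0 := (hu.map (algebraMap R K)).ne_zero
  let e : Fin m → K := fun k => algebraMap R K a * (algebraMap R K w)⁻¹ * c (i, k)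
  -- The exponents of `y` are shifted cyclically by `k₀`. Those that wrap around pick up `y ^ (-m) =
  -- u⁻¹`.
  let d : Fin m → K := fun j =>
    if (j : ℕ) + k₀ < m then e (j + k₀) else (algebraMap R K u)⁻¹ * e (j + k₀)
  have hsum : (algebraMap R K a • (t ^ (m - (i : ℕ)) * y ^ 0 : A)) *
      (∑ k : Fin m, c (i, k) • (t ^ (i : ℕ) * y ^ (k : ℕ) : A)) * (y⁻¹ ^ (k₀ : ℕ) : Aˣ) =
      ∑ j, d j • (y ^ (j : ℕ) : A) := by
    rw [Finset.mul_sum, Finset.sum_mul, ← Equiv.sum_comp (Equiv.addRight k₀)]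
    refine Finset.sum_congr rfl fun j _ => ?_
    rw [Equiv.coe_addRight, inv_pow, Units.mul_inv_eq_iff_eq_mul, pow_zero, mul_one,
      smul_mul_smul_comm, ← mul_assoc, hm1, ← Algebra.smul_def (algebraMap R K w)⁻¹, smul_smul, smul_mul_assoc,
      Units.val_pow_eq_pow_val, ← pow_add]
    have he : algebraMap R K a * c (i, j + k₀) * (algebraMap R K w)⁻¹ = e (j + k₀) := by
      simp only [e]
      ring
    rw [he]
    by_cases hlt : (j : ℕ) + k₀ < m
    · rw [Fin.val_add_eq_of_add_lt hlt]
      simp only [d, if_pos hlt]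
    · have hv : (j : ℕ) + k₀ = m + (j + k₀ : Fin m) := by
        rw [Fin.val_add, Nat.mod_eq_sub_mod (by lia), Nat.mod_eq_of_lt (by lia)]
        lia
      simp only [d, if_neg hlt]
      rw [hv, pow_add, hy, ← Algebra.smul_def, smul_smul, mul_right_comm, inv_mul_cancel₀ hu0,
        one_mul]
  have hint := h.isIntegral_coeff hζ d (hsum ▸ IsIntegral.of_mem_of_fg A₁ hfg _ hmem)
  have hd0 : d 0 = e k₀ := by simp [d]
  rw [hd0, IsIntegrallyClosed.isIntegral_iff] at hint
  obtain ⟨r, hr⟩ := hint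
  refine ⟨r, ?_⟩
  have hwK : algebraMap R K w ≠ 0 := by simpa using hw0
  rw [map_mul, hr]
  simp only [e]
  field_simp

end Maximal

/-! ### Maximal order in a division ring, given a suitable valuation -/

section Main

variable {R : Type*} [CommRing R] [IsDomain R] [IsNoetherianRing R] [IsIntegrallyClosed R]
  {q : Ideal R} [q.IsPrime] {m : ℕ} [NeZero m] {w : R}
  (hw : Ideal.span {w} = symbolicPower q m)
  {B : Type*} [CommRing B] [Algebra R B] [FaithfulSMul R B]
  {ρ : Multiplicative (ZMod m) →* (B ≃ₐ[R] B)}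
  {ζ u : R} {b : B} (h : IsKummerGenerator ρ ζ u b)

theorem ne_zero_of_span_eq_symbolicPower (hw : Ideal.span {w} = symbolicPower q m)
    (hq : q.height = 1) : w ≠ 0 := by
  rintro rfl
  obtain ⟨π, hπ, hπ0⟩ := q.ne_bot_iff.mp (q.ne_bot_of_height_eq_one hq)
  have := hw ▸ pow_mem_symbolicPower hπ m
  simp at this
  exact hπ0 this.1

include h in
-- Isolates what geometry has to provide: a valuation ring `V` with a reduction `ψ`, for which `w`
-- is a uniformizer and the reduction of `u` has an `m`-th root of full degree.
theorem isMaximalOrderInDivisionRing_symbol (hq : q.height = 1)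
    {D : Type*} [CommRing D] [IsDomain D] (V : Subring (FractionRing R)) (ψ : V →+* D)
    (hRV : ∀ r : R, algebraMap R (FractionRing R) r ∈ V)
    (hψw : ψ ⟨_, hRV w⟩ = 0)
    (hV : ∀ z : FractionRing R, z ≠ 0 → ∃ (n : ℤ) (v : V), ψ v ≠ 0 ∧
      z = (algebraMap R (FractionRing R) w) ^ n * v)
    {y' : D} (hy' : y' ^ m = ψ ⟨_, hRV u⟩)
    (hli : ∀ g : Fin m → V, ∑ k, ψ (g k) * y' ^ (k : ℕ) = 0 → ∀ k, ψ (g k) = 0) :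
    IsMaximalOrderInDivisionRing R (SymbolAlgebra (cyclicCoverGrading q hw) ρ) := by
  have hw0 := ne_zero_of_span_eq_symbolicPower hw hq
  obtain ⟨t, y, hpair, htm, hym, hmon⟩ := exists_generic_isSymbolPair hw hw0 h
    (q.ne_bot_of_height_eq_one hq)
  have hfaith := faithfulSMul_symbolAlgebra hw h (C := FractionRing R) (nonZeroDivisors R)
  have hinj := includeRight_injective_symbolAlgebra hw h (C := FractionRing R) (nonZeroDivisors R)
    le_rfl
  have hnt := nontrivial_symbolAlgebra hw h
  have hnt' : Nontrivial (FractionRing R ⊗[R] SymbolAlgebra (cyclicCoverGrading q hw) ρ) :=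
    hinj.nontrivial
  have hfin := symbolAlgebra_finite hw h
  have haz := hpair.isAzumaya
  have hfd : FiniteDimensional (FractionRing R)
    (FractionRing R ⊗[R] SymbolAlgebra (cyclicCoverGrading q hw) ρ) := inferInstance
  have hwK : algebraMap R (FractionRing R) w ≠ 0 := by simpa using hw0
  obtain ⟨ζ', hζ'⟩ : ∃ ζ' : R, ζ * ζ' = 1 :=
    ⟨ζ ^ (m - 1), by rw [← pow_succ', Nat.sub_add_cancel NeZero.one_le, h.charRoot.pow_eq]⟩
  -- The valuation argument needs a slot with `m`-th power `w`, which is `t⁻¹`.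
  have hpair' := hpair.inv_left (ζ' := algebraMap R _ ζ')
    (by rw [← map_mul, hζ', map_one]) (u := Units.mk0 _ (inv_ne_zero hwK)) htm
  have hnzd : NoZeroDivisors (FractionRing R ⊗[R] SymbolAlgebra (cyclicCoverGrading q hw) ρ) := by
    refine IsSymbolPair.noZeroDivisors (V := V) (ζ := ⟨_, hRV ζ'⟩) (w := ⟨_, hRV w⟩)
      (u := ⟨_, hRV u⟩) ψ hpair' ?_ hym hwK hψw hy' hV hli
    rw [← Units.val_pow_eq_pow_val, inv_pow, Units.inv_eq_of_mul_eq_one_left]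
    rw [Units.val_pow_eq_pow_val, htm, ← map_mul, mul_inv_cancel₀ hwK, map_one]
  have hdom : IsDomain (FractionRing R ⊗[R] SymbolAlgebra (cyclicCoverGrading q hw) ρ) :=
    NoZeroDivisors.to_isDomain _
  refine ⟨hnt', fun x hx => ?_, inferInstance, hfd, hinj, ⟨?_, ?_⟩, fun A₁ hA₁ hle => ?_⟩
  · obtain ⟨v, rfl⟩ := FiniteDimensional.isUnit (FractionRing R) hx
    exact ⟨_, v.mul_inv, v.inv_mul⟩
  · have := (Module.Finite.fg_top (R := R)).map (AlgHom.toLinearMap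
      (Algebra.TensorProduct.includeRight :
        SymbolAlgebra (cyclicCoverGrading q hw) ρ →ₐ[R] FractionRing R ⊗[R] _))
    rwa [Submodule.map_top] at this
  · rw [eq_top_iff]
    rintro z -
    induction z with
    | zero => exact zero_mem _
    | add x y hx hy => exact add_mem hx hy
    | tmul c x =>
      have : c ⊗ₜ[R] x = c • ((1 : FractionRing R) ⊗ₜ[R] x) := by
        rw [TensorProduct.smul_tmul', smul_eq_mul, mul_one]
      rw [this]
      exact Submodule.smul_mem _ c (Submodule.subset_span
        (AlgHom.mem_range_self Algebra.TensorProduct.includeRight x))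
  · refine le_antisymm (fun z hz => ?_) hle
    refine hpair.mem_of_mem_order h.charRoot hq hw hw0 h.isUnit htm hym hA₁.1
      (Subalgebra.toSubmodule (AlgHom.range _)) (fun n a ha k => ?_) (fun z hz => hle hz) hz
    have h1 := AlgHom.mem_range_self (Algebra.TensorProduct.includeRight :
      SymbolAlgebra (cyclicCoverGrading q hw) ρ →ₐ[R] FractionRing R ⊗[R] _)
      (symbolMonomial hw hw0 ρ b n ⟨a, ha⟩ k)
    rw [hmon n ⟨a, ha⟩ k] at h1
    exact h1

/-- The extension of the coefficients of rational functions. -/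
noncomputable def ratFuncMap (k L : Type*) [Field k] [Field L] [Algebra k L] : RatFunc k →+* RatFunc L :=
  IsLocalization.map (RatFunc L) (Polynomial.mapRingHom (algebraMap k L))
    (nonZeroDivisors_le_comap_nonZeroDivisors_of_injective _
      (Polynomial.map_injective _ (algebraMap k L).injective))

theorem ratFuncMap_algebraMap {k L : Type*} [Field k] [Field L] [Algebra k L] (r : Polynomial k) :
    ratFuncMap k L (algebraMap _ _ r) = algebraMap (Polynomial L) _ (r.map (algebraMap k L)) :=
  IsLocalization.map_eq _ _

/-- Powers that are linearly independent over a field remain so over its field of rational functions. -/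
theorem sum_map_ratFunc_mul_pow_eq_zero {k L : Type*} [Field k] [Field L] [Algebra k L] {α : L}
    (hα : LinearIndependent k (fun i : Fin m => α ^ (i : ℕ))) (g : Fin m → RatFunc k)
    (hg : ∑ i, ratFuncMap k L (g i) *
      RatFunc.C α ^ (i : ℕ) = 0) (i : Fin m) : g i = 0 := by
  classical
  -- After a common denominator is cleared, the relation is one between polynomials and can be read
  -- off coefficient by coefficient.
  obtain ⟨d, hd⟩ := IsLocalization.exist_integer_multiples_of_finite
    (nonZeroDivisors (Polynomial k)) g
  choose p hp using hd
  have hd0 : algebraMap (Polynomial k) (RatFunc k) d ≠ 0 := by simp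
  have hp' : ∀ i, algebraMap (Polynomial k) (RatFunc k) (p i) = algebraMap _ _ (d : Polynomial k) * g i := by
    intro i
    rw [← Algebra.smul_def]
    exact hp i
  have h1 : ∑ i, (p i).map (algebraMap k L) * Polynomial.C (α ^ (i : ℕ)) = 0 := by
    refine IsFractionRing.injective (Polynomial L) (RatFunc L) ?_
    rw [map_zero, map_sum, ← mul_zero (ratFuncMap k L (algebraMap _ _ (d : Polynomial k))), ← hg, Finset.mul_sum]
    refine Finset.sum_congr rfl fun i _ => ?_
    rw [map_mul, ← ratFuncMap_algebraMap, hp', map_mul, mul_assoc, RatFunc.algebraMap_C, map_pow]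
  have h2 : p i = 0 := by
    ext n
    have h3 := congrArg (Polynomial.coeff · n) h1
    simp only [Polynomial.finsetSum_coeff, Polynomial.coeff_mul_C, Polynomial.coeff_map,
      Polynomial.coeff_zero, ← Algebra.smul_def] at h3
    exact Fintype.linearIndependent_iff.mp hα (fun i => (p i).coeff n) h3 i
  have h4 := hp' i
  rw [h2, map_zero] at h4
  exact (mul_eq_zero.mp h4.symm).resolve_left hd0

end Main

/-! ### The symbol attached to a cyclic étale lift -/

section Lift

variable {R : Type*} [CommRing R] [IsDomain R] [IsNoetherianRing R] [IsIntegrallyClosed R]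
    [HenselianLocalRing R] {q : Ideal R} [q.IsPrime] (hq : q.height = 1) {m : ℕ} [NeZero m] {w : R}
    (hw : Ideal.span {w} = symbolicPower q m)
    (hζ : ∃ ζ : IsLocalRing.ResidueField R, IsPrimitiveRoot ζ m)
    {L : Type*} [Field L] [Algebra (IsLocalRing.ResidueField R) L] [Algebra R L]
    [IsScalarTower R (IsLocalRing.ResidueField R) L]
    [FiniteDimensional (IsLocalRing.ResidueField R) L] [IsGalois (IsLocalRing.ResidueField R) L]
    {τ : Multiplicative (ZMod m) ≃* (L ≃ₐ[IsLocalRing.ResidueField R] L)}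
    {B : Type*} [CommRing B] [Algebra R B] {ρ : Multiplicative (ZMod m) →* (B ≃ₐ[R] B)}
    {red : B →ₐ[R] L} (hB : IsCyclicEtaleLift τ ρ red)

include hB in
-- A finite étale algebra over a local ring is free, and this one is nonzero because it maps onto
-- `L`.
theorem IsCyclicEtaleLift.faithfulSMul : FaithfulSMul R B := by
  have := hB.finite
  have := hB.etale
  have hflat : Module.Flat R B := inferInstance
  have hfree : Module.Free R B := Module.free_of_flat_of_isLocalRing
  have : Nontrivial B := hB.surjective.nontrivial
  infer_instance

include hq hw hζ hB in
/-- The symbol is a maximal order in a division ring, and Azumaya in codimension one, if `w` is a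
uniformizer of a discrete valuation of the field of fractions whose residue field is the field of
rational functions over the residue field of `R`. -/
theorem IsCyclicEtaleLift.isMaximalOrder_and_isAzumayaInCodimOne
    (V : Subring (FractionRing R)) (ψ : V →+* RatFunc (IsLocalRing.ResidueField R))
    (hRV : ∀ r : R, algebraMap R (FractionRing R) r ∈ V)
    (hψ : ∀ r, ψ ⟨_, hRV r⟩ = RatFunc.C (IsLocalRing.residue R r))
    (hψw : ψ ⟨_, hRV w⟩ = 0)
    (hV : ∀ z : FractionRing R, z ≠ 0 → ∃ (n : ℤ) (v : V), ψ v ≠ 0 ∧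
      z = (algebraMap R (FractionRing R) w) ^ n * v) :
    IsMaximalOrderInDivisionRing R (SymbolAlgebra (cyclicCoverGrading q hw) ρ) ∧
      IsAzumayaInCodimOne R (SymbolAlgebra (cyclicCoverGrading q hw) ρ) := by
  obtain ⟨ζ, u, b, α, hchar, hu, hbm, hρ, hspan, hαu, hli⟩ := hB.exists_kummerGenerator hζ
  have h : IsKummerGenerator ρ ζ u b := ⟨hchar, hu, hbm, hρ, hspan⟩
  have := hB.faithfulSMul
  let F := ratFuncMap (IsLocalRing.ResidueField R) L
  refine ⟨?_, isAzumayaInCodimOne_symbol hw (ne_zero_of_span_eq_symbolicPower hw hq) h hq⟩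
  have hFC : ∀ c, F (RatFunc.C c) = RatFunc.C (algebraMap _ L c) := by
    intro c
    rw [← RatFunc.algebraMap_C, ← RatFunc.algebraMap_C]
    rw [ratFuncMap_algebraMap, Polynomial.map_C]
  -- The reduction is composed with the inclusion of the rational functions over `κ` in those over
  -- `L`, where `α` is the required root of `u`.
  refine isMaximalOrderInDivisionRing_symbol hw h hq V (F.comp ψ) hRV ?_ (fun z hz => ?_)
    (y' := RatFunc.C α) ?_ (fun g hg k => ?_)
  · rw [RingHom.comp_apply, hψw, map_zero]
  · obtain ⟨n, v, hv, rfl⟩ := hV z hz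
    exact ⟨n, v, by simpa using hv, rfl⟩
  · rw [RingHom.comp_apply, hψ, hFC, ← hαu, map_pow]
  · rw [RingHom.comp_apply, sum_map_ratFunc_mul_pow_eq_zero hli (fun k => ψ (g k)) hg k, map_zero]

end Lift

/-! ### Dimensions of quotients by principal ideals -/

section QuotientDegree

variable (k : Type*) {D : Type*} [Field k] [CommRing D] [IsDomain D] [Algebra k D]

/-- The quotients of `D` by nonzero principal ideals are finite-dimensional over `k`. -/
def HasFinitePrincipalQuotients (D : Type*) [CommRing D] [Algebra k D] : Prop :=
  ∀ a : D, a ≠ 0 → Module.Finite k (D ⧸ Ideal.span {a})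

/-- Multiplication by `a` as a linear map from `D / b` to `D / ab`. -/
def quotMulLeft (a b : D) : (D ⧸ Ideal.span {b}) →ₗ[k] D ⧸ Ideal.span {a * b} :=
  (Submodule.mapQ (Ideal.span {b}) (Ideal.span {a * b}) (LinearMap.mulLeft D a) (by
    rw [Ideal.span, Submodule.span_le]
    rintro _ rfl
    exact Ideal.mem_span_singleton_self _)).restrictScalars k

/-- The projection from `D / ab` to `D / a`. -/
def quotProj (a b : D) : (D ⧸ Ideal.span {a * b}) →ₗ[k] D ⧸ Ideal.span {a} :=
  (Ideal.Quotient.factorₐ k (I := Ideal.span {a * b}) (J := Ideal.span {a})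
    (Ideal.span_singleton_le_span_singleton.mpr (Dvd.intro b rfl))).toLinearMap

theorem quotMulLeft_injective {a : D} (ha : a ≠ 0) (b : D) :
    Function.Injective (quotMulLeft k a b) := by
  rw [injective_iff_map_eq_zero]
  intro z hz
  obtain ⟨z, rfl⟩ := Ideal.Quotient.mk_surjective z
  have hz' : Ideal.Quotient.mk (Ideal.span {a * b}) (a * z) = 0 := hz
  rw [Ideal.Quotient.eq_zero_iff_mem, Ideal.mem_span_singleton] at hz' ⊢
  exact (mul_dvd_mul_iff_left ha).mp hz'

theorem quotProj_surjective (a b : D) : Function.Surjective (quotProj k a b) :=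
  Ideal.Quotient.factor_surjective (Ideal.span_singleton_le_span_singleton.mpr (Dvd.intro b rfl))

theorem exact_quotMulLeft_quotProj (a b : D) :
    Function.Exact (quotMulLeft k a b) (quotProj k a b) := by
  intro z
  obtain ⟨z, rfl⟩ := Ideal.Quotient.mk_surjective z
  constructor
  · intro hz
    have hz' : Ideal.Quotient.mk (Ideal.span {a}) z = 0 := hz
    rw [Ideal.Quotient.eq_zero_iff_mem, Ideal.mem_span_singleton] at hz'
    obtain ⟨c, rfl⟩ := hz'
    exact ⟨Ideal.Quotient.mk _ c, rfl⟩
  · rintro ⟨c, hc⟩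
    obtain ⟨c, rfl⟩ := Ideal.Quotient.mk_surjective c
    rw [← hc]
    change Ideal.Quotient.mk (Ideal.span {a}) (a * c) = 0
    rw [Ideal.Quotient.eq_zero_iff_mem, Ideal.mem_span_singleton]
    exact dvd_mul_right _ _

theorem finite_quotient_mul {a b : D} (ha : Module.Finite k (D ⧸ Ideal.span {a}))
    (hb : Module.Finite k (D ⧸ Ideal.span {b})) : Module.Finite k (D ⧸ Ideal.span {a * b}) :=
  Module.Finite.of_exact (exact_quotMulLeft_quotProj k a b) (quotProj_surjective k a b)

variable {k}

/-- Additivity of dimension in the exact sequence `0 → D/b → D/ab → D/a → 0`. -/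
theorem HasFinitePrincipalQuotients.finrank_mul (h : HasFinitePrincipalQuotients k D) {a b : D}
    (ha : a ≠ 0) (hb : b ≠ 0) : Module.finrank k (D ⧸ Ideal.span {a * b}) =
      Module.finrank k (D ⧸ Ideal.span {a}) + Module.finrank k (D ⧸ Ideal.span {b}) := by
  have := h _ (mul_ne_zero ha hb)
  rw [← (quotProj k a b).finrank_range_add_finrank_ker,
    LinearMap.range_eq_top.mpr (quotProj_surjective k a b), finrank_top,
    LinearMap.exact_iff.mp (exact_quotMulLeft_quotProj k a b),
    LinearMap.finrank_range_of_inj (quotMulLeft_injective k ha b)]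

theorem finrank_quotient_of_isUnit {a : D} (ha : IsUnit a) :
    Module.finrank k (D ⧸ Ideal.span {a}) = 0 := by
  rw [Ideal.span_singleton_eq_top.mpr ha]
  exact Module.finrank_zero_of_subsingleton

theorem HasFinitePrincipalQuotients.finrank_pow (h : HasFinitePrincipalQuotients k D) {a : D}
    (ha : a ≠ 0) (n : ℕ) : Module.finrank k (D ⧸ Ideal.span {a ^ n}) =
      n * Module.finrank k (D ⧸ Ideal.span {a}) := by
  induction n with
  | zero => rw [pow_zero, finrank_quotient_of_isUnit isUnit_one, zero_mul]
  | succ n ih => rw [pow_succ, h.finrank_mul (pow_ne_zero n ha) ha, ih, add_mul, one_mul]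

theorem HasFinitePrincipalQuotients.finrank_prod (h : HasFinitePrincipalQuotients k D) {ι : Type*}
    (s : Finset ι) {a : ι → D} (ha : ∀ i ∈ s, a i ≠ 0) :
    Module.finrank k (D ⧸ Ideal.span {∏ i ∈ s, a i}) =
      ∑ i ∈ s, Module.finrank k (D ⧸ Ideal.span {a i}) := by
  classical
  induction s using Finset.induction with
  | empty => rw [Finset.prod_empty, finrank_quotient_of_isUnit isUnit_one, Finset.sum_empty]
  | insert i s hi ih =>
    rw [Finset.prod_insert hi, Finset.sum_insert hi, h.finrank_mul (ha i (by simp))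
      (Finset.prod_ne_zero_iff.mpr fun j hj => ha j (by simp [hj])), ih fun j hj => ha j (by simp [hj])]

variable (k D) {F : Type*} [Field F] [Algebra D F] [IsFractionRing D F]

/-- The dimension of `D / a` minus that of `D / b`, for a fraction `a / b`. -/
noncomputable def fractionDegree (φ : F) : ℤ :=
  (Module.finrank k (D ⧸ Ideal.span {(IsLocalization.sec (nonZeroDivisors D) φ).1}) : ℤ) -
    Module.finrank k (D ⧸ Ideal.span {((IsLocalization.sec (nonZeroDivisors D) φ).2 : D)})

variable {k D} (h : HasFinitePrincipalQuotients k D)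
include h

theorem fractionDegree_eq {φ : F} (hφ : φ ≠ 0) {a b : D} (hb : b ≠ 0)
    (hab : φ * algebraMap D F b = algebraMap D F a) :
    fractionDegree k D φ = (Module.finrank k (D ⧸ Ideal.span {a}) : ℤ) -
      Module.finrank k (D ⧸ Ideal.span {b}) := by
  have hsec := IsLocalization.sec_spec (nonZeroDivisors D) φ
  set s := IsLocalization.sec (nonZeroDivisors D) φ with hs
  have hs2 : (s.2 : D) ≠ 0 := nonZeroDivisors.coe_ne_zero _
  have hinj := IsFractionRing.injective D F
  have hs1 : s.1 ≠ 0 := by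
    intro h0
    rw [h0, map_zero, mul_eq_zero] at hsec
    exact hsec.elim hφ (by simp)
  have ha : a ≠ 0 := by
    rintro rfl
    rw [map_zero, mul_eq_zero] at hab
    exact hab.elim hφ (by simpa using hb)
  have heq : s.1 * b = a * s.2 := hinj (by rw [map_mul, map_mul, ← hsec, ← hab]; ring)
  have h1 := h.finrank_mul hs1 hb
  rw [heq, h.finrank_mul ha hs2] at h1
  rw [fractionDegree, ← hs]
  lia

theorem fractionDegree_algebraMap {a : D} (ha : a ≠ 0) :
    fractionDegree k D (algebraMap D F a) = Module.finrank k (D ⧸ Ideal.span {a}) := by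
  rw [fractionDegree_eq h (by simpa using ha) one_ne_zero (a := a) (by simp),
    finrank_quotient_of_isUnit isUnit_one]
  simp

theorem fractionDegree_mul {φ ψ : F} (hφ : φ ≠ 0) (hψ : ψ ≠ 0) :
    fractionDegree k D (φ * ψ) = fractionDegree k D φ + fractionDegree k D ψ := by
  obtain ⟨a, b, hb, rfl⟩ := IsFractionRing.div_surjective (A := D) φ
  obtain ⟨c, d, hd, rfl⟩ := IsFractionRing.div_surjective (A := D) ψ
  have hb0 := nonZeroDivisors.ne_zero hb
  have hd0 := nonZeroDivisors.ne_zero hd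
  have hb' : algebraMap D F b ≠ 0 := by simpa using hb0
  have hd' : algebraMap D F d ≠ 0 := by simpa using hd0
  have ha0 : a ≠ 0 := by rintro rfl; simp at hφ
  have hc0 : c ≠ 0 := by rintro rfl; simp at hψ
  rw [fractionDegree_eq h hφ hb0 (a := a) (by field_simp),
    fractionDegree_eq h hψ hd0 (a := c) (by field_simp),
    fractionDegree_eq h (mul_ne_zero hφ hψ) (mul_ne_zero hb0 hd0) (a := a * c)
      (by rw [map_mul, map_mul]; field_simp), h.finrank_mul ha0 hc0, h.finrank_mul hb0 hd0]
  push_cast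
  ring

end QuotientDegree

/-! ### Localizations of a polynomial ring in one variable -/

section LocalPolynomial

open Polynomial

variable {k D : Type*} [Field k] [CommRing D] [IsDomain D] [Algebra k D] [Algebra k[X] D]
  [IsScalarTower k k[X] D]

/-- The ideal `(p)` is maximal, so localizing at it does not change the quotient by it, and
`k[X]/(p)` has dimension the degree of `p`. -/
theorem finrank_quotient_map_irreducible (P : Ideal k[X]) [P.IsPrime] [IsLocalization.AtPrime D P]
    {p : k[X]} (hp : Irreducible p) (hP : P = Ideal.span {p}) :
    Module.Finite k (D ⧸ Ideal.span {algebraMap k[X] D p}) ∧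
      Module.finrank k (D ⧸ Ideal.span {algebraMap k[X] D p}) = p.natDegree := by
  have := IsLocalization.AtPrime.isLocalRing D P
  have hmax : P.IsMaximal := hP ▸ PrincipalIdealRing.isMaximal_of_irreducible hp
  have hmap : IsLocalRing.maximalIdeal D = Ideal.span {algebraMap k[X] D p} := by
    rw [← IsLocalization.AtPrime.map_eq_maximalIdeal P D, hP, Ideal.map_span, Set.image_singleton]
  let e : (k[X] ⧸ Ideal.span {p}) ≃ₗ[k] D ⧸ Ideal.span {algebraMap k[X] D p} :=
    LinearEquiv.ofBijective ((Ideal.quotientMapₐ (Ideal.span {algebraMap k[X] D p})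
      (IsScalarTower.toAlgHom k k[X] D) (by
        rw [Ideal.span_le]
        rintro _ rfl
        exact Ideal.mem_span_singleton_self _)).toLinearMap) (by
      constructor
      · rw [injective_iff_map_eq_zero]
        intro z hz
        obtain ⟨z, rfl⟩ := Ideal.Quotient.mk_surjective z
        have hz' : Ideal.Quotient.mk _ (algebraMap k[X] D z) = 0 := hz
        rw [Ideal.Quotient.eq_zero_iff_mem, ← hmap,
          IsLocalization.AtPrime.to_map_mem_maximal_iff D P, hP] at hz'
        exact Ideal.Quotient.eq_zero_iff_mem.mpr hz'
      · intro z
        obtain ⟨z, rfl⟩ := Ideal.Quotient.mk_surjective z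
        obtain ⟨x, hx⟩ := (IsLocalization.AtPrime.equivQuotMaximalIdeal P D).surjective
          (Ideal.Quotient.mk _ z)
        obtain ⟨x, rfl⟩ := Ideal.Quotient.mk_surjective x
        rw [IsLocalization.AtPrime.equivQuotMaximalIdeal_apply_mk, Ideal.Quotient.eq, hmap] at hx
        exact ⟨Ideal.Quotient.mk _ x, Ideal.Quotient.eq.mpr hx⟩)
  have hfin : Module.Finite k (k[X] ⧸ Ideal.span {p}) :=
    (AdjoinRoot.powerBasis hp.ne_zero).finite
  exact ⟨Module.Finite.equiv e, by rw [← e.finrank_eq, finrank_quotient_span_eq_natDegree]⟩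

/-- A localization of `k[t]` at a prime ideal is a principal ideal domain with finite-dimensional
quotients. -/
theorem hasFinitePrincipalQuotients_of_isLocalization (P : Ideal k[X]) [P.IsPrime]
    [IsLocalization.AtPrime D P] : HasFinitePrincipalQuotients k D := by
  intro a ha
  obtain ⟨⟨f, s⟩, hf⟩ := IsLocalization.surj P.primeCompl a
  have hunit : IsUnit (algebraMap k[X] D s) := IsLocalization.map_units D s
  have hinj : Function.Injective (algebraMap k[X] D) :=
    IsLocalization.injective D P.primeCompl_le_nonZeroDivisors
  -- Denominators are units, so `a` may be replaced by a polynomial. Of its irreducible factors,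
  -- only those in `P` contribute a nonzero quotient.
  have hspan : Ideal.span {a} = Ideal.span {algebraMap k[X] D f} := by
    rw [← hf, Ideal.span_singleton_mul_right_unit hunit]
  rw [hspan]
  have hf0 : f ≠ 0 := by
    rintro rfl
    rw [map_zero] at hf
    exact (mul_ne_zero ha hunit.ne_zero) hf
  clear hspan hf
  have hu : ∀ x : D, IsUnit x → Module.Finite k (D ⧸ Ideal.span {x}) := by
    intro x hx
    rw [Ideal.span_singleton_eq_top.mpr hx]
    infer_instance
  induction f using WfDvdMonoid.induction_on_irreducible with
  | zero => exact absurd rfl hf0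
  | unit u hu' => exact hu _ (hu'.map _)
  | mul f p hf1 hp ih =>
    rw [map_mul]
    refine finite_quotient_mul k ?_ (ih hf1)
    by_cases hpP : p ∈ P
    · refine (finrank_quotient_map_irreducible P hp ?_).1
      have := PrincipalIdealRing.isMaximal_of_irreducible hp
      exact (this.eq_of_le (Ideal.IsPrime.ne_top ‹_›) (by simpa [Ideal.span_le] using hpP)).symm
    · exact hu _ (IsLocalization.map_units D (⟨p, hpP⟩ : P.primeCompl))

end LocalPolynomial

/-! ### Local rings of schemes over an affine base -/

section Stalks

open CategoryTheory Limits AlgebraicGeometry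

universe u

/-- The ring homomorphism from `S` to the local ring at a point of a scheme over `S`. -/
noncomputable def stalkHom {S : CommRingCat.{u}} {P : Scheme.{u}} (g : P ⟶ Spec S) (x : P) :
    S ⟶ P.presheaf.stalk x :=
  (Scheme.ΓSpecIso S).inv ≫ g.appTop ≫ P.presheaf.germ ⊤ x trivial

/-- On spectra `stalkHom` is the canonical map from the spectrum of the local ring. As `Spec` is
faithful, the compatibilities below reduce to identities between canonical morphisms. -/
theorem SpecMap_stalkHom {S : CommRingCat.{u}} {P : Scheme.{u}} (g : P ⟶ Spec S) (x : P) :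
    Spec.map (stalkHom g x) = P.fromSpecStalk x ≫ g := by
  rw [stalkHom, Spec.map_comp, Spec.map_comp, ← Scheme.fromSpecStalk_toSpecΓ, Category.assoc,
    Category.assoc, ← Scheme.toSpecΓ_naturality_assoc, ← SpecMap_ΓSpecIso_hom, ← Spec.map_comp,
    Iso.inv_hom_id, Spec.map_id, Category.comp_id]

theorem stalkHom_stalkSpecializes {S : CommRingCat.{u}} {P : Scheme.{u}} (g : P ⟶ Spec S) {x y : P}
    (h : x ⤳ y) : stalkHom g y ≫ P.presheaf.stalkSpecializes h = stalkHom g x := by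
  apply Spec.map_injective
  rw [Spec.map_comp, SpecMap_stalkHom, SpecMap_stalkHom,
    Scheme.SpecMap_stalkSpecializes_fromSpecStalk_assoc]

theorem stalkHom_stalkMap {S : CommRingCat.{u}} {P Y : Scheme.{u}} (g : P ⟶ Spec S) (f : Y ⟶ P)
    (y : Y) : stalkHom g (f y) ≫ f.stalkMap y = stalkHom (f ≫ g) y := by
  apply Spec.map_injective
  rw [Spec.map_comp, SpecMap_stalkHom, SpecMap_stalkHom,
    Scheme.SpecMap_stalkMap_fromSpecStalk_assoc]

theorem stalkHom_SpecMap {S T : CommRingCat.{u}} {P : Scheme.{u}} (g : P ⟶ Spec S) (φ : T ⟶ S)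
    (x : P) : stalkHom (g ≫ Spec.map φ) x = φ ≫ stalkHom g x := by
  apply Spec.map_injective
  rw [Spec.map_comp, SpecMap_stalkHom, SpecMap_stalkHom, Category.assoc]

/-- The image of a point in an affine scheme is the contraction of the maximal ideal. -/
theorem mem_asIdeal_iff {S : CommRingCat.{u}} {P : Scheme.{u}} (g : P ⟶ Spec S) (x : P) (s : S) :
    s ∈ PrimeSpectrum.asIdeal (g x) ↔
      (stalkHom g x).hom s ∈ IsLocalRing.maximalIdeal (P.presheaf.stalk x) := by
  have h : g x = Spec.map (stalkHom g x) (IsLocalRing.closedPoint (P.presheaf.stalk x)) := by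
    rw [SpecMap_stalkHom]
    exact (congrArg g (Scheme.fromSpecStalk_closedPoint (x := x))).symm
  rw [h]
  rfl

/-- The local ring at a point in the image of an affine open immersion is a localization. -/
theorem exists_isLocalization_stalk {S : CommRingCat.{u}} {P : Scheme.{u}} (c : Spec S ⟶ P)
    [IsOpenImmersion c] (y : PrimeSpectrum S) :
    ∃ θ : S ⟶ P.presheaf.stalk (c y), Spec.map θ ≫ c = P.fromSpecStalk (c y) ∧
      let _ := θ.hom.toAlgebra
      IsLocalization.AtPrime (P.presheaf.stalk (c y)) y.asIdeal := by
  let y' : Spec S := y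
  refine ⟨stalkHom (𝟙 _) y' ≫ inv (c.stalkMap y'), ?_, ?_⟩
  · rw [Spec.map_comp, SpecMap_stalkHom, Category.comp_id, Category.assoc,
      ← Scheme.SpecMap_stalkMap_fromSpecStalk, ← Spec.map_comp_assoc, IsIso.hom_inv_id,
      Spec.map_id, Category.id_comp]
  · have h : stalkHom (𝟙 (Spec S)) y' = StructureSheaf.toStalk S y := by
      apply Spec.map_injective
      rw [SpecMap_stalkHom, Category.comp_id]
      exact Spec.fromSpecStalk_eq' S y
    intro _
    let e : (Spec.structureSheaf S).presheaf.stalk y ≃+* P.presheaf.stalk (c y) :=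
      (asIso (c.stalkMap y')).symm.commRingCatIsoToRingEquiv
    let e' : (Spec.structureSheaf S).presheaf.stalk y ≃ₐ[S] P.presheaf.stalk (c y) :=
      AlgEquiv.ofRingEquiv (f := e) (fun r => by
        change _ = (inv (c.stalkMap y')).hom ((stalkHom (𝟙 (Spec S)) y').hom r)
        rw [h]
        rfl)
    exact IsLocalization.isLocalization_of_algEquiv y.asIdeal.primeCompl e'

end Stalks

/-! ### Coordinate rings of the standard charts of the projective line -/

section ProjectiveLineCharts

open CategoryTheory Limits AlgebraicGeometry HomogeneousLocalization

universe u

theorem MvPolynomial.IsHomogeneous.pow_mul_eval₂ {σ R S : Type*} [CommRing R] [CommRing S] (f : R →+* S)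
    (g : σ → S) (c : S) {a : MvPolynomial σ R} {n : ℕ} (ha : a.IsHomogeneous n) :
    c ^ n * a.eval₂ f g = a.eval₂ f (fun l => c * g l) := by
  rw [MvPolynomial.eval₂_eq, MvPolynomial.eval₂_eq, Finset.mul_sum]
  refine Finset.sum_congr rfl fun d hd => ?_
  have hn : ∑ i ∈ d.support, d i = n := ha.degree_eq_sum_deg_support hd |>.symm
  simp only [mul_pow, Finset.prod_mul_distrib]
  rw [Finset.prod_pow_eq_pow_sum, hn]
  ring

variable (k : Type u) [Field k]

attribute [local instance] MvPolynomial.gradedAlgebra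

theorem X_mem_homogeneousSubmodule (i : Fin 2) :
    MvPolynomial.X i ∈ MvPolynomial.homogeneousSubmodule (Fin 2) k 1 :=
  MvPolynomial.isHomogeneous_X k i

/-- The inclusion of `k` in the ring of sections of the structure sheaf on a standard open subset
of the projective line. -/
noncomputable def awayC (x : MvPolynomial (Fin 2) k) :
    k →+* Away (MvPolynomial.homogeneousSubmodule (Fin 2) k) x :=
  (fromZeroRingHom (MvPolynomial.homogeneousSubmodule (Fin 2) k) _).comp
    (algebraMap k (MvPolynomial.homogeneousSubmodule (Fin 2) k 0))

/-- The quotient of the homogeneous coordinates `X j` and `X i`. -/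
noncomputable def awayCoord (i j : Fin 2) :
    Away (MvPolynomial.homogeneousSubmodule (Fin 2) k) (MvPolynomial.X i) :=
  Away.mk _ (X_mem_homogeneousSubmodule k i) 1 (MvPolynomial.X j)
    (by simpa using X_mem_homogeneousSubmodule k j)

/-- The coordinate `X j / X i` on the standard open subset `X i ≠ 0` of the projective line. -/
noncomputable def polynomialToAway (i j : Fin 2) :
    Polynomial k →+* Away (MvPolynomial.homogeneousSubmodule (Fin 2) k) (MvPolynomial.X i) :=
  Polynomial.eval₂RingHom (awayC k _) (awayCoord k i j)

/-- The localization of the homogeneous coordinate ring of the projective line at a coordinate. -/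
noncomputable abbrev coordLoc (i : Fin 2) : MvPolynomial (Fin 2) k →+*
    Localization.Away (MvPolynomial.X i : MvPolynomial (Fin 2) k) := algebraMap _ _

theorem isUnit_coordLoc (i : Fin 2) : IsUnit (coordLoc k i (MvPolynomial.X i)) :=
  IsLocalization.Away.algebraMap_isUnit (MvPolynomial.X i : MvPolynomial (Fin 2) k)

theorem awayC_val (i : Fin 2) (a : k) :
    (awayC k (MvPolynomial.X i) a).val = coordLoc k i (MvPolynomial.C a) := by
  rw [awayC, RingHom.comp_apply]
  rfl

theorem pow_mul_val_mk (i : Fin 2) (n : ℕ) (a : MvPolynomial (Fin 2) k) (ha) :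
    coordLoc k i (MvPolynomial.X i) ^ n *
      (Away.mk (MvPolynomial.homogeneousSubmodule (Fin 2) k)
        (X_mem_homogeneousSubmodule k i) n a ha).val = coordLoc k i a := by
  rw [Away.val_mk, Localization.mk_eq_mk', mul_comm, ← map_pow]
  exact IsLocalization.mk'_spec (Localization.Away (MvPolynomial.X i : MvPolynomial (Fin 2) k)) a
    ⟨MvPolynomial.X i ^ n, (Submonoid.mem_powers_iff _ _).mpr ⟨n, rfl⟩⟩

theorem awayCoord_val (i j : Fin 2) : coordLoc k i (MvPolynomial.X i) * (awayCoord k i j).val =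
    coordLoc k i (MvPolynomial.X j) := by
  have := pow_mul_val_mk k i 1 (MvPolynomial.X j) (by simpa using X_mem_homogeneousSubmodule k j)
  rwa [pow_one] at this

/-- The inverse is dehomogenization, `X i ↦ 1` and `X j ↦ X`. It is a left inverse by inspection of
generators. For surjectivity, a fraction of degree `n` is compared with its dehomogenization after
multiplication by the unit `X i ^ n`. -/
theorem polynomialToAway_bijective {i j : Fin 2} (hij : i ≠ j) :
    Function.Bijective (polynomialToAway k i j) := by
  let d : MvPolynomial (Fin 2) k →+* Polynomial k :=
    MvPolynomial.eval₂Hom Polynomial.C (fun l => if l = i then 1 else Polynomial.X)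
  have hl : ∀ l, l = i ∨ l = j := by
    intro l
    fin_cases i <;> fin_cases j <;> fin_cases l <;> simp_all
  have hX := isUnit_coordLoc k i
  let v : Away (MvPolynomial.homogeneousSubmodule (Fin 2) k) (MvPolynomial.X i) →+*
    Localization.Away (MvPolynomial.X i : MvPolynomial (Fin 2) k) := algebraMap _ _
  have hv : ∀ z, v z = z.val := fun _ => rfl
  constructor
  · have hd : IsUnit (d (MvPolynomial.X i)) := by simp [d]
    let r : Localization.Away (MvPolynomial.X i : MvPolynomial (Fin 2) k) →+* Polynomial k :=
      IsLocalization.Away.lift (MvPolynomial.X i) hd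
    have hr : ∀ z, r (coordLoc k i z) = d z := IsLocalization.Away.lift_eq _ hd
    have h : (r.comp v).comp (polynomialToAway k i j) = RingHom.id _ := by
      refine Polynomial.ringHom_ext (fun a => ?_) ?_
      · simp only [RingHom.comp_apply, polynomialToAway, Polynomial.coe_eval₂RingHom,
          Polynomial.eval₂_C, hv, awayC_val, hr]
        simp [d]
      · simp only [RingHom.comp_apply, polynomialToAway, Polynomial.coe_eval₂RingHom,
          Polynomial.eval₂_X, hv]
        have := congrArg r (awayCoord_val k i j)
        rw [map_mul, hr, hr] at this
        simpa [d, hij.symm] using this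
    exact Function.LeftInverse.injective (g := r.comp v) fun z => RingHom.congr_fun h z
  · intro z
    obtain ⟨n, a, ha, rfl⟩ := Away.mk_surjective _ (X_mem_homogeneousSubmodule k i) z
    refine ⟨d a, HomogeneousLocalization.val_injective _ ?_⟩
    have ha' : a.IsHomogeneous n := by simpa using ha
    have h1 : (v.comp (polynomialToAway k i j)).comp d = MvPolynomial.eval₂Hom
        ((coordLoc k i).comp MvPolynomial.C) (fun l => (awayCoord k i l).val) := by
      refine MvPolynomial.ringHom_ext (fun a => ?_) (fun l => ?_)
      · simp [d, polynomialToAway, hv, awayC_val]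
      · obtain rfl | rfl := hl l
        · have h2 : (awayCoord k l l).val = 1 := by
            refine hX.mul_left_cancel ?_
            rw [awayCoord_val, mul_one]
          simp [d, h2]
        · simp [d, hij.symm, polynomialToAway, hv]
    rw [← hv, ← RingHom.comp_apply, ← RingHom.comp_apply, h1]
    refine (hX.pow n).mul_left_cancel ?_
    have h2 := ha'.pow_mul_eval₂ ((coordLoc k i).comp MvPolynomial.C)
      (fun l => (awayCoord k i l).val) (coordLoc k i (MvPolynomial.X i))
    rw [MvPolynomial.coe_eval₂Hom, h2, pow_mul_val_mk]
    simp only [awayCoord_val]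
    exact ((congrArg _ (MvPolynomial.eval₂_eta a)).symm.trans
      (MvPolynomial.eval₂_comp_left (coordLoc k i) MvPolynomial.C MvPolynomial.X a)).symm

end ProjectiveLineCharts

/-! ### The standard charts and their overlap -/

section ProjectiveLineCharts

open CategoryTheory Limits AlgebraicGeometry HomogeneousLocalization

universe u

variable (k : Type u) [Field k]

attribute [local instance] MvPolynomial.gradedAlgebra

/-- The projective line as the homogeneous spectrum of a polynomial ring. -/
noncomputable abbrev projLine : Scheme.{u} := Proj (MvPolynomial.homogeneousSubmodule (Fin 2) k)

/-- The standard affine open subset `X i ≠ 0` of the projective line, with the coordinate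
`X j / X i`. -/
noncomputable def projLineChart {i j : Fin 2} (hij : i ≠ j) :
    Spec (CommRingCat.of (Polynomial k)) ⟶ projLine k :=
  Spec.map (RingEquiv.ofBijective _ (polynomialToAway_bijective k hij)).toCommRingCatIso.inv ≫
    Proj.awayι (MvPolynomial.homogeneousSubmodule (Fin 2) k) (MvPolynomial.X i)
      (X_mem_homogeneousSubmodule k i) one_pos

theorem SpecMap_projLineChart {i j : Fin 2} (hij : i ≠ j) :
    Spec.map (CommRingCat.ofHom (polynomialToAway k i j)) ≫ projLineChart k hij =
    Proj.awayι (MvPolynomial.homogeneousSubmodule (Fin 2) k) (MvPolynomial.X i)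
      (X_mem_homogeneousSubmodule k i) one_pos := by
  have h : CommRingCat.ofHom (polynomialToAway k i j) =
    (RingEquiv.ofBijective _ (polynomialToAway_bijective k hij)).toCommRingCatIso.hom := rfl
  rw [projLineChart, h, ← Spec.map_comp_assoc, Iso.inv_hom_id, Spec.map_id, Category.id_comp]

instance {i j : Fin 2} (hij : i ≠ j) : IsOpenImmersion (projLineChart k hij) :=
  IsOpenImmersion.comp _ _

theorem projLineChart_toSpec {i j : Fin 2} (hij : i ≠ j) :
    projLineChart k hij ≫ projectiveLine.toSpec k = Spec.map (CommRingCat.ofHom Polynomial.C) := by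
  have h : projectiveLine.toSpec k = Proj.toSpecZero (MvPolynomial.homogeneousSubmodule (Fin 2) k) ≫
    Spec.map (CommRingCat.ofHom
      (algebraMap k (MvPolynomial.homogeneousSubmodule (Fin 2) k 0))) := rfl
  rw [h, projLineChart, Category.assoc, Proj.awayι_toSpecZero_assoc, ← Spec.map_comp, ← Spec.map_comp]
  congr 1
  rw [Iso.comp_inv_eq]
  refine CommRingCat.hom_ext (RingHom.ext fun a => ?_)
  change awayC k _ a = polynomialToAway k i j (Polynomial.C a)
  rw [polynomialToAway, Polynomial.coe_eval₂RingHom, Polynomial.eval₂_C]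

theorem mem_range_projLineChart {i j : Fin 2} (hij : i ≠ j) (x : projLine k) :
    x ∈ Set.range (projLineChart k hij) ↔
      x ∈ Proj.basicOpen (MvPolynomial.homogeneousSubmodule (Fin 2) k) (MvPolynomial.X i) := by
  rw [← Proj.opensRange_awayι _ _ (X_mem_homogeneousSubmodule k i) one_pos]
  have h : (projLineChart k hij).opensRange = _ := Scheme.Hom.opensRange_comp_of_isIso _ _
  exact (SetLike.ext_iff.mp h x :)

theorem projLineChart_mem_range_iff {i j : Fin 2} (hij : i ≠ j) (y : PrimeSpectrum (Polynomial k)) :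
    projLineChart k hij y ∈ Set.range (projLineChart k hij.symm) ↔ Polynomial.X ∉ y.asIdeal := by
  rw [mem_range_projLineChart]
  have h := Proj.awayι_preimage_basicOpen (MvPolynomial.homogeneousSubmodule (Fin 2) k)
    (X_mem_homogeneousSubmodule k i) one_pos (X_mem_homogeneousSubmodule k j) one_pos
  let e := RingEquiv.ofBijective _ (polynomialToAway_bijective k hij)
  have h1 := SetLike.ext_iff.mp h (PrimeSpectrum.comap e.symm.toRingHom y)
  refine h1.trans (not_congr ?_)
  change e.symm _ ∈ y.asIdeal ↔ _
  have h2 : e Polynomial.X = Away.isLocalizationElem (X_mem_homogeneousSubmodule k i)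
      (X_mem_homogeneousSubmodule k j) := by
    change polynomialToAway k i j Polynomial.X = _
    rw [polynomialToAway, Polynomial.coe_eval₂RingHom, Polynomial.eval₂_X]
    refine HomogeneousLocalization.val_injective _ ?_
    rw [awayCoord, Away.val_mk, Away.val_mk, pow_one (MvPolynomial.X j)]
  rw [← h2, RingEquiv.symm_apply_apply]

theorem mem_range_projLineChart_or (x : projLine k) {i j : Fin 2} (hij : i ≠ j) :
    x ∈ Set.range (projLineChart k hij) ∨ x ∈ Set.range (projLineChart k hij.symm) := by
  rw [mem_range_projLineChart, mem_range_projLineChart]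
  have h := Proj.iSup_basicOpen_eq_top' (MvPolynomial.homogeneousSubmodule (Fin 2) k)
    (MvPolynomial.X : Fin 2 → MvPolynomial (Fin 2) k)
    (fun i => ⟨1, X_mem_homogeneousSubmodule k i⟩) (by
      rw [eq_top_iff]
      rintro a -
      induction a using MvPolynomial.induction_on with
      | C a =>
        have h0 : MvPolynomial.C a ∈ MvPolynomial.homogeneousSubmodule (Fin 2) k 0 :=
          MvPolynomial.isHomogeneous_C _ _
        exact (Algebra.adjoin (MvPolynomial.homogeneousSubmodule (Fin 2) k 0) _).algebraMap_mem ⟨_, h0⟩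
      | add p q hp hq => exact add_mem hp hq
      | mul_X p i hp => exact mul_mem hp (Algebra.subset_adjoin (Set.mem_range_self i)))
  obtain ⟨l, hl⟩ := TopologicalSpace.Opens.mem_iSup.mp
    (h ▸ trivial : x ∈ ⨆ i, Proj.basicOpen (MvPolynomial.homogeneousSubmodule (Fin 2) k)
      (MvPolynomial.X i : MvPolynomial (Fin 2) k))
  have : l = i ∨ l = j := by
    fin_cases i <;> fin_cases j <;> fin_cases l <;> simp_all
  obtain rfl | rfl := this
  · exact Or.inl hl
  · exact Or.inr hl

theorem SpecMap_awayMap_projLineChart {i j : Fin 2} (hij : i ≠ j) {x : MvPolynomial (Fin 2) k}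
    (hx : x = MvPolynomial.X i * MvPolynomial.X j) :
    Spec.map (CommRingCat.ofHom ((awayMap (MvPolynomial.homogeneousSubmodule (Fin 2) k)
        (X_mem_homogeneousSubmodule k j) hx).comp (polynomialToAway k i j))) ≫
        projLineChart k hij =
      Proj.awayι (MvPolynomial.homogeneousSubmodule (Fin 2) k) x
        (hx ▸ SetLike.mul_mem_graded (X_mem_homogeneousSubmodule k i)
          (X_mem_homogeneousSubmodule k j)) two_pos := by
  rw [CommRingCat.ofHom_comp, Spec.map_comp, Category.assoc, SpecMap_projLineChart,
    Proj.SpecMap_awayMap_awayι]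

theorem awayMap_awayCoord_mul {i j : Fin 2} {x : MvPolynomial (Fin 2) k}
    (hx : x = MvPolynomial.X i * MvPolynomial.X j) (hx' : x = MvPolynomial.X j * MvPolynomial.X i) :
    awayMap (MvPolynomial.homogeneousSubmodule (Fin 2) k) (X_mem_homogeneousSubmodule k j) hx
      (polynomialToAway k i j Polynomial.X) *
    awayMap (MvPolynomial.homogeneousSubmodule (Fin 2) k) (X_mem_homogeneousSubmodule k i) hx'
      (polynomialToAway k j i Polynomial.X) = 1 := by
  rw [polynomialToAway, polynomialToAway, Polynomial.coe_eval₂RingHom, Polynomial.coe_eval₂RingHom,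
    Polynomial.eval₂_X, Polynomial.eval₂_X, awayCoord, awayCoord, awayMap_mk, awayMap_mk]
  refine HomogeneousLocalization.val_injective _ ?_
  rw [val_mul, Away.val_mk, Away.val_mk, Localization.mk_mul, val_one]
  rw [← Localization.mk_one, Localization.mk_eq_mk_iff, Localization.r_iff_exists]
  refine ⟨1, ?_⟩
  subst hx
  simp only [OneMemClass.coe_one, Submonoid.coe_mul]
  ring

/-- The overlap of the two standard affine open subsets of the projective line. -/
theorem exists_overlap_projLineChart {i j : Fin 2} (hij : i ≠ j) :
    ∃ (W : CommRingCat.{u}) (ψ ψ' : CommRingCat.of (Polynomial k) ⟶ W), Nontrivial W ∧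
      IsOpenImmersion (Spec.map ψ ≫ projLineChart k hij) ∧
      Spec.map ψ ≫ projLineChart k hij = Spec.map ψ' ≫ projLineChart k hij.symm ∧
      ψ.hom Polynomial.X * ψ'.hom Polynomial.X = 1 := by
  refine ⟨_, _, _, ?_, ?_, (SpecMap_awayMap_projLineChart k hij rfl).trans
    (SpecMap_awayMap_projLineChart k hij.symm (mul_comm _ _)).symm,
    awayMap_awayCoord_mul k rfl (mul_comm _ _)⟩
  · have h0 : (MvPolynomial.X i * MvPolynomial.X j : MvPolynomial (Fin 2) k) ≠ 0 :=
      mul_ne_zero (MvPolynomial.X_ne_zero i) (MvPolynomial.X_ne_zero j)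
    have := IsLocalization.isDomain_localization (R := MvPolynomial (Fin 2) k)
      (powers_le_nonZeroDivisors_of_noZeroDivisors h0)
    refine ⟨0, 1, fun h => ?_⟩
    have h1 := congrArg HomogeneousLocalization.val h
    rw [val_zero, val_one] at h1
    exact zero_ne_one h1
  · rw [SpecMap_awayMap_projLineChart]
    infer_instance

end ProjectiveLineCharts

/-! ### Schemes glued from two affine lines -/

section TwoCharts

open CategoryTheory Limits AlgebraicGeometry Polynomial

universe u

/-- Two affine lines over `k` that are glued along `t ↦ t⁻¹`. -/
structure ProjectiveLineCharts {k : Type u} [Field k] {P : Scheme.{u}}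
    (g : P ⟶ Spec (CommRingCat.of k)) where
  /-- The first affine line. -/
  c : Spec (CommRingCat.of k[X]) ⟶ P
  /-- The second affine line. -/
  c' : Spec (CommRingCat.of k[X]) ⟶ P
  /-- The ring of functions on the overlap. -/
  W : CommRingCat.{u}
  /-- The first coordinate on the overlap. -/
  ψ : CommRingCat.of k[X] ⟶ W
  /-- The second coordinate on the overlap. -/
  ψ' : CommRingCat.of k[X] ⟶ W
  isOpenImmersion_c : IsOpenImmersion c
  isOpenImmersion_c' : IsOpenImmersion c'
  c_comp : c ≫ g = Spec.map (CommRingCat.ofHom Polynomial.C)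
  c'_comp : c' ≫ g = Spec.map (CommRingCat.ofHom Polynomial.C)
  nontrivial_W : Nontrivial W
  isOpenImmersion_W : IsOpenImmersion (Spec.map ψ ≫ c)
  overlap : Spec.map ψ ≫ c = Spec.map ψ' ≫ c'
  mul_eq : ψ.hom Polynomial.X * ψ'.hom Polynomial.X = 1
  cover : ∀ x : P, x ∈ Set.range c ∨ x ∈ Set.range c'
  mem_iff : ∀ y : PrimeSpectrum k[X], c' y ∈ Set.range c ↔ X ∉ y.asIdeal

/-- The standard charts of the projective line. -/
noncomputable def projectiveLineCharts (k : Type u) [Field k] :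
    ProjectiveLineCharts (projectiveLine.toSpec k) :=
  letI h := exists_overlap_projLineChart k (zero_ne_one (α := Fin 2))
  { c := projLineChart k (zero_ne_one (α := Fin 2))
    c' := projLineChart k (zero_ne_one (α := Fin 2)).symm
    W := h.choose
    ψ := h.choose_spec.choose
    ψ' := h.choose_spec.choose_spec.choose
    isOpenImmersion_c := inferInstanceAs (IsOpenImmersion (projLineChart k _))
    isOpenImmersion_c' := inferInstanceAs (IsOpenImmersion (projLineChart k _))
    c_comp := projLineChart_toSpec k _
    c'_comp := projLineChart_toSpec k _
    nontrivial_W := h.choose_spec.choose_spec.choose_spec.1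
    isOpenImmersion_W := h.choose_spec.choose_spec.choose_spec.2.1
    overlap := h.choose_spec.choose_spec.choose_spec.2.2.1
    mul_eq := h.choose_spec.choose_spec.choose_spec.2.2.2
    cover := fun x => mem_range_projLineChart_or k x _
    mem_iff := projLineChart_mem_range_iff k _ }

namespace ProjectiveLineCharts

variable {k : Type u} [Field k] {P : Scheme.{u}} {g : P ⟶ Spec (CommRingCat.of k)}
  (𝓒 : ProjectiveLineCharts g)

attribute [instance] isOpenImmersion_c isOpenImmersion_c' nontrivial_W isOpenImmersion_W

/-- The generic point of the affine line. -/
noncomputable def genPt : Spec (CommRingCat.of k[X]) := (⊥ : PrimeSpectrum k[X])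

theorem genPt_specializes (y : Spec (CommRingCat.of k[X])) : genPt ⤳ y :=
  (PrimeSpectrum.le_iff_specializes (R := k[X]) _ _).mp bot_le

theorem exists_overlap_eq : ∃ w, 𝓒.c genPt = 𝓒.c' w := by
  have h : IsOpenImmersion (Spec.map 𝓒.ψ) := IsOpenImmersion.of_comp _ 𝓒.c
  obtain ⟨w⟩ : Nonempty (Spec 𝓒.W) := inferInstanceAs (Nonempty (PrimeSpectrum 𝓒.W))
  obtain ⟨v, hv⟩ := (genPt_specializes (Spec.map 𝓒.ψ w)).mem_open (Spec.map 𝓒.ψ).isOpenEmbedding.isOpen_range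
    ⟨w, rfl⟩
  exact ⟨Spec.map 𝓒.ψ' v, by
    rw [← hv, ← Scheme.Hom.comp_apply, ← Scheme.Hom.comp_apply, 𝓒.overlap]⟩

/-- The overlap is nonempty and open in the first line, so it contains the generic point. Hence the
generic points of the two lines specialize to each other, and every point lies below one of them. -/
theorem specializes (x : P) : 𝓒.c genPt ⤳ x := by
  obtain ⟨w, hw⟩ := 𝓒.exists_overlap_eq
  have h1 : 𝓒.c' genPt ⤳ 𝓒.c genPt := hw ▸ (genPt_specializes w).map 𝓒.c'.continuous
  obtain ⟨v, hv⟩ := h1.mem_open 𝓒.c.isOpenEmbedding.isOpen_range ⟨_, rfl⟩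
  have h2 : 𝓒.c genPt ⤳ 𝓒.c' genPt := hv ▸ (genPt_specializes v).map 𝓒.c.continuous
  obtain ⟨y, rfl⟩ | ⟨y, rfl⟩ := 𝓒.cover x
  · exact (genPt_specializes y).map 𝓒.c.continuous
  · exact h2.trans ((genPt_specializes y).map 𝓒.c'.continuous)

theorem exists_stalk_chart (c : Spec (CommRingCat.of k[X]) ⟶ P) [IsOpenImmersion c]
    (hc : c ≫ g = Spec.map (CommRingCat.ofHom Polynomial.C)) (y : PrimeSpectrum k[X]) :
    ∃ θ : k[X] →+* P.presheaf.stalk (c y),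
      Spec.map (CommRingCat.ofHom θ) ≫ c = P.fromSpecStalk (c y) ∧
      (∀ a, θ (C a) = (stalkHom g (c y)).hom a) ∧
      let _ := θ.toAlgebra
      IsLocalization.AtPrime (P.presheaf.stalk (c y)) y.asIdeal := by
  obtain ⟨θ, hθ, hloc⟩ := exists_isLocalization_stalk c y
  refine ⟨θ.hom, hθ, fun a => ?_, hloc⟩
  have : stalkHom g (c y) = CommRingCat.ofHom Polynomial.C ≫ θ := by
    apply Spec.map_injective
    rw [SpecMap_stalkHom, Spec.map_comp, ← hc, ← Category.assoc, hθ]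
  rw [this]
  rfl

include 𝓒 in
/-- The local rings of the projective line are localizations of polynomial rings. -/
theorem exists_isLocalization (x : P) : ∃ (θ : k[X] →+* P.presheaf.stalk x) (Q : PrimeSpectrum k[X]),
    (∀ a, θ (C a) = (stalkHom g x).hom a) ∧
    let _ := θ.toAlgebra
    IsLocalization.AtPrime (P.presheaf.stalk x) Q.asIdeal := by
  obtain ⟨y, rfl⟩ | ⟨y, rfl⟩ := 𝓒.cover x
  · obtain ⟨θ, -, h⟩ := exists_stalk_chart 𝓒.c 𝓒.c_comp y
    exact ⟨θ, y, h⟩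
  · obtain ⟨θ, -, h⟩ := exists_stalk_chart 𝓒.c' 𝓒.c'_comp y
    exact ⟨θ, y, h⟩

include 𝓒 in
theorem isIntegral : IsIntegral P := by
  have h1 : ∀ x : P, _root_.IsReduced (P.presheaf.stalk x) := by
    intro x
    obtain ⟨θ, Q, -, h⟩ := 𝓒.exists_isLocalization x
    let _ := θ.toAlgebra
    have : IsLocalization.AtPrime (P.presheaf.stalk x) Q.asIdeal := h
    have := IsLocalization.isDomain_of_atPrime (P.presheaf.stalk x) (P := Q.asIdeal)
    infer_instance
  have h2 : AlgebraicGeometry.IsReduced P := isReduced_of_isReduced_stalk P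
  have h3 : IrreducibleSpace P := by
    rw [irreducibleSpace_def]
    have : closure {𝓒.c genPt} = Set.univ :=
      Set.eq_univ_of_forall fun x => (𝓒.specializes x).mem_closure
    exact (this ▸ isIrreducible_singleton.closure : IsIrreducible (Set.univ : Set P))
  exact isIntegral_of_irreducibleSpace_of_isReduced P

end ProjectiveLineCharts

instance (k : Type u) [Field k] : IsIntegral (projectiveLine k) := (projectiveLineCharts k).isIntegral

end TwoCharts

/-! ### Local degrees and the function field of the projective line -/

section TwoCharts

open CategoryTheory Limits AlgebraicGeometry Polynomial

universe u

variable {k : Type u} [Field k] {P : Scheme.{u}} (g : P ⟶ Spec (CommRingCat.of k))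

/-- The structure of an algebra on the local rings of a scheme over `k`. -/
noncomputable abbrev stalkAlgebra (x : P) : Algebra k (P.presheaf.stalk x) := (stalkHom g x).hom.toAlgebra

theorem localDegree_of_isUnit [IsIntegral P] {x : P} {a : P.presheaf.stalk x} (ha : IsUnit a) : localDegree g x a = 0 :=
  letI := stalkAlgebra g x
  finrank_quotient_of_isUnit (k := k) ha

/-- The order of vanishing of a rational function at a point, weighted by the residue degree. -/
noncomputable def pointDegree [IsIntegral P] (x : P) (φ : P.functionField) : ℤ :=
  letI := stalkAlgebra g x
  fractionDegree k (P.presheaf.stalk x) φ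

variable {g}

theorem exists_stalk_chart_of_mem (c : Spec (CommRingCat.of k[X]) ⟶ P) [IsOpenImmersion c]
    (hc : c ≫ g = Spec.map (CommRingCat.ofHom Polynomial.C)) {x : P} (hx : x ∈ Set.range c) :
    ∃ (θ : k[X] →+* P.presheaf.stalk x) (y : PrimeSpectrum k[X]), c y = x ∧
      Spec.map (CommRingCat.ofHom θ) ≫ c = P.fromSpecStalk x ∧
      (∀ a, θ (C a) = (stalkHom g x).hom a) ∧
      let _ := θ.toAlgebra
      IsLocalization.AtPrime (P.presheaf.stalk x) y.asIdeal := by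
  obtain ⟨y, rfl⟩ := hx
  obtain ⟨θ, h⟩ := ProjectiveLineCharts.exists_stalk_chart c hc y
  exact ⟨θ, y, rfl, h⟩

/-- The coordinate ring of an affine open line in the function field. -/
theorem exists_functionField_chart [IsIntegral P] (c : Spec (CommRingCat.of k[X]) ⟶ P) [IsOpenImmersion c]
    (hc : c ≫ g = Spec.map (CommRingCat.ofHom Polynomial.C)) :
    ∃ θ : k[X] →+* P.functionField,
      Spec.map (CommRingCat.ofHom θ) ≫ c = P.fromSpecStalk (genericPoint P) ∧
      (∀ a, θ (C a) = (stalkHom g (genericPoint P)).hom a) ∧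
      let _ := θ.toAlgebra
      IsFractionRing k[X] P.functionField := by
  have hmem : genericPoint P ∈ Set.range c :=
    ((genericPoint_spec P).specializes (y := c ProjectiveLineCharts.genPt) trivial).mem_open
      c.isOpenEmbedding.isOpen_range ⟨_, rfl⟩
  obtain ⟨θ, y, -, hθ, hC, hloc⟩ := exists_stalk_chart_of_mem c hc hmem
  refine ⟨θ, hθ, hC, ?_⟩
  intro _
  have hloc' : IsLocalization y.asIdeal.primeCompl P.functionField := hloc
  have hinj : Function.Injective (algebraMap k[X] P.functionField) :=
    IsLocalization.injective P.functionField y.asIdeal.primeCompl_le_nonZeroDivisors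
  -- The local ring is a field, so a polynomial in the prime `y` becomes zero in it, and the prime
  -- is zero.
  have hy : y.asIdeal.primeCompl = nonZeroDivisors k[X] := by
    refine le_antisymm y.asIdeal.primeCompl_le_nonZeroDivisors fun f hf hfy => ?_
    have h1 := (IsLocalization.AtPrime.to_map_mem_maximal_iff P.functionField y.asIdeal f).mpr hfy
    rw [IsLocalRing.eq_maximalIdeal (Ideal.bot_isMaximal (K := P.functionField)) |>.symm] at h1
    exact nonZeroDivisors.ne_zero hf (hinj (by simpa using h1))
  rw [hy] at hloc'
  exact hloc'

theorem algebraMap_comp_chart [IsIntegral P] {c : Spec (CommRingCat.of k[X]) ⟶ P} [IsOpenImmersion c]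
    {θ : k[X] →+* P.functionField}
    (hθ : Spec.map (CommRingCat.ofHom θ) ≫ c = P.fromSpecStalk (genericPoint P)) {x : P}
    {θx : k[X] →+* P.presheaf.stalk x} (hθx : Spec.map (CommRingCat.ofHom θx) ≫ c = P.fromSpecStalk x)
    (f : k[X]) : algebraMap (P.presheaf.stalk x) P.functionField (θx f) = θ f := by
  have h : CommRingCat.ofHom θx ≫ P.presheaf.stalkSpecializes
      ((genericPoint_spec P).specializes trivial) = CommRingCat.ofHom θ := by
    apply Spec.map_injective
    rw [← cancel_mono c, hθ, Spec.map_comp, Category.assoc, hθx]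
    exact Scheme.SpecMap_stalkSpecializes_fromSpecStalk _
  exact RingHom.congr_fun (congrArg CommRingCat.Hom.hom h) f

namespace ProjectiveLineCharts

variable (𝓒 : ProjectiveLineCharts g)

include 𝓒

theorem hasFinitePrincipalQuotients (x : P) :
    letI := stalkAlgebra g x
    HasFinitePrincipalQuotients k (P.presheaf.stalk x) := by
  obtain ⟨θ, Q, hC, h⟩ := 𝓒.exists_isLocalization x
  let _ := θ.toAlgebra
  let _ := stalkAlgebra g x
  have : IsLocalization.AtPrime (P.presheaf.stalk x) Q.asIdeal := h
  have : IsScalarTower k k[X] (P.presheaf.stalk x) := IsScalarTower.of_algebraMap_eq fun a => (hC a).symm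
  have := IsLocalization.isDomain_of_atPrime (P.presheaf.stalk x) Q.asIdeal
  exact hasFinitePrincipalQuotients_of_isLocalization Q.asIdeal

theorem isPrincipalIdealRing (x : P) : IsPrincipalIdealRing (P.presheaf.stalk x) := by
  obtain ⟨θ, Q, hC, h⟩ := 𝓒.exists_isLocalization x
  let _ := θ.toAlgebra
  have : IsLocalization.AtPrime (P.presheaf.stalk x) Q.asIdeal := h
  refine ⟨fun J => ?_⟩
  rw [← IsLocalization.map_under Q.asIdeal.primeCompl _ J]
  obtain ⟨p, hp⟩ := IsPrincipalIdealRing.principal (J.under k[X])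
  rw [hp, Ideal.submodule_span_eq, Ideal.map_span, Set.image_singleton]
  exact ⟨_, rfl⟩

theorem localDegree_mul [IsIntegral P] {x : P} {a b : P.presheaf.stalk x} (ha : a ≠ 0) (hb : b ≠ 0) :
    localDegree g x (a * b) = localDegree g x a + localDegree g x b :=
  letI := stalkAlgebra g x
  (𝓒.hasFinitePrincipalQuotients x).finrank_mul ha hb

theorem localDegree_pow [IsIntegral P] {x : P} {a : P.presheaf.stalk x} (ha : a ≠ 0) (n : ℕ) :
    localDegree g x (a ^ n) = n * localDegree g x a :=
  letI := stalkAlgebra g x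
  (𝓒.hasFinitePrincipalQuotients x).finrank_pow ha n

theorem localDegree_prod [IsIntegral P] {x : P} {ι : Type*} (s : Finset ι) {a : ι → P.presheaf.stalk x}
    (ha : ∀ i ∈ s, a i ≠ 0) : localDegree g x (∏ i ∈ s, a i) = ∑ i ∈ s, localDegree g x (a i) :=
  letI := stalkAlgebra g x
  (𝓒.hasFinitePrincipalQuotients x).finrank_prod s ha

theorem pointDegree_eq [IsIntegral P] {x : P} {φ : P.functionField} (hφ : φ ≠ 0) {a b : P.presheaf.stalk x}
    (hb : b ≠ 0) (hab : φ * algebraMap _ P.functionField b = algebraMap _ P.functionField a) :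
    pointDegree g x φ = (localDegree g x a : ℤ) - localDegree g x b :=
  letI := stalkAlgebra g x
  fractionDegree_eq (𝓒.hasFinitePrincipalQuotients x) hφ hb hab

theorem pointDegree_algebraMap [IsIntegral P] {x : P} {a : P.presheaf.stalk x} (ha : a ≠ 0) :
    pointDegree g x (algebraMap _ P.functionField a) = localDegree g x a :=
  letI := stalkAlgebra g x
  fractionDegree_algebraMap (𝓒.hasFinitePrincipalQuotients x) ha

theorem pointDegree_mul [IsIntegral P] (x : P) {φ ψ : P.functionField} (hφ : φ ≠ 0) (hψ : ψ ≠ 0) :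
    pointDegree g x (φ * ψ) = pointDegree g x φ + pointDegree g x ψ :=
  letI := stalkAlgebra g x
  fractionDegree_mul (𝓒.hasFinitePrincipalQuotients x) hφ hψ

/-- The generic point lies in the overlap, so the gluing relation between the two coordinates holds
in the function field. -/
theorem exists_functionField_charts [IsIntegral P] : ∃ θ θ' : k[X] →+* P.functionField,
    Spec.map (CommRingCat.ofHom θ) ≫ 𝓒.c = P.fromSpecStalk (genericPoint P) ∧
    Spec.map (CommRingCat.ofHom θ') ≫ 𝓒.c' = P.fromSpecStalk (genericPoint P) ∧
    (∀ a, θ (C a) = (stalkHom g (genericPoint P)).hom a) ∧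
    (∀ a, θ' (C a) = (stalkHom g (genericPoint P)).hom a) ∧
    (let _ := θ.toAlgebra; IsFractionRing k[X] P.functionField) ∧ θ X * θ' X = 1 := by
  obtain ⟨θ, hθ, hC, hfrac⟩ := exists_functionField_chart 𝓒.c 𝓒.c_comp
  obtain ⟨θ', hθ', hC', -⟩ := exists_functionField_chart 𝓒.c' 𝓒.c'_comp
  refine ⟨θ, θ', hθ, hθ', hC, hC', hfrac, ?_⟩
  have h : IsOpenImmersion (Spec.map 𝓒.ψ) := IsOpenImmersion.of_comp _ 𝓒.c
  obtain ⟨w⟩ : Nonempty (Spec 𝓒.W) := inferInstanceAs (Nonempty (PrimeSpectrum 𝓒.W))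
  obtain ⟨y, hy⟩ : genericPoint P ∈ Set.range (Spec.map 𝓒.ψ ≫ 𝓒.c) :=
    ((genericPoint_spec P).specializes (y := (Spec.map 𝓒.ψ ≫ 𝓒.c) w) trivial).mem_open
      (Spec.map 𝓒.ψ ≫ 𝓒.c).isOpenEmbedding.isOpen_range ⟨_, rfl⟩
  obtain ⟨ω, hω⟩ : ∃ ω : 𝓒.W ⟶ P.presheaf.stalk (genericPoint P),
      Spec.map ω ≫ Spec.map 𝓒.ψ ≫ 𝓒.c = P.fromSpecStalk (genericPoint P) := by
    rw [← hy]
    obtain ⟨ω, hω, -⟩ := exists_isLocalization_stalk (Spec.map 𝓒.ψ ≫ 𝓒.c) y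
    exact ⟨ω, hω⟩
  have h1 : CommRingCat.ofHom θ = 𝓒.ψ ≫ ω := by
    apply Spec.map_injective
    rw [← cancel_mono 𝓒.c, hθ, Spec.map_comp, Category.assoc, hω]
  have h2 : CommRingCat.ofHom θ' = 𝓒.ψ' ≫ ω := by
    apply Spec.map_injective
    rw [← cancel_mono 𝓒.c', hθ', Spec.map_comp, Category.assoc, ← 𝓒.overlap, hω]
  have h3 : θ X = ω.hom (𝓒.ψ.hom X) := RingHom.congr_fun (congrArg CommRingCat.Hom.hom h1) X
  have h4 : θ' X = ω.hom (𝓒.ψ'.hom X) := RingHom.congr_fun (congrArg CommRingCat.Hom.hom h2) X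
  rw [h3, h4, ← map_mul, 𝓒.mul_eq, map_one]

end ProjectiveLineCharts

end TwoCharts

/-! ### Principal divisors on the projective line have degree zero -/

section Degree

open CategoryTheory Limits AlgebraicGeometry Polynomial

universe u

namespace ProjectiveLineCharts

variable {k : Type u} [Field k] {P : Scheme.{u}} {g : P ⟶ Spec (CommRingCat.of k)} [IsIntegral P]
  (𝓒 : ProjectiveLineCharts g)

include 𝓒

theorem localDegree_irreducible (c : Spec (CommRingCat.of k[X]) ⟶ P) [IsOpenImmersion c]
    (hc : c ≫ g = Spec.map (CommRingCat.ofHom Polynomial.C)) {θ : k[X] →+* P.functionField}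
    (hθ : Spec.map (CommRingCat.ofHom θ) ≫ c = P.fromSpecStalk (genericPoint P)) 
    (y : PrimeSpectrum k[X]) : ∃ θy : k[X] →+* P.presheaf.stalk (c y),
      (∀ f, algebraMap _ P.functionField (θy f) = θ f) ∧ (∀ f, f ≠ 0 → θy f ≠ 0) ∧
      (∀ f ∉ y.asIdeal, localDegree g (c y) (θy f) = 0) ∧
      ∀ p, Irreducible p → p ∈ y.asIdeal → localDegree g (c y) (θy p) = p.natDegree := by
  obtain ⟨θy, hθy, hC, h⟩ := exists_stalk_chart c hc y
  let _ := θy.toAlgebra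
  let _ := stalkAlgebra g (c y)
  have : IsLocalization.AtPrime (P.presheaf.stalk (c y)) y.asIdeal := h
  have : IsScalarTower k k[X] (P.presheaf.stalk (c y)) :=
    IsScalarTower.of_algebraMap_eq fun a => (hC a).symm
  refine ⟨θy, algebraMap_comp_chart hθ hθy, fun f hf => ?_, fun f hf => ?_, fun p hp hpy => ?_⟩
  · have := IsLocalization.injective (P.presheaf.stalk (c y)) y.asIdeal.primeCompl_le_nonZeroDivisors
    exact (map_ne_zero_iff _ this).mpr hf
  · exact localDegree_of_isUnit g (IsLocalization.map_units (P.presheaf.stalk (c y))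
      (⟨f, hf⟩ : y.asIdeal.primeCompl))
  · refine (finrank_quotient_map_irreducible y.asIdeal hp ?_).2
    have := PrincipalIdealRing.isMaximal_of_irreducible hp
    exact (this.eq_of_le (Ideal.IsPrime.ne_top inferInstance) (by simpa [Ideal.span_le] using hpy)).symm

/-- The sum of the orders of vanishing of a rational function is zero. -/
def HasDegreeZero (g : P ⟶ Spec (CommRingCat.of k)) (φ : P.functionField) : Prop :=
  (Function.support fun x => pointDegree g x φ).Finite ∧ ∑ᶠ x, pointDegree g x φ = 0

theorem HasDegreeZero.mul {φ χ : P.functionField} (hφ : φ ≠ 0) (hχ : χ ≠ 0) (h : HasDegreeZero g φ)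
    (h' : HasDegreeZero g χ) : HasDegreeZero g (φ * χ) := by
  have h1 : (fun x => pointDegree g x (φ * χ)) = fun x => pointDegree g x φ + pointDegree g x χ :=
    funext fun x => 𝓒.pointDegree_mul x hφ hχ
  refine ⟨?_, ?_⟩
  · rw [h1]
    exact (h.1.union h'.1).subset (Function.support_add _ _)
  · rw [h1, finsum_add_distrib h.1 h'.1, h.2, h'.2, add_zero]

/-- The divisor consists of the closed point `p = 0`, of degree `deg p`, and a pole of order `deg p`
at the origin of the second chart. -/
theorem hasDegreeZero_irreducible {θ θ' : k[X] →+* P.functionField}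
    (hθ : Spec.map (CommRingCat.ofHom θ) ≫ 𝓒.c = P.fromSpecStalk (genericPoint P))
    (hθ' : Spec.map (CommRingCat.ofHom θ') ≫ 𝓒.c' = P.fromSpecStalk (genericPoint P))
    (hC : ∀ a, θ (C a) = θ' (C a)) (hX : θ X * θ' X = 1) {p : k[X]} (hp : Irreducible p) :
    HasDegreeZero g (θ p) := by
  have hinf : (Ideal.span {(X : k[X])}).IsPrime :=
    (Ideal.span_singleton_prime X_ne_zero).mpr prime_X
  have hpp : (Ideal.span {p}).IsPrime := (Ideal.span_singleton_prime hp.ne_zero).mpr hp.prime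
  let yp : PrimeSpectrum k[X] := ⟨Ideal.span {p}, hpp⟩
  let yi : PrimeSpectrum k[X] := ⟨Ideal.span {X}, hinf⟩
  have hXmax : (Ideal.span {(X : k[X])}).IsMaximal :=
    PrincipalIdealRing.isMaximal_of_irreducible irreducible_X
  have hpmax : (Ideal.span {p}).IsMaximal := PrincipalIdealRing.isMaximal_of_irreducible hp
  have hyi : ∀ y : PrimeSpectrum k[X], X ∈ y.asIdeal → y = yi := fun y hy =>
    PrimeSpectrum.ext (hXmax.eq_of_le (Ideal.IsPrime.ne_top inferInstance)
      (by simpa [Ideal.span_le] using hy)).symm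
  have hyp : ∀ y : PrimeSpectrum k[X], p ∈ y.asIdeal → y = yp := fun y hy =>
    PrimeSpectrum.ext (hpmax.eq_of_le (Ideal.IsPrime.ne_top inferInstance)
      (by simpa [Ideal.span_le] using hy)).symm
  have hne : 𝓒.c yp ≠ 𝓒.c' yi := by
    intro h
    exact (𝓒.mem_iff yi).mp ⟨yp, h⟩ (Ideal.mem_span_singleton_self X)
  have hθp : θ p ≠ 0 := by
    obtain ⟨θy, h1, h2, -, -⟩ := 𝓒.localDegree_irreducible 𝓒.c 𝓒.c_comp hθ yp
    rw [← h1]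
    simpa using h2 p hp.ne_zero
  have hval : ∀ y, p ∉ y.asIdeal → pointDegree g (𝓒.c y) (θ p) = 0 := by
    intro y hy
    obtain ⟨θy, h1, h2, h3, -⟩ := 𝓒.localDegree_irreducible 𝓒.c 𝓒.c_comp hθ y
    rw [← h1, 𝓒.pointDegree_algebraMap (h2 p hp.ne_zero), h3 p hy, Nat.cast_zero]
  have hvalp : pointDegree g (𝓒.c yp) (θ p) = p.natDegree := by
    obtain ⟨θy, h1, h2, -, h4⟩ := 𝓒.localDegree_irreducible 𝓒.c 𝓒.c_comp hθ yp
    rw [← h1, 𝓒.pointDegree_algebraMap (h2 p hp.ne_zero), h4 p hp (Ideal.mem_span_singleton_self p)]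
  have hvali : pointDegree g (𝓒.c' yi) (θ p) = -p.natDegree := by
    obtain ⟨θy, h1, h2, h3, h4⟩ := 𝓒.localDegree_irreducible 𝓒.c' 𝓒.c'_comp hθ' yi
    -- In the coordinate `s = X⁻¹` at infinity, `p = s ^ (-deg p) * reverse p`. The constant term of
    -- `reverse p` is the leading coefficient of `p`, so `reverse p` is a unit at `s = 0`.
    have hrev : θ p * θ' X ^ p.natDegree = θ' p.reverse := by
      have ev : ∀ (η : k[X] →+* P.functionField) (f : k[X]), η f = f.eval₂ (η.comp C) (η X) :=
        fun η f => RingHom.congr_fun (ringHom_ext (by simp) (by simp) :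
          η = eval₂RingHom (η.comp C) (η X)) f
      have hCC : θ'.comp C = θ.comp C := RingHom.ext fun a => (hC a).symm
      let _ : Invertible (θ X) := ⟨θ' X, by rw [mul_comm, hX], hX⟩
      have h5 := eval₂_reverse_mul_pow (θ.comp C) (θ X) p
      rw [ev θ p, ← h5, ev θ' p.reverse, hCC, mul_assoc, ← mul_pow, hX, one_pow, mul_one]
      rfl
    rw [𝓒.pointDegree_eq hθp (h2 _ (pow_ne_zero p.natDegree X_ne_zero)) (a := θy p.reverse)
      (by rw [h1, h1, map_pow, hrev]), h3, map_pow, 𝓒.localDegree_pow (h2 _ X_ne_zero),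
      h4 X irreducible_X (Ideal.mem_span_singleton_self X)]
    · simp
    · intro h
      have := X_dvd_iff.mp (Ideal.mem_span_singleton.mp h)
      rw [coeff_zero_reverse, leadingCoeff_eq_zero] at this
      exact hp.ne_zero this
  classical
  have hsupp : (Function.support fun x => pointDegree g x (θ p)) ⊆
      (({𝓒.c yp, 𝓒.c' yi} : Finset P) : Set P) := by
    intro x hx
    rw [Finset.coe_insert, Finset.coe_singleton]
    by_cases hxc : x ∈ Set.range 𝓒.c
    · obtain ⟨y, rfl⟩ := hxc
      by_cases hy : p ∈ PrimeSpectrum.asIdeal y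
      · exact Or.inl (congrArg 𝓒.c (hyp y hy))
      · exact absurd (hval y hy) hx
    · obtain ⟨y, rfl⟩ := (𝓒.cover x).resolve_left hxc
      have hXy := not_not.mp (mt (𝓒.mem_iff y).mpr hxc)
      exact Or.inr (congrArg 𝓒.c' (hyi y hXy))
  refine ⟨(Finset.finite_toSet _).subset hsupp, ?_⟩
  rw [finsum_eq_sum_of_support_subset _ hsupp, Finset.sum_pair hne, hvalp, hvali]
  ring

/-- The degree of a principal divisor on the projective line is zero. -/
theorem hasDegreeZero {φ : P.functionField} (hφ : φ ≠ 0) : HasDegreeZero g φ := by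
  obtain ⟨θ, θ', hθ, hθ', hC, hC', hfrac, hX⟩ := 𝓒.exists_functionField_charts
  let _ := θ.toAlgebra
  have hinj : Function.Injective θ := IsFractionRing.injective k[X] P.functionField
  have h0 : ∀ f : k[X], f ≠ 0 → θ f ≠ 0 := fun f hf => (map_ne_zero_iff _ hinj).mpr hf
  have hpoly : ∀ f : k[X], f ≠ 0 → HasDegreeZero g (θ f) := by
    intro f hf
    induction f using WfDvdMonoid.induction_on_irreducible with
    | zero => exact absurd rfl hf
    | unit f hu =>
      obtain ⟨a, ha, rfl⟩ := Polynomial.isUnit_iff.mp hu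
      have h1 : ∀ x, pointDegree g x (θ (C a)) = 0 := by
        intro x
        have h2 : θ (C a) = algebraMap _ P.functionField ((stalkHom g x).hom a) := by
          rw [hC, ← stalkHom_stalkSpecializes g ((genericPoint_spec P).specializes trivial : _ ⤳ x)]
          rfl
        have h3 : IsUnit ((stalkHom g x).hom a) := ha.map _
        rw [h2, 𝓒.pointDegree_algebraMap h3.ne_zero, localDegree_of_isUnit g h3, Nat.cast_zero]
      refine ⟨?_, ?_⟩
      · simp [h1]
      · simp [h1]
    | mul f p hf1 hp ih =>
      rw [map_mul]
      exact HasDegreeZero.mul 𝓒 (h0 p hp.ne_zero) (h0 f hf1)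
        (𝓒.hasDegreeZero_irreducible hθ hθ' (fun a => (hC a).trans (hC' a).symm) hX hp) (ih hf1)
  obtain ⟨a, b, hb, rfl⟩ := IsFractionRing.div_surjective (A := k[X]) φ
  have hb0 := nonZeroDivisors.ne_zero hb
  have ha0 : a ≠ 0 := by rintro rfl; simp at hφ
  have ha := hpoly a ha0
  have hb := hpoly b hb0
  have h1 : (fun x => pointDegree g x (algebraMap k[X] P.functionField a / algebraMap _ _ b)) =
      fun x => pointDegree g x (θ a) - pointDegree g x (θ b) := by
    funext x
    rw [eq_sub_iff_add_eq, ← 𝓒.pointDegree_mul x hφ (h0 b hb0)]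
    congr 1
    exact div_mul_cancel₀ _ (h0 b hb0)
  refine ⟨?_, ?_⟩
  · rw [h1]
    exact (ha.1.union hb.1).subset (Function.support_sub _ _)
  · rw [h1, finsum_sub_distrib ha.1 hb.1, ha.2, hb.2, sub_zero]

end ProjectiveLineCharts

end Degree

/-! ### Factorization into given primes in a local domain -/

section LocalFactorization

/-- An element is a product of powers of prime elements `π i` if every prime ideal that contains it
contains one of the `π i`. -/
theorem exists_eq_unit_mul_prod_pow {A : Type*} [CommRing A] [IsDomain A] {w : A} {ι : Type*}
    (s : Finset ι) (π : ι → A) (hπ : ∀ i ∈ s, Prime (π i))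
    (h : ∀ P : Ideal A, P.IsPrime → w ∈ P → ∃ i ∈ s, π i ∈ P) :
    ∃ (u : A) (n : ι → ℕ), IsUnit u ∧ w = u * ∏ i ∈ s, π i ^ n i := by
  classical
  -- The product of the `π i` lies in every prime that contains `w`, so `w` divides one of its
  -- powers. A divisor of a product of primes is a unit times a subproduct.
  have hrad : ∏ i ∈ s, π i ∈ (Ideal.span {w}).radical := by
    rw [Ideal.radical_eq_sInf, Submodule.mem_sInf]
    rintro P ⟨hwP, hP⟩
    obtain ⟨i, hi, hiP⟩ := h P hP (hwP (Ideal.mem_span_singleton_self w))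
    obtain ⟨c, hc⟩ := Finset.dvd_prod_of_mem π hi
    rw [hc]
    exact Ideal.mul_mem_right c P hiP
  obtain ⟨N, hN⟩ := hrad
  obtain ⟨c, hc⟩ := Ideal.mem_span_singleton.mp hN
  have hprod : w * c = 1 * ∏ x ∈ s ×ˢ Finset.range N, π x.1 := by
    rw [← hc, one_mul, Finset.prod_product, ← Finset.prod_pow]
    simp
  obtain ⟨t, t', b, b', ht, -, hb, hw, -⟩ := mul_eq_mul_prime_prod
    (fun x hx => hπ x.1 (Finset.mem_product.mp hx).1) hprod
  refine ⟨b, fun i => (t.filter fun x => x.1 = i).card, IsUnit.of_mul_eq_one _ hb.symm, ?_⟩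
  rw [hw, ← Finset.prod_fiberwise_of_maps_to (t := s) (g := Prod.fst)
    (fun x hx => (Finset.mem_product.mp (ht ▸ Finset.mem_union_left t' hx)).1)]
  congr 1
  refine Finset.prod_congr rfl fun i _ => ?_
  rw [Finset.prod_congr rfl fun x hx => by rw [(Finset.mem_filter.mp hx).2], Finset.prod_const]

/-- The order of `w` along `h = 0` is well-defined. -/
theorem pow_eq_pow_of_order {A F : Type*} [CommRing A] [IsDomain A] [IsLocalRing A] [Field F] [Algebra A F]
    [IsFractionRing A F] {h w : F} {π a b s t s' t' : A} {n n' : ℕ}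
    (hπ : π ∈ IsLocalRing.maximalIdeal A) (hπ0 : π ≠ 0) (ha : IsUnit a) (hb : IsUnit b)
    (hab : h * algebraMap A F b = algebraMap A F (π * a))
    (hs : IsUnit s) (ht : IsUnit t) (hs' : IsUnit s') (ht' : IsUnit t')
    (hw : w * algebraMap A F t = h ^ n * algebraMap A F s)
    (hw' : w * algebraMap A F t' = h ^ n' * algebraMap A F s') : n = n' := by
  wlog hle : n ≤ n' generalizing n n' s t s' t'
  · exact (this hs' ht' hs ht hw' hw (le_of_not_ge hle)).symm
  obtain ⟨d, rfl⟩ := Nat.exists_eq_add_of_le hle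
  have hinj := IsFractionRing.injective A F
  have hb0 : algebraMap A F b ≠ 0 := (map_ne_zero_iff _ hinj).mpr hb.ne_zero
  have hh : h ≠ 0 := by
    rintro rfl
    rw [zero_mul, eq_comm, map_eq_zero_iff _ hinj] at hab
    exact mul_ne_zero hπ0 ha.ne_zero hab
  have h1 : algebraMap A F s * algebraMap A F t' = h ^ d * algebraMap A F s' * algebraMap A F t := by
    refine mul_left_cancel₀ (pow_ne_zero n hh) ?_
    rw [← mul_assoc, ← hw, mul_right_comm, hw', pow_add]
    ring
  have h2 : s * t' * b ^ d = (π * a) ^ d * s' * t := by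
    apply hinj
    simp only [map_mul, map_pow] at hab ⊢
    rw [h1, ← hab]
    ring
  by_contra hd
  have hd0 : d ≠ 0 := by lia
  have hu : IsUnit (s * t' * b ^ d) := (hs.mul ht').mul (hb.pow d)
  refine (IsLocalRing.notMem_maximalIdeal.mpr hu) ?_
  rw [h2, mul_assoc]
  exact Ideal.mul_mem_right _ _ (Ideal.pow_mem_of_mem _ (Ideal.mul_mem_right _ _ hπ) d (Nat.pos_of_ne_zero hd0))

/-- If `y a + π b` is in `I`, then so is `π b`, and so is `b` since `I` is prime. Thus `I = (y) + π
I`, and Nakayama's lemma concludes. -/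
theorem eq_span_singleton_of_maximalIdeal_eq {A : Type*} [CommRing A] [IsLocalRing A] [IsNoetherianRing A]
    {I : Ideal A} [I.IsPrime] {y π : A} (hy : y ∈ I) (hπ : π ∉ I)
    (hm : ∀ z ∈ IsLocalRing.maximalIdeal A, ∃ a b, z = y * a + π * b)
    (hπm : π ∈ IsLocalRing.maximalIdeal A) : I = Ideal.span {y} := by
  refine le_antisymm ?_ (by simpa [Ideal.span_le] using hy)
  refine Submodule.le_of_le_smul_of_le_jacobson_bot (IsNoetherian.noetherian I)
    (IsLocalRing.maximalIdeal_le_jacobson _) fun z hz => ?_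
  obtain ⟨a, b, rfl⟩ := hm z (IsLocalRing.le_maximalIdeal (Ideal.IsPrime.ne_top ‹_›) hz)
  have hπb : π * b ∈ I := (Ideal.add_mem_iff_right I (I.mul_mem_right a hy)).mp hz
  have hb : b ∈ I := (Ideal.IsPrime.mem_or_mem ‹_› hπb).resolve_left hπ
  exact Submodule.add_mem_sup (Ideal.mul_mem_right _ _ (Ideal.mem_span_singleton_self y))
    (Submodule.smul_mem_smul hπm hb)

end LocalFactorization

/-! ### The linear system of a string of curves -/

section Continuant

open Matrix

/-- The coefficient at the end of the string in the solution of the linear system of a string. -/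
theorem last_eq_one_of_string {r : ℕ} (s a : Fin (r + 1) → ℤ) {m : ℤ} (hm : m ≠ 0)
    (hdet : m = Matrix.det (-(Matrix.of fun i j : Fin (r + 1) =>
      if i = j then s i else if i.val + 1 = j.val ∨ j.val + 1 = i.val then 1 else 0)))
    (h : ∀ i, a i * s i + (∑ j, if i.val + 1 = j.val ∨ j.val + 1 = i.val then a j else 0) +
      (if i = 0 then m else 0) = 0) : a (Fin.last r) = 1 := by
  set M : Matrix (Fin (r + 1)) (Fin (r + 1)) ℤ := -(Matrix.of fun i j : Fin (r + 1) =>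
      if i = j then s i else if i.val + 1 = j.val ∨ j.val + 1 = i.val then 1 else 0) with hM
  have hMa : M *ᵥ a = Pi.single 0 m := by
    ext i
    have h1 : (M *ᵥ a) i = -(a i * s i + ∑ j, if i.val + 1 = j.val ∨ j.val + 1 = i.val then a j else 0) := by
      rw [hM, neg_mulVec, Pi.neg_apply, mulVec, dotProduct]
      congr 1
      have h0 : a i * s i = ∑ j, if i = j then a j * s j else 0 := by simp
      rw [h0, ← Finset.sum_add_distrib]
      refine Finset.sum_congr rfl fun j _ => ?_
      rw [Matrix.of_apply]
      by_cases hij : i = j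
      · subst hij
        simp [mul_comm]
      · by_cases hadj : i.val + 1 = j.val ∨ j.val + 1 = i.val <;> simp [hij, hadj]
    rw [h1, Pi.single_apply]
    linarith [h i]
  -- Cramer's rule: multiplying `M a = m e` by the adjugate, and using `det M = m`, identifies `a`
  -- with the first column of the adjugate, up to the factor `m`.
  have h2 : m • a = m • (M.adjugate *ᵥ Pi.single 0 1) := by
    rw [hdet, ← Matrix.mulVec_smul, ← Pi.single_smul, smul_eq_mul, mul_one, ← hdet, ← hMa, mulVec_mulVec,
      adjugate_mul, ← hdet, smul_mulVec, one_mulVec]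
  have h3 : a (Fin.last r) = M.adjugate (Fin.last r) 0 := by
    have := congrFun h2 (Fin.last r)
    simpa [hm] using this
  -- Deleting the first row and the last column leaves an upper triangular matrix whose diagonal
  -- consists of the subdiagonal entries `-1` of `M`. The two signs `(-1) ^ r` cancel.
  rw [h3, adjugate_fin_succ_eq_det_submatrix, det_of_isUpperTriangular]
  · have : ∀ i : Fin r, M (Fin.succAbove 0 i) (Fin.succAbove (Fin.last r) i) = -1 := by
      intro i
      simp [hM, Fin.ext_iff]
    simp only [submatrix_apply, this]
    simp [← pow_add, ← two_mul]
  · intro i j hij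
    have : j.val < i.val := hij
    simp only [submatrix_apply, hM, Matrix.neg_apply, of_apply, Fin.succAbove_zero, Fin.succAbove_last]
    rw [if_neg (by simp [Fin.ext_iff]; lia), if_neg (by simp; lia), neg_zero]

end Continuant

/-! ### Irreducible closed subsets and primes of local rings -/

section Specialization

open CategoryTheory Limits AlgebraicGeometry TensorProduct

universe u

/-- Suppose `d` is not in `k · 1`. A functional vanishing on `1` but not on `d`, applied to the
first factor of `1 ⊗ d = d ⊗ 1`, gives a contradiction. -/
theorem surjective_of_isEpi_field {k A : Type*} [Field k] [CommRing A] [Algebra k A] [Nontrivial A]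
    [Algebra.IsEpi k A] : Function.Surjective (algebraMap k A) := by
  intro d
  by_contra hd
  have hd' : d ∉ Submodule.span k {(1 : A)} := fun h => by
    obtain ⟨a, ha⟩ := Submodule.mem_span_singleton.mp h
    exact hd ⟨a, by rw [← ha, Algebra.smul_def, mul_one]⟩
  obtain ⟨φ, hφ, hφ'⟩ := Submodule.exists_le_ker_of_notMem hd'
  have h1 : φ 1 = 0 := hφ' (Submodule.mem_span_singleton_self _)
  have h := (Algebra.isEpi_iff_forall_one_tmul_eq k A).mp inferInstance d
  have h2 := congrArg (fun z => TensorProduct.lid k A (TensorProduct.map φ LinearMap.id z)) h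
  simp only [TensorProduct.map_tmul, TensorProduct.lid_tmul, LinearMap.id_apply, h1, zero_smul] at h2
  exact (smul_ne_zero hφ one_ne_zero) h2.symm

variable {X : Scheme.{u}}

/-- The prime ideal of `𝒪_{X, p}` of the irreducible closed subset with generic point `ξ`. -/
noncomputable def specializationIdeal {ξ p : X} (h : ξ ⤳ p) : Ideal (X.presheaf.stalk p) :=
  (IsLocalRing.maximalIdeal (X.presheaf.stalk ξ)).comap (X.presheaf.stalkSpecializes h).hom

instance {ξ p : X} (h : ξ ⤳ p) : (specializationIdeal h).IsPrime :=
  Ideal.IsPrime.comap _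

theorem mem_specializationIdeal {ξ p : X} (h : ξ ⤳ p) {s : X.presheaf.stalk p} :
    s ∈ specializationIdeal h ↔
      (X.presheaf.stalkSpecializes h).hom s ∈ IsLocalRing.maximalIdeal (X.presheaf.stalk ξ) :=
  Iff.rfl

theorem isUnit_stalkSpecializes {ξ p : X} (h : ξ ⤳ p) {s : X.presheaf.stalk p}
    (hs : s ∉ specializationIdeal h) : IsUnit ((X.presheaf.stalkSpecializes h).hom s) :=
  IsLocalRing.notMem_maximalIdeal.mp hs

theorem SpecMap_stalkSpecializes_closedPoint {ξ p : X} (h : ξ ⤳ p) :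
    X.fromSpecStalk p (⟨specializationIdeal h, inferInstance⟩ : PrimeSpectrum (X.presheaf.stalk p)) = ξ := by
  have h1 : (Spec.map (X.presheaf.stalkSpecializes h) ≫ X.fromSpecStalk p)
      (IsLocalRing.closedPoint (X.presheaf.stalk ξ)) = ξ := by
    rw [Scheme.SpecMap_stalkSpecializes_fromSpecStalk]
    exact Scheme.fromSpecStalk_closedPoint
  exact h1

/-- The primes of the local ring at `p` are the generizations of `p`. So conditions on all primes
containing `w` become conditions on points of `X`. -/
theorem exists_specializationIdeal_eq {p : X} (P : Ideal (X.presheaf.stalk p)) [hP : P.IsPrime] :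
    ∃ (ξ : X) (h : ξ ⤳ p), specializationIdeal h = P := by
  let z : PrimeSpectrum (X.presheaf.stalk p) := ⟨P, hP⟩
  have h : X.fromSpecStalk p z ⤳ p := by
    have : X.fromSpecStalk p z ∈ Set.range (X.fromSpecStalk p) := ⟨z, rfl⟩
    rwa [Scheme.range_fromSpecStalk] at this
  refine ⟨_, h, ?_⟩
  have := (X.fromSpecStalk p).isEmbedding.injective (SpecMap_stalkSpecializes_closedPoint h)
  exact congrArg PrimeSpectrum.asIdeal this

theorem specializationIdeal_mono {ξ ξ' p : X} (h : ξ ⤳ p) (h' : ξ' ⤳ p) (hξ : ξ' ⤳ ξ) :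
    specializationIdeal h' ≤ specializationIdeal h := by
  intro s hs
  by_contra hs'
  have := (isUnit_stalkSpecializes h hs').map (X.presheaf.stalkSpecializes hξ).hom
  refine hs (?_ : IsUnit _)
  rw [← TopCat.Presheaf.stalkSpecializes_comp X.presheaf hξ h]
  exact this

theorem specializes_of_specializationIdeal_le {ξ ξ' p : X} (h : ξ ⤳ p) (h' : ξ' ⤳ p)
    (hle : specializationIdeal h' ≤ specializationIdeal h) : ξ' ⤳ ξ := by
  rw [← SpecMap_stalkSpecializes_closedPoint h, ← SpecMap_stalkSpecializes_closedPoint h']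
  exact Specializes.map ((PrimeSpectrum.le_iff_specializes _ _).mp hle) (X.fromSpecStalk p).continuous

theorem stalkHom_mem_specializationIdeal {S : CommRingCat.{u}} (g : X ⟶ Spec S) {ξ p : X} (h : ξ ⤳ p)
    (s : S) : (stalkHom g p).hom s ∈ specializationIdeal h ↔ s ∈ PrimeSpectrum.asIdeal (g ξ) := by
  rw [mem_asIdeal_iff, ← stalkHom_stalkSpecializes g h]
  rfl

/-- The kernel of the restriction of germs to an integral closed subscheme. -/
theorem mem_ker_stalkMap_iff {Z : Scheme.{u}} [IsIntegral Z] (ι : Z ⟶ X) {z z' : Z} (h : z' ⤳ z)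
    (hz' : z' = genericPoint Z) {s : X.presheaf.stalk (ι z)} :
    (ι.stalkMap z).hom s = 0 ↔ s ∈ specializationIdeal (h.map ι.continuous) := by
  subst hz'
  have h1 : (ι.stalkMap (genericPoint Z)).hom ((X.presheaf.stalkSpecializes (h.map ι.continuous)).hom s) =
      (Z.presheaf.stalkSpecializes h).hom ((ι.stalkMap z).hom s) :=
    Scheme.Hom.stalkSpecializes_stalkMap_apply ι _ _ h s
  have h2 : Function.Injective (Z.presheaf.stalkSpecializes h).hom :=
    IsFractionRing.injective (Z.presheaf.stalk z) Z.functionField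
  rw [← map_eq_zero_iff _ h2, ← h1, mem_specializationIdeal]
  constructor
  · intro h0 hu
    exact (hu.map (ι.stalkMap (genericPoint Z)).hom).ne_zero h0
  · intro hs
    by_contra h0
    exact hs ((isUnit_map_iff (ι.stalkMap (genericPoint Z)).hom _).mp (Ne.isUnit (a := (_ : Z.functionField)) h0))

theorem ker_stalkMap {Z : Scheme.{u}} [IsIntegral Z] (ι : Z ⟶ X) {z : Z} (h : ι (genericPoint Z) ⤳ ι z) :
    RingHom.ker (ι.stalkMap z).hom = specializationIdeal h :=
  Ideal.ext fun _ => mem_ker_stalkMap_iff ι ((genericPoint_spec Z).specializes trivial) rfl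

end Specialization

/-! ### Intersections in a single rational point -/

section Intersection

open CategoryTheory Limits AlgebraicGeometry Polynomial

universe u

variable {k : Type u} [Field k]

namespace ProjectiveLineCharts

variable {P : Scheme.{u}} {g : P ⟶ Spec (CommRingCat.of k)} [IsIntegral P]

theorem exists_ratFunc_ringHom (𝓒 : ProjectiveLineCharts g) :
    ∃ e : P.functionField →+* RatFunc k, ∀ a, e ((stalkHom g (genericPoint P)).hom a) = RatFunc.C a := by
  obtain ⟨θ, -, -, -, hC, -, hfrac, -⟩ := 𝓒.exists_functionField_charts
  let _ := θ.toAlgebra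
  have : IsFractionRing k[X] P.functionField := hfrac
  refine ⟨(IsFractionRing.ringEquivOfRingEquiv (K := P.functionField) (L := RatFunc k)
    (RingEquiv.refl k[X])).toRingHom, fun a => ?_⟩
  rw [← hC]
  exact (IsFractionRing.ringEquivOfRingEquiv_algebraMap (RingEquiv.refl k[X]) (C a)).trans
    (RatFunc.algebraMap_C a)

theorem not_surjective_stalkHom (𝓒 : ProjectiveLineCharts g) :
    ¬ Function.Surjective (stalkHom g (genericPoint P)).hom := by
  intro h
  obtain ⟨θ, -, -, -, hC, -, hfrac, -⟩ := 𝓒.exists_functionField_charts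
  let _ := θ.toAlgebra
  have : IsFractionRing k[X] P.functionField := hfrac
  obtain ⟨a, ha⟩ := h (θ X)
  rw [← hC] at ha
  exact X_ne_C a (IsFractionRing.injective k[X] P.functionField ha).symm

end ProjectiveLineCharts

/-- The scheme-theoretic intersection of `Z` and `P` is a single rational point. -/
def MeetsInRationalPoint {X Z P : Scheme.{u}} (ι : Z ⟶ X) (e : P ⟶ X) (g : P ⟶ Spec (CommRingCat.of k)) :
    Prop :=
  ∃ (W : Scheme.{u}) (a : W ⟶ Z) (b : W ⟶ P), IsPullback a b ι e ∧ IsIso (b ≫ g)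

theorem mem_range_of_genericPoint_specializes {X Z : Scheme.{u}} {ι : Z ⟶ X} [IsIntegral Z] [IsClosedImmersion ι]
    {p : X} (h : ι (genericPoint Z) ⤳ p) : p ∈ Set.range ι :=
  h.mem_closed ι.isClosedEmbedding.isClosed_range ⟨_, rfl⟩

namespace MeetsInRationalPoint

variable {X Z P : Scheme.{u}} {ι : Z ⟶ X} {e : P ⟶ X} {g : P ⟶ Spec (CommRingCat.of k)}
  [IsIntegral Z] [IsClosedImmersion ι] [IsClosedImmersion e] (H : MeetsInRationalPoint ι e g)

include H

theorem exists_specializes : ∃ x, ι (genericPoint Z) ⤳ e x := by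
  obtain ⟨W, a, b, hab, h⟩ := H
  let z : W := inv (b ≫ g) (IsLocalRing.closedPoint k)
  refine ⟨b z, ?_⟩
  have : e (b z) = ι (a z) := congrArg (fun φ : W ⟶ X => φ z) hab.w.symm
  rw [this]
  exact ((genericPoint_spec Z).specializes trivial).map ι.continuous

theorem eq_of_specializes {x x' : P} (h : ι (genericPoint Z) ⤳ e x) (h' : ι (genericPoint Z) ⤳ e x') :
    x = x' := by
  obtain ⟨y, hy⟩ := mem_range_of_genericPoint_specializes h
  obtain ⟨y', hy'⟩ := mem_range_of_genericPoint_specializes h'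
  obtain ⟨W, a, b, hab, hiso⟩ := H
  obtain ⟨z, -, hz⟩ := Scheme.Pullback.exists_preimage_pullback y x hy
  obtain ⟨z', -, hz'⟩ := Scheme.Pullback.exists_preimage_pullback y' x' hy'
  have h1 : ∀ t : W, t = inv (b ≫ g) (IsLocalRing.closedPoint k) := fun t => by
    have h2 : (b ≫ g) t = IsLocalRing.closedPoint k := Subsingleton.elim (α := PrimeSpectrum k) _ _
    rw [← h2]
    exact (congrArg (fun φ : W ⟶ W => φ t) (IsIso.hom_inv_id (b ≫ g))).symm
  have h3 : hab.isoPullback.inv z = hab.isoPullback.inv z' := (h1 _).trans (h1 _).symm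
  have h4 : ∀ t, b (hab.isoPullback.inv t) = pullback.snd ι e t := fun t =>
    congrArg (fun φ : pullback ι e ⟶ P => φ t) hab.isoPullback_inv_snd
  rw [← hz, ← hz', ← h4, ← h4, h3]

/-- With `J` the image in `𝒪_{P,x}` of the ideal of `Z`, the spectrum of `𝒪_{P,x} / J` maps
monomorphically to the intersection, which is `Spec k`. Hence `k → 𝒪_{P,x} / J` is an epimorphism
from a field to a nonzero ring, so surjective. All of transversality is derived from this. -/
theorem exists_eq_add (x : P) (h : ι (genericPoint Z) ⤳ e x) (d : P.presheaf.stalk x) :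
    ∃ (a : k), ∃ s ∈ specializationIdeal h, d = (stalkHom g x).hom a + (e.stalkMap x).hom s := by
  obtain ⟨y, hy⟩ := mem_range_of_genericPoint_specializes h
  have hy' : e x ⤳ ι y := specializes_of_eq hy.symm
  have hZ : ι (genericPoint Z) ⤳ ι y := h.trans hy'
  let J := (specializationIdeal h).map (e.stalkMap x).hom
  by_cases hJ : J = ⊤
  · obtain ⟨s, hs, hsd⟩ := (Ideal.mem_map_iff_of_surjective _ (e.stalkMap_surjective x)).mp
      (show d ∈ J from hJ ▸ trivial)
    exact ⟨0, s, hs, by rw [map_zero, zero_add, hsd]⟩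
  have : Nontrivial (P.presheaf.stalk x ⧸ J) := Ideal.Quotient.nontrivial_iff.mpr hJ
  let mk : P.presheaf.stalk x ⟶ CommRingCat.of (P.presheaf.stalk x ⧸ J) :=
    CommRingCat.ofHom (Ideal.Quotient.mk J)
  -- The quotient map kills the ideal of `Z`, so it factors through the local ring of `Z`. This
  -- gives the second leg of the map to the fibre product.
  obtain ⟨σ, hσ⟩ : ∃ σ : Z.presheaf.stalk y ⟶ CommRingCat.of (P.presheaf.stalk x ⧸ J),
      ι.stalkMap y ≫ σ = X.presheaf.stalkSpecializes hy' ≫ e.stalkMap x ≫ mk := by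
    let ψ := X.presheaf.stalkSpecializes hy' ≫ e.stalkMap x ≫ mk
    have hker : RingHom.ker (ι.stalkMap y).hom ≤ RingHom.ker ψ.hom := by
      intro s hs
      have h1 := (mem_ker_stalkMap_iff ι ((genericPoint_spec Z).specializes trivial) rfl).mp hs
      have h2 : (X.presheaf.stalkSpecializes hy').hom s ∈ specializationIdeal h := by
        rw [mem_specializationIdeal] at h1 ⊢
        rw [← TopCat.Presheaf.stalkSpecializes_comp X.presheaf h hy'] at h1
        exact h1
      exact Ideal.Quotient.eq_zero_iff_mem.mpr (Ideal.mem_map_of_mem _ h2)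
    refine ⟨CommRingCat.ofHom ((ι.stalkMap y).hom.liftOfSurjective (ι.stalkMap_surjective y) ⟨ψ.hom, hker⟩), ?_⟩
    refine CommRingCat.hom_ext (RingHom.ext fun s => ?_)
    exact RingHom.liftOfRightInverse_comp_apply _ _
      (Function.rightInverse_surjInv (ι.stalkMap_surjective y)) ⟨ψ.hom, hker⟩ s
  have hmono : Mono (Spec.map mk) :=
    have : IsClosedImmersion (Spec.map mk) := IsClosedImmersion.spec_of_surjective _ Ideal.Quotient.mk_surjective
    inferInstance
  obtain ⟨W, a, b, hab, hiso⟩ := H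
  have hcomm : (Spec.map σ ≫ Z.fromSpecStalk y) ≫ ι = (Spec.map mk ≫ P.fromSpecStalk x) ≫ e := by
    rw [Category.assoc, Category.assoc, ← Scheme.SpecMap_stalkMap_fromSpecStalk,
      ← Scheme.SpecMap_stalkMap_fromSpecStalk, ← Spec.map_comp_assoc, hσ, Spec.map_comp, Spec.map_comp,
      Category.assoc, Category.assoc, Scheme.SpecMap_stalkSpecializes_fromSpecStalk]
  let l := hab.lift _ _ hcomm
  have hlb : l ≫ b = Spec.map mk ≫ P.fromSpecStalk x := hab.lift_snd _ _ hcomm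
  have hl : Mono l := by
    have : Mono (l ≫ b) := hlb ▸ inferInstance
    exact mono_of_mono l b
  have hlg : Spec.map (stalkHom g x ≫ mk) = l ≫ b ≫ g := by
    rw [reassoc_of% hlb, Spec.map_comp, SpecMap_stalkHom]
  have hm : Mono (Spec.map (stalkHom g x ≫ mk)) := hlg ▸ inferInstance
  have hepi : Epi (stalkHom g x ≫ mk) := ⟨fun u v huv => Spec.map_injective (by
    rw [← cancel_mono (Spec.map (stalkHom g x ≫ mk)), ← Spec.map_comp, ← Spec.map_comp, huv])⟩
  let _ := (stalkHom g x ≫ mk).hom.toAlgebra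
  have : Algebra.IsEpi k (P.presheaf.stalk x ⧸ J) := CommRingCat.epi_iff_epi.mp hepi
  obtain ⟨c, hc⟩ := surjective_of_isEpi_field (k := k) (Ideal.Quotient.mk J d)
  have hc' : d - (stalkHom g x).hom c ∈ J := Ideal.Quotient.eq.mp hc.symm
  obtain ⟨s, hs, hsd⟩ := (Ideal.mem_map_iff_of_surjective _ (e.stalkMap_surjective x)).mp hc'
  exact ⟨c, s, hs, by rw [hsd]; ring⟩

/-- Otherwise the decomposition `k + J` at the generic point, where `J = 0`, would make the function
field of the line equal to `k`. -/
theorem not_specializes_genericPoint [IsIntegral P] (𝓒 : ProjectiveLineCharts g) :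
    ¬ ι (genericPoint Z) ⤳ e (genericPoint P) := by
  intro h
  refine 𝓒.not_surjective_stalkHom fun d => ?_
  obtain ⟨a, s, hs, rfl⟩ := H.exists_eq_add _ h d
  have h0 : (e.stalkMap (genericPoint P)).hom s = 0 := by
    by_contra h0
    have hu : IsUnit s := (isUnit_map_iff (e.stalkMap (genericPoint P)).hom _).mp
      (Ne.isUnit (a := (_ : P.functionField)) h0)
    exact Ideal.IsPrime.ne_top inferInstance (Ideal.eq_top_of_isUnit_mem _ hs hu)
  exact ⟨a, by rw [h0, add_zero]⟩

theorem localDegree_eq_one [IsIntegral P] {x : P} (h : ι (genericPoint Z) ⤳ e x)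
    {π : X.presheaf.stalk (e x)} (hπ : specializationIdeal h = Ideal.span {π}) :
    localDegree g x ((e.stalkMap x).hom π) = 1 := by
  have hJ : Ideal.span {(e.stalkMap x).hom π} ≠ ⊤ := by
    intro h1
    have h2 : IsUnit π := (isUnit_map_iff (e.stalkMap x).hom _).mp (Ideal.span_singleton_eq_top.mp h1)
    refine Ideal.IsPrime.ne_top (I := specializationIdeal h) inferInstance ?_
    rw [hπ, Ideal.span_singleton_eq_top.mpr h2]
  let _ := stalkAlgebra g x
  change Module.finrank k (P.presheaf.stalk x ⧸ Ideal.span {(e.stalkMap x).hom π}) = 1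
  have : Nontrivial (P.presheaf.stalk x ⧸ Ideal.span {(e.stalkMap x).hom π}) :=
    Ideal.Quotient.nontrivial_iff.mpr hJ
  have hsurj : Function.Surjective (algebraMap k (P.presheaf.stalk x ⧸ Ideal.span {(e.stalkMap x).hom π})) := by
    intro z
    obtain ⟨d, rfl⟩ := Ideal.Quotient.mk_surjective z
    obtain ⟨a, s, hs, rfl⟩ := H.exists_eq_add _ h d
    refine ⟨a, Ideal.Quotient.eq.mpr ?_⟩
    rw [hπ] at hs
    obtain ⟨t, rfl⟩ := Ideal.mem_span_singleton'.mp hs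
    rw [map_mul]
    change (stalkHom g x).hom a - ((stalkHom g x).hom a + _) ∈ _
    rw [sub_add_cancel_left]
    exact neg_mem (Ideal.mul_mem_left _ _ (Ideal.mem_span_singleton_self _))
  have e := LinearEquiv.ofBijective
    (Algebra.linearMap k (P.presheaf.stalk x ⧸ Ideal.span {(e.stalkMap x).hom π}))
    ⟨(algebraMap k _).injective, hsurj⟩
  rw [← e.finrank_eq, Module.finrank_self]

/-- Transversality gives local parameters: a lift `y` of a generator of the image of the ideal of
`Z` generates the maximal ideal together with the equation `π` of `P`. Nakayama's lemma then shows
that `y` alone generates the ideal of `Z`. -/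
theorem specializationIdeal_eq_span [IsIntegral P] (𝓒 : ProjectiveLineCharts g) {x : P}
    (h : ι (genericPoint Z) ⤳ e x) [IsNoetherianRing (X.presheaf.stalk (e x))]
    {π : X.presheaf.stalk (e x)} (hπ : RingHom.ker (e.stalkMap x).hom = Ideal.span {π})
    (hZ : ¬ e (genericPoint P) ⤳ ι (genericPoint Z)) :
    ∃ y, specializationIdeal h = Ideal.span {y} := by
  have hx : e (genericPoint P) ⤳ e x := ((genericPoint_spec P).specializes trivial).map e.continuous
  rw [ker_stalkMap e hx] at hπ
  have hPI := 𝓒.isPrincipalIdealRing x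
  obtain ⟨d, hd⟩ := IsPrincipalIdealRing.principal ((specializationIdeal h).map (e.stalkMap x).hom)
  obtain ⟨y, hy, rfl⟩ := (Ideal.mem_map_iff_of_surjective _ (e.stalkMap_surjective x)).mp
    (show d ∈ (specializationIdeal h).map (e.stalkMap x).hom from hd ▸ Ideal.mem_span_singleton_self d)
  refine ⟨y, eq_span_singleton_of_maximalIdeal_eq (π := π) hy ?_ ?_ ?_⟩
  · intro hπI
    exact hZ (specializes_of_specializationIdeal_le h hx (hπ.trans_le (by simpa [Ideal.span_le] using hπI)))
  · intro z hz
    obtain ⟨a, s, hs, has⟩ := H.exists_eq_add _ h ((e.stalkMap x).hom z)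
    have ha : a = 0 := by
      by_contra ha
      have hu : IsUnit ((stalkHom g x).hom a) := (Ne.isUnit ha).map _
      refine (IsLocalRing.notMem_maximalIdeal.mpr hu) ?_
      rw [eq_sub_of_add_eq has.symm, ← map_sub]
      have h1 : z - s ∈ IsLocalRing.maximalIdeal (X.presheaf.stalk (e x)) :=
        sub_mem hz (IsLocalRing.le_maximalIdeal (Ideal.IsPrime.ne_top inferInstance) hs)
      exact fun hu => h1 ((isUnit_map_iff (e.stalkMap x).hom _).mp hu)
    rw [ha, map_zero, zero_add] at has
    have h2 : (e.stalkMap x).hom z ∈ (specializationIdeal h).map (e.stalkMap x).hom :=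
      has ▸ Ideal.mem_map_of_mem _ hs
    rw [hd] at h2
    obtain ⟨c, hc⟩ := Ideal.mem_span_singleton'.mp h2
    obtain ⟨c, rfl⟩ := e.stalkMap_surjective x c
    have h3 : z - y * c ∈ specializationIdeal hx := by
      rw [← ker_stalkMap e hx, RingHom.mem_ker, map_sub, map_mul, sub_eq_zero, ← hc, mul_comm]
    rw [hπ] at h3
    obtain ⟨t, ht⟩ := Ideal.mem_span_singleton'.mp h3
    exact ⟨c, t, by rw [mul_comm π, ht]; ring⟩
  · refine IsLocalRing.le_maximalIdeal (J := specializationIdeal hx) (Ideal.IsPrime.ne_top inferInstance) ?_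
    rw [hπ]
    exact Ideal.mem_span_singleton_self π

end MeetsInRationalPoint

end Intersection

/-! ### Orders of vanishing along curves through a point -/

section Orders

open CategoryTheory Limits AlgebraicGeometry

universe u

variable {X : Scheme.{u}} [IsIntegral X]

theorem algebraMap_stalkSpecializes {ξ p : X} (h : ξ ⤳ p) (s : X.presheaf.stalk p) :
    algebraMap _ X.functionField ((X.presheaf.stalkSpecializes h).hom s) = algebraMap _ X.functionField s := by
  have := TopCat.Presheaf.stalkSpecializes_comp X.presheaf
    ((genericPoint_spec X).specializes (y := ξ) trivial) h
  exact RingHom.congr_fun (congrArg CommRingCat.Hom.hom this) s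

/-- The rational function `h` has a simple zero along the closure of `ξ`, and the ideal of the
closure of `ξ` is principal at `p`. -/
def HasSimpleZero (ξ : X) (h : X.functionField) (p : X) : Prop :=
  ∃ (hp : ξ ⤳ p) (π a b : X.presheaf.stalk p), specializationIdeal hp = Ideal.span {π} ∧
    a ∉ specializationIdeal hp ∧ b ∉ specializationIdeal hp ∧
    h * algebraMap _ X.functionField b = algebraMap _ X.functionField (π * a)

/-- The rational function `w` vanishes to order `n` at `ξ`, where `h` vanishes to order one. -/
def HasOrder (ξ : X) (h w : X.functionField) (n : ℕ) : Prop :=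
  ∃ s t : X.presheaf.stalk ξ, IsUnit s ∧ IsUnit t ∧
    w * algebraMap _ X.functionField t = h ^ n * algebraMap _ X.functionField s

theorem HasOrder.unique {ξ p : X} {h w : X.functionField} {n n' : ℕ} (hh : HasSimpleZero ξ h p) (h0 : h ≠ 0)
    (H : HasOrder ξ h w n) (H' : HasOrder ξ h w n') : n = n' := by
  obtain ⟨hp, π, a, b, hπ, ha, hb, hab⟩ := hh
  obtain ⟨s, t, hs, ht, hst⟩ := H
  obtain ⟨s', t', hs', ht', hst'⟩ := H'
  have hinj := IsFractionRing.injective (X.presheaf.stalk ξ) X.functionField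
  refine pow_eq_pow_of_order (π := (X.presheaf.stalkSpecializes hp).hom π) (h := h) ?_ ?_
    (isUnit_stalkSpecializes hp ha) (isUnit_stalkSpecializes hp hb) ?_ hs ht hs' ht' hst hst'
  · rw [← mem_specializationIdeal, hπ]
    exact Ideal.mem_span_singleton_self π
  · intro hπ0
    have hb0 : algebraMap _ X.functionField ((X.presheaf.stalkSpecializes hp).hom b) ≠ 0 :=
      (map_ne_zero_iff _ hinj).mpr (isUnit_stalkSpecializes hp hb).ne_zero
    rw [algebraMap_stalkSpecializes] at hb0
    rw [map_mul, ← algebraMap_stalkSpecializes hp π, hπ0, map_zero, zero_mul] at hab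
    exact mul_ne_zero h0 hb0 hab
  · rw [← map_mul, algebraMap_stalkSpecializes, algebraMap_stalkSpecializes, hab]

variable {ι : Type*} {ξ : ι → X} {h : ι → X.functionField} {p : X}

/-- Each curve through `p` has a prime local equation, and every prime containing `w` contains one
of these equations. So `w` is a unit times a product of their powers. -/
theorem exists_factorization (S : Finset ι) (hS : ∀ c ∈ S, HasSimpleZero (ξ c) (h c) p) (h0 : ∀ c ∈ S, h c ≠ 0)
    (hne : ∀ c ∈ S, ∀ c' ∈ S, c ≠ c' → ¬ ξ c' ⤳ ξ c) (w : X.presheaf.stalk p)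
    (hw : ∀ (η : X) (hη : η ⤳ p), w ∈ specializationIdeal hη → ∃ c ∈ S, ξ c ⤳ η) :
    ∃ (u : X.presheaf.stalk p) (π : ι → X.presheaf.stalk p) (n : ι → ℕ), IsUnit u ∧
      w = u * ∏ c ∈ S, π c ^ n c ∧
      ∀ c ∈ S, (∀ hp : ξ c ⤳ p, specializationIdeal hp = Ideal.span {π c}) ∧
        HasOrder (ξ c) (h c) (algebraMap _ X.functionField w) (n c) := by
  classical
  have hS' : ∀ c : ι, ∃ π a b : X.presheaf.stalk p, ∀ hc : c ∈ S, ∀ hp : ξ c ⤳ p,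
      specializationIdeal hp = Ideal.span {π} ∧
      a ∉ specializationIdeal hp ∧ b ∉ specializationIdeal hp ∧
      h c * algebraMap _ X.functionField b = algebraMap _ X.functionField (π * a) := by
    intro c
    by_cases hc : c ∈ S
    · obtain ⟨hp, π, a, b, H⟩ := hS c hc
      exact ⟨π, a, b, fun _ _ => H⟩
    · exact ⟨0, 0, 0, fun hc' => absurd hc' hc⟩
  choose π a b H using hS'
  have hp : ∀ c ∈ S, ξ c ⤳ p := fun c hc => (hS c hc).1
  have hπ0 : ∀ c ∈ S, π c ≠ 0 := by
    intro c hc hπ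
    obtain ⟨-, -, hb, hab⟩ := H c hc (hp c hc)
    rw [hπ, zero_mul, map_zero, mul_eq_zero, or_iff_right (h0 c hc), map_eq_zero_iff _
      (IsFractionRing.injective (X.presheaf.stalk p) X.functionField)] at hab
    exact hb (hab ▸ Ideal.zero_mem _)
  obtain ⟨u, n, hu, hwu⟩ := exists_eq_unit_mul_prod_pow (w := w) S π
    (fun c hc => by
      have := (H c hc (hp c hc)).1
      exact (Ideal.span_singleton_prime (hπ0 c hc)).mp (this ▸ inferInstance))
    (fun P hP hwP => by
      obtain ⟨η, hη, rfl⟩ := exists_specializationIdeal_eq P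
      obtain ⟨c, hc, hcη⟩ := hw η hη hwP
      refine ⟨c, hc, specializationIdeal_mono hη (hp c hc) hcη ?_⟩
      rw [(H c hc (hp c hc)).1]
      exact Ideal.mem_span_singleton_self _)
  refine ⟨u, π, n, hu, hwu, fun c hc => ⟨fun hp => (H c hc hp).1, ?_⟩⟩
  obtain ⟨-, ha, hb, hab⟩ := H c hc (hp c hc)
  -- At the generic point of one curve the equations of the others are units, so the exponent of its
  -- own equation is the order of `w` there.
  have hother : ∏ c' ∈ S.erase c, π c' ^ n c' ∉ specializationIdeal (hp c hc) := by
    intro hmem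
    obtain ⟨c', hc', hmem'⟩ := (Ideal.IsPrime.prod_mem_iff).mp hmem
    have hc'S := Finset.mem_of_mem_erase hc'
    refine hne c hc c' hc'S (Finset.ne_of_mem_erase hc').symm
      (specializes_of_specializationIdeal_le (hp c hc) (hp c' hc'S) ?_)
    rw [(H c' hc'S (hp c' hc'S)).1, Ideal.span_singleton_le_iff_mem]
    exact Ideal.IsPrime.mem_of_pow_mem inferInstance _ hmem'
  refine ⟨(X.presheaf.stalkSpecializes (hp c hc)).hom (u * (∏ c' ∈ S.erase c, π c' ^ n c') * b c ^ n c),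
    (X.presheaf.stalkSpecializes (hp c hc)).hom (a c ^ n c), ?_, ?_, ?_⟩
  · rw [map_mul, map_mul, map_pow]
    exact ((hu.map _).mul (isUnit_stalkSpecializes _ hother)).mul ((isUnit_stalkSpecializes _ hb).pow _)
  · rw [map_pow]
    exact (isUnit_stalkSpecializes _ ha).pow _
  · rw [algebraMap_stalkSpecializes, algebraMap_stalkSpecializes, hwu, ← Finset.mul_prod_erase S _ hc]
    simp only [map_mul, map_pow] at hab ⊢
    linear_combination (-1 : X.functionField) * algebraMap _ X.functionField u *
      algebraMap _ X.functionField (∏ c' ∈ S.erase c, π c' ^ n c') * congrArg (· ^ n c) hab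

theorem exists_factorization_of_hasOrder (S : Finset ι) (hS : ∀ c ∈ S, HasSimpleZero (ξ c) (h c) p)
    (h0 : ∀ c ∈ S, h c ≠ 0) (hne : ∀ c ∈ S, ∀ c' ∈ S, c ≠ c' → ¬ ξ c' ⤳ ξ c) (w : X.presheaf.stalk p)
    (hw : ∀ (η : X) (hη : η ⤳ p), w ∈ specializationIdeal hη → ∃ c ∈ S, ξ c ⤳ η) (n : ι → ℕ)
    (hn : ∀ c ∈ S, HasOrder (ξ c) (h c) (algebraMap _ X.functionField w) (n c)) :
    ∃ (u : X.presheaf.stalk p) (π : ι → X.presheaf.stalk p), IsUnit u ∧ w = u * ∏ c ∈ S, π c ^ n c ∧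
      ∀ c ∈ S, ∀ hp : ξ c ⤳ p, specializationIdeal hp = Ideal.span {π c} := by
  obtain ⟨u, π, n', hu, hwu, H⟩ := exists_factorization S hS h0 hne w hw
  refine ⟨u, π, hu, ?_, fun c hc => (H c hc).1⟩
  rw [hwu]
  congr 1
  exact Finset.prod_congr rfl fun c hc => by rw [(H c hc).2.unique (hS c hc) (h0 c hc) (hn c hc)]

end Orders

/-! ### The degree of a principal divisor on an exceptional curve -/

section DegreeRelation

open CategoryTheory Limits AlgebraicGeometry

universe u

variable {k : Type u} [Field k] {X P : Scheme.{u}} [IsIntegral X] [IsIntegral P] {e : P ⟶ X}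
  {g : P ⟶ Spec (CommRingCat.of k)}

theorem stalkMap_specializes_algebraMap {x : P} (hx : e (genericPoint P) ⤳ e x) (s : X.presheaf.stalk (e x)) :
    (e.stalkMap (genericPoint P)).hom ((X.presheaf.stalkSpecializes hx).hom s) =
      algebraMap (P.presheaf.stalk x) P.functionField ((e.stalkMap x).hom s) :=
  Scheme.Hom.stalkSpecializes_stalkMap_apply e _ _ ((genericPoint_spec P).specializes trivial) s

/-- The degree of the restriction to `P` of the divisor of a rational function `w` is zero. The
function `w` vanishes to order `n` along `P`, and the divisor of the other zeros of `w` has at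
`x ∈ P` the intersection multiplicity `N x` with `P`. -/
theorem HasSelfIntersection.mul_add_finsum_eq_zero {s : ℤ} (hs : HasSelfIntersection g e s)
    (𝓒 : ProjectiveLineCharts g) {w : X.functionField} (hw0 : w ≠ 0) {n : ℕ} (hn : n ≠ 0) (N : P → ℤ)
    (hN : (Function.support N).Finite)
    (H : ∀ x, ∃ ρ π : X.presheaf.stalk (e x), RingHom.ker (e.stalkMap x).hom = Ideal.span {π} ∧
      w = algebraMap _ X.functionField (ρ * π ^ n) ∧ (e.stalkMap x).hom ρ ≠ 0 ∧
      localDegree g x ((e.stalkMap x).hom ρ) = N x) :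
    n * s + ∑ᶠ x, N x = 0 := by
  obtain ⟨h, π, a, b, hπ, hab, rfl⟩ := hs
  have H' : ∀ x, ∃ ρ : X.presheaf.stalk (e x),
      w = algebraMap _ X.functionField (ρ * π x ^ n) ∧ (e.stalkMap x).hom ρ ≠ 0 ∧
      localDegree g x ((e.stalkMap x).hom ρ) = N x := by
    intro x
    obtain ⟨ρ, π', hπ', hw, hρ, hρN⟩ := H x
    obtain ⟨u, hu⟩ := Ideal.span_singleton_eq_span_singleton.mp ((hπ x).symm.trans hπ')
    refine ⟨ρ * u ^ n, ?_, ?_, ?_⟩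
    · rw [hw, ← hu]
      congr 1
      ring
    · rw [map_mul]
      exact mul_ne_zero hρ ((u.isUnit.pow n).map _).ne_zero
    · rw [map_mul, 𝓒.localDegree_mul hρ ((u.isUnit.pow n).map _).ne_zero,
        localDegree_of_isUnit g ((u.isUnit.pow n).map _), add_zero, hρN]
  choose ρ hw hρ hρN using H'
  let η := genericPoint P
  have hunit : ∀ s : X.presheaf.stalk (e η), (e.stalkMap η).hom s ≠ 0 → IsUnit s := fun s hs =>
    (isUnit_map_iff (e.stalkMap η).hom _).mp (Ne.isUnit (a := (_ : P.functionField)) hs)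
  obtain ⟨a', ha'⟩ := (hunit (a η) (hab η).1).exists_right_inv
  -- This is `w / h ^ n`, because `w = ρ π ^ n` and `π = h b / a`. It is a unit at the generic point
  -- of `P` and restricts to a rational function on `P`, whose degree is zero.
  let G := ρ η * b η ^ n * a' ^ n
  have hG0 : (e.stalkMap η).hom G ≠ 0 := by
    have ha0 : (e.stalkMap η).hom a' ≠ 0 := fun h0 => by
      have := congrArg (e.stalkMap η).hom ha'
      rw [map_mul, h0, mul_zero, map_one] at this
      exact zero_ne_one this
    simp only [G, map_mul, map_pow]
    exact mul_ne_zero (mul_ne_zero (hρ η) (pow_ne_zero n (hab η).2.1)) (pow_ne_zero n ha0)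
  have hinj : ∀ x : P, Function.Injective (algebraMap (X.presheaf.stalk (e x)) X.functionField) :=
    fun x => IsFractionRing.injective (X.presheaf.stalk (e x)) X.functionField
  have hh : h ≠ 0 := by
    rintro rfl
    have h1 := (hab η).2.2
    rw [zero_mul, eq_comm, map_eq_zero_iff _ (hinj η), mul_eq_zero,
      or_iff_left (hunit _ (hab η).1).ne_zero] at h1
    exact hw0 (by rw [hw η, h1, zero_pow hn, mul_zero, map_zero])
  have hGh : ∀ x, algebraMap _ X.functionField G * algebraMap _ X.functionField (a x) ^ n =
      algebraMap _ X.functionField (ρ x) * algebraMap _ X.functionField (b x) ^ n := by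
    intro x
    have key : ∀ x, w * algebraMap _ X.functionField (a x) ^ n =
        algebraMap _ X.functionField (ρ x) * algebraMap _ X.functionField (b x) ^ n * h ^ n := fun x => by
      have h1 := congrArg (· ^ n) (hab x).2.2
      simp only [map_mul, mul_pow] at h1
      rw [hw x, map_mul, map_pow, mul_assoc, ← h1]
      ring
    have haη : algebraMap _ X.functionField (a η) * algebraMap _ X.functionField a' = 1 := by
      rw [← map_mul, ha', map_one]
    have h2 : algebraMap _ X.functionField G * h ^ n = w := by
      have h3 := congrArg (· ^ n) haη
      simp only [mul_pow, one_pow] at h3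
      simp only [G, map_mul, map_pow]
      linear_combination w * h3 - algebraMap _ X.functionField a' ^ n * key η
    refine mul_right_cancel₀ (pow_ne_zero n hh) ?_
    rw [← key x, ← h2]
    ring
  -- Locally `G = ρ (b / a) ^ n`. The order of `ρ` on `P` is `N x`, while the orders of `a / b` add
  -- up to the negative of the self-intersection.
  have hdeg : ∀ x, pointDegree g x ((e.stalkMap η).hom G) =
      N x - n * ((localDegree g x ((e.stalkMap x).hom (a x)) : ℤ) - localDegree g x ((e.stalkMap x).hom (b x))) := by
    intro x
    have hx : e η ⤳ e x := ((genericPoint_spec P).specializes trivial).map e.continuous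
    have h1 : G * (X.presheaf.stalkSpecializes hx).hom (a x ^ n) =
        (X.presheaf.stalkSpecializes hx).hom (ρ x * b x ^ n) := by
      apply hinj η
      rw [map_mul, algebraMap_stalkSpecializes, algebraMap_stalkSpecializes]
      simpa only [map_mul, map_pow] using hGh x
    have h2 : (e.stalkMap η).hom G * algebraMap (P.presheaf.stalk x) P.functionField
        ((e.stalkMap x).hom (a x) ^ n) = algebraMap (P.presheaf.stalk x) P.functionField
        ((e.stalkMap x).hom (ρ x) * (e.stalkMap x).hom (b x) ^ n) := by
      have := congrArg (e.stalkMap η).hom h1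
      rw [map_mul, stalkMap_specializes_algebraMap hx, stalkMap_specializes_algebraMap hx] at this
      simpa only [map_mul, map_pow] using this
    rw [𝓒.pointDegree_eq hG0 (pow_ne_zero n (hab x).1) h2, 𝓒.localDegree_mul (hρ x)
      (pow_ne_zero n (hab x).2.1), 𝓒.localDegree_pow (hab x).1, 𝓒.localDegree_pow (hab x).2.1, ← hρN x]
    push_cast
    ring
  obtain ⟨hfin, hsum⟩ := 𝓒.hasDegreeZero hG0
  have h1 : ∀ x, (n : ℤ) * ((localDegree g x ((e.stalkMap x).hom (a x)) : ℤ) -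
      localDegree g x ((e.stalkMap x).hom (b x))) = N x - pointDegree g x ((e.stalkMap η).hom G) := fun x => by
    rw [hdeg x]
    ring
  have h2 := smul_finsum (n : ℤ) fun x => (localDegree g x ((e.stalkMap x).hom (a x)) : ℤ) -
      localDegree g x ((e.stalkMap x).hom (b x))
  simp only [smul_eq_mul, h1] at h2
  rw [finsum_sub_distrib hN hfin, hsum, sub_zero] at h2
  rw [mul_neg, h2, neg_add_cancel]

end DegreeRelation

/-! ### Morphisms that are isomorphisms over an open subset -/

section IsoOverOpen

open CategoryTheory Limits AlgebraicGeometry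

universe u

theorem isLocalization_of_isIso_stalkMap {S : CommRingCat.{u}} {X : Scheme.{u}} (f : X ⟶ Spec S) (x : X)
    [IsIso (f.stalkMap x)] {y : PrimeSpectrum S} (hy : f x = y) :
    let _ := (stalkHom f x).hom.toAlgebra
    IsLocalization.AtPrime (X.presheaf.stalk x) y.asIdeal := by
  subst hy
  let y : PrimeSpectrum S := f x
  have h : stalkHom (𝟙 (Spec S)) (f x) = StructureSheaf.toStalk S y := by
    apply Spec.map_injective
    rw [SpecMap_stalkHom, Category.comp_id]
    exact Spec.fromSpecStalk_eq' S y
  have h' : stalkHom f x = stalkHom (𝟙 (Spec S)) (f x) ≫ f.stalkMap x := by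
    rw [stalkHom_stalkMap, Category.comp_id]
  intro _
  let e : (Spec.structureSheaf S).presheaf.stalk y ≃+* X.presheaf.stalk x :=
    (asIso (f.stalkMap x)).commRingCatIsoToRingEquiv
  let e' : (Spec.structureSheaf S).presheaf.stalk y ≃ₐ[S] X.presheaf.stalk x :=
    AlgEquiv.ofRingEquiv (f := e) (fun r => by
      change (f.stalkMap x).hom _ = (stalkHom f x).hom r
      rw [h', h]
      rfl)
  exact IsLocalization.isLocalization_of_algEquiv y.asIdeal.primeCompl e'

variable {X Y : Scheme.{u}} (f : X ⟶ Y) (U : Y.Opens) [IsIso (f ∣_ U)]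

theorem isIso_stalkMap_of_isIso_restrict {x : X} (hx : x ∈ f ⁻¹ᵁ U) : IsIso (f.stalkMap x) := by
  let z : (f ⁻¹ᵁ U).toScheme := ⟨x, hx⟩
  have : IsIso ((f ∣_ U).stalkMap z) := inferInstance
  exact ((MorphismProperty.isomorphisms CommRingCat).arrow_mk_iso_iff
    (morphismRestrictStalkMap f U z)).mp this

theorem eq_of_isIso_restrict {x x' : X} (hx : x ∈ f ⁻¹ᵁ U) (h : f x = f x') : x = x' := by
  have hx' : x' ∈ f ⁻¹ᵁ U := (h ▸ hx : f x' ∈ U)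
  have h1 : (f ∣_ U) ⟨x, hx⟩ = (f ∣_ U) ⟨x', hx'⟩ :=
    Subtype.ext ((morphismRestrict_base_coe f U ⟨x, hx⟩).trans
      (h.trans (morphismRestrict_base_coe f U ⟨x', hx'⟩).symm))
  exact congrArg Subtype.val ((f ∣_ U).homeomorph.injective h1)

theorem exists_eq_of_isIso_restrict {y : Y} (hy : y ∈ U) : ∃ x, f x = y := by
  obtain ⟨x, hx⟩ := (f ∣_ U).homeomorph.surjective ⟨y, hy⟩
  refine ⟨x.1, ?_⟩
  have := congrArg Subtype.val hx
  rwa [← morphismRestrict_base_coe]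

theorem isFractionRing_functionField {S : CommRingCat.{u}} [IsDomain S] {X : Scheme.{u}} [IsIntegral X]
    (f : X ⟶ Spec S) (U : (Spec S).Opens) [IsIso (f ∣_ U)] (hU : (⊥ : PrimeSpectrum S) ∈ U) :
    let _ := (stalkHom f (genericPoint X)).hom.toAlgebra
    IsFractionRing S X.functionField := by
  obtain ⟨x, hx⟩ := exists_eq_of_isIso_restrict f U hU
  have h1 : f (genericPoint X) ⤳ f x := ((genericPoint_spec X).specializes trivial).map f.continuous
  have h2 : f (genericPoint X) = (⊥ : PrimeSpectrum S) := by
    rw [hx] at h1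
    exact le_bot_iff (α := PrimeSpectrum S).mp ((PrimeSpectrum.le_iff_specializes _ _).mpr h1)
  have h3 : f (genericPoint X) ∈ U := by
    rw [h2]
    exact hU
  have := isIso_stalkMap_of_isIso_restrict f U h3
  have h4 := isLocalization_of_isIso_stalkMap f (genericPoint X) h2
  intro _
  have h6 : IsLocalization (⊥ : PrimeSpectrum S).asIdeal.primeCompl X.functionField := h4
  have h5 : (⊥ : PrimeSpectrum S).asIdeal.primeCompl = nonZeroDivisors S := Ideal.primeCompl_bot
  rw [h5] at h6
  exact h6

end IsoOverOpen

/-! ### The configuration of curves on the resolution -/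

section ExceptionalCurves

open CategoryTheory Limits AlgebraicGeometry

universe u

namespace HirzebruchJungResolution

variable {R : Type u} [CommRing R] [IsLocalRing R] (𝓧 : HirzebruchJungResolution R)

instance : IsIntegral 𝓧.X := 𝓧.isIntegral

instance (i : Fin (𝓧.r + 1)) : IsClosedImmersion (𝓧.E i) := 𝓧.isClosedImmersion_E i

instance : IsIso (𝓧.f ∣_ puncturedSpec R) := 𝓧.isIso_restrict

instance (x : 𝓧.X) : IsNoetherianRing (𝓧.X.presheaf.stalk x) :=
  have := 𝓧.isRegular x
  inferInstance

theorem stalkHom_stalkMap_E (i : Fin (𝓧.r + 1)) (x : projectiveLine (IsLocalRing.ResidueField R)) (a : R) :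
    ((𝓧.E i).stalkMap x).hom ((stalkHom 𝓧.f (𝓧.E i x)).hom a) =
      (stalkHom (projectiveLine.toSpec (IsLocalRing.ResidueField R)) x).hom (IsLocalRing.residue R a) := by
  have h := stalkHom_stalkMap 𝓧.f (𝓧.E i) x
  rw [𝓧.E_comp_f, stalkHom_SpecMap] at h
  exact RingHom.congr_fun (congrArg CommRingCat.Hom.hom h) a

theorem f_E (i : Fin (𝓧.r + 1)) (x : projectiveLine (IsLocalRing.ResidueField R)) :
    𝓧.f (𝓧.E i x) = IsLocalRing.closedPoint R := by
  have h1 : 𝓧.f (𝓧.E i x) = Spec.map (CommRingCat.ofHom (IsLocalRing.residue R))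
      (projectiveLine.toSpec (IsLocalRing.ResidueField R) x) :=
    congrArg (fun φ : projectiveLine (IsLocalRing.ResidueField R) ⟶ Spec (CommRingCat.of R) => φ x)
      (𝓧.E_comp_f i)
  have h2 : projectiveLine.toSpec (IsLocalRing.ResidueField R) x =
      IsLocalRing.closedPoint (IsLocalRing.ResidueField R) :=
    Subsingleton.elim (α := PrimeSpectrum (IsLocalRing.ResidueField R)) _ _
  rw [h1, h2]
  exact IsLocalRing.comap_closedPoint (IsLocalRing.residue R)

theorem mem_of_f_eq_closedPoint {x : 𝓧.X} (h : 𝓧.f x = IsLocalRing.closedPoint R) :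
    ∃ i, 𝓧.E i (genericPoint _) ⤳ x := by
  obtain ⟨i, y, rfl⟩ := 𝓧.exists_mem_E x h
  exact ⟨i, ((genericPoint_spec _).specializes trivial).map (𝓧.E i).continuous⟩

theorem meetsInRationalPoint_succ (i : Fin 𝓧.r) : MeetsInRationalPoint (𝓧.E i.succ) (𝓧.E i.castSucc)
    (projectiveLine.toSpec (IsLocalRing.ResidueField R)) :=
  ⟨_, _, _, (IsPullback.of_hasPullback _ _).flip, 𝓧.isIso_inter i⟩

/-- Both projections give the same map from the intersection to `Spec κ`, since they agree over
`Spec R` and `Spec κ` is a closed subscheme of it. Transversality is thus symmetric. -/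
theorem meetsInRationalPoint_castSucc (i : Fin 𝓧.r) : MeetsInRationalPoint (𝓧.E i.castSucc) (𝓧.E i.succ)
    (projectiveLine.toSpec (IsLocalRing.ResidueField R)) := by
  refine ⟨_, _, _, IsPullback.of_hasPullback _ _, ?_⟩
  have : IsClosedImmersion (Spec.map (CommRingCat.ofHom (IsLocalRing.residue R))) :=
    IsClosedImmersion.spec_of_surjective _ IsLocalRing.residue_surjective
  have h : pullback.snd (𝓧.E i.castSucc) (𝓧.E i.succ) ≫ projectiveLine.toSpec (IsLocalRing.ResidueField R) =
      pullback.fst (𝓧.E i.castSucc) (𝓧.E i.succ) ≫ projectiveLine.toSpec (IsLocalRing.ResidueField R) := by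
    have h1 := pullback.condition_assoc (f := 𝓧.E i.castSucc) (g := 𝓧.E i.succ) 𝓧.f
    rw [𝓧.E_comp_f, 𝓧.E_comp_f] at h1
    rw [← cancel_mono (Spec.map (CommRingCat.ofHom (IsLocalRing.residue R))), Category.assoc, Category.assoc, h1]
  rw [h]
  exact 𝓧.isIso_inter i

variable {𝓧} (C : 𝓧.TransversalCurve)

instance : IsIntegral C.E₀ := C.isIntegral

instance : IsClosedImmersion C.ι := C.isClosedImmersion

namespace TransversalCurve

/-- The generic points of the exceptional curves and of the transversal curve. -/
noncomputable def point : Option (Fin (𝓧.r + 1)) → 𝓧.X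
  | none => C.ι (genericPoint C.E₀)
  | some i => 𝓧.E i (genericPoint _)

/-- The curve with index `c` meets the `i`-th exceptional curve, and is different from it. -/
def Adj : Option (Fin (𝓧.r + 1)) → Fin (𝓧.r + 1) → Prop
  | none, i => i = 0
  | some j, i => i.val + 1 = j.val ∨ j.val + 1 = i.val

theorem not_adj_self (i : Fin (𝓧.r + 1)) : ¬ Adj (𝓧 := 𝓧) (some i) i := by
  simp [Adj]

theorem exists_meetsInRationalPoint {c : Option (Fin (𝓧.r + 1))} {i : Fin (𝓧.r + 1)} (h : Adj c i) :
    ∃ (Z : Scheme.{u}) (ι : Z ⟶ 𝓧.X) (_ : IsIntegral Z) (_ : IsClosedImmersion ι),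
      C.point c = ι (genericPoint Z) ∧
      MeetsInRationalPoint ι (𝓧.E i) (projectiveLine.toSpec (IsLocalRing.ResidueField R)) := by
  match c, h with
  | none, h =>
    refine ⟨_, C.ι, inferInstance, inferInstance, rfl, ?_⟩
    rw [show i = 0 from h]
    exact ⟨_, _, _, IsPullback.of_hasPullback _ _, C.isIso_inter⟩
  | some j, Or.inl h =>
    refine ⟨_, 𝓧.E j, inferInstance, inferInstance, rfl, ?_⟩
    obtain ⟨l, rfl, rfl⟩ : ∃ l : Fin 𝓧.r, i = l.castSucc ∧ j = l.succ :=
      ⟨⟨i, by lia⟩, rfl, Fin.ext h.symm⟩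
    exact 𝓧.meetsInRationalPoint_succ _
  | some j, Or.inr h =>
    refine ⟨_, 𝓧.E j, inferInstance, inferInstance, rfl, ?_⟩
    obtain ⟨l, rfl, rfl⟩ : ∃ l : Fin 𝓧.r, j = l.castSucc ∧ i = l.succ :=
      ⟨⟨j, by lia⟩, rfl, Fin.ext h.symm⟩
    exact 𝓧.meetsInRationalPoint_castSucc _

theorem eq_of_specializes {c : Option (Fin (𝓧.r + 1))} {i : Fin (𝓧.r + 1)} (h : ¬ Adj c i)
    {x : projectiveLine (IsLocalRing.ResidueField R)} (hx : C.point c ⤳ 𝓧.E i x) : c = some i := by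
  match c with
  | none =>
    exact absurd ⟨x, rfl⟩ (Set.disjoint_left.mp (C.disjoint i h) (mem_range_of_genericPoint_specializes hx))
  | some j =>
    have hmem := mem_range_of_genericPoint_specializes (ι := 𝓧.E j) hx
    rcases lt_trichotomy j.val i.val with hji | hji | hji
    · exact absurd ⟨x, rfl⟩ (Set.disjoint_left.mp (𝓧.disjoint j i (by simp only [Adj] at h; lia)) hmem)
    · rw [Fin.ext hji]
    · exact absurd hmem (Set.disjoint_left.mp (𝓧.disjoint i j (by simp only [Adj] at h; lia)) ⟨x, rfl⟩)

theorem eq_of_specializes_genericPoint {c : Option (Fin (𝓧.r + 1))} {i : Fin (𝓧.r + 1)}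
    (hx : C.point c ⤳ 𝓧.E i (genericPoint _)) : c = some i := by
  refine C.eq_of_specializes (fun h => ?_) hx
  obtain ⟨Z, ι, _, _, hξ, H⟩ := C.exists_meetsInRationalPoint h
  exact H.not_specializes_genericPoint (projectiveLineCharts _) (hξ ▸ hx)

theorem exists_specializes_iff {c : Option (Fin (𝓧.r + 1))} {i : Fin (𝓧.r + 1)} (h : Adj c i) :
    ∃ x, ∀ y, C.point c ⤳ 𝓧.E i y ↔ y = x := by
  obtain ⟨Z, ι, _, _, hξ, H⟩ := C.exists_meetsInRationalPoint h
  obtain ⟨x, hx⟩ := H.exists_specializes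
  rw [hξ]
  exact ⟨x, fun y => ⟨fun hy => H.eq_of_specializes hy hx, fun hy => hy ▸ hx⟩⟩

theorem localDegree_eq_one {c : Option (Fin (𝓧.r + 1))} {i : Fin (𝓧.r + 1)} (h : Adj c i)
    {x : projectiveLine (IsLocalRing.ResidueField R)} (hx : C.point c ⤳ 𝓧.E i x)
    {π : 𝓧.X.presheaf.stalk (𝓧.E i x)} (hπ : specializationIdeal hx = Ideal.span {π}) :
    localDegree (projectiveLine.toSpec (IsLocalRing.ResidueField R)) x (((𝓧.E i).stalkMap x).hom π) = 1 := by
  obtain ⟨Z, ι, _, _, hξ, H⟩ := C.exists_meetsInRationalPoint h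
  have hx' : ι (genericPoint Z) ⤳ 𝓧.E i x := hξ ▸ hx
  refine H.localDegree_eq_one hx' (π := π) ?_
  rw [← hπ]
  congr 1
  exact hξ.symm

end TransversalCurve

end HirzebruchJungResolution

end ExceptionalCurves

/-! ### Zeros of `w` on the resolution -/

section Divisor

open CategoryTheory Limits AlgebraicGeometry

universe u

theorem algebraMap_stalkHom {S : CommRingCat.{u}} {X : Scheme.{u}} [IsIntegral X] (f : X ⟶ Spec S) (p : X) (a : S) :
    algebraMap _ X.functionField ((stalkHom f p).hom a) = (stalkHom f (genericPoint X)).hom a :=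
  RingHom.congr_fun (congrArg CommRingCat.Hom.hom
    (stalkHom_stalkSpecializes f ((genericPoint_spec X).specializes (y := p) trivial))) a

namespace HirzebruchJungResolution

variable {R : Type u} [CommRing R] [IsLocalRing R] {𝓧 : HirzebruchJungResolution R}

/-- The function that computes the self-intersection number has a simple zero along the curve. -/
theorem exists_hasSimpleZero (i : Fin (𝓧.r + 1)) : ∃ h, ∀ x, HasSimpleZero (𝓧.E i (genericPoint _)) h (𝓧.E i x) := by
  obtain ⟨h, π, a, b, hπ, hab, -⟩ := 𝓧.hasSelfInt i
  refine ⟨h, fun x => ?_⟩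
  have hx : 𝓧.E i (genericPoint _) ⤳ 𝓧.E i x :=
    ((genericPoint_spec _).specializes trivial).map (𝓧.E i).continuous
  refine ⟨hx, π x, a x, b x, ?_, ?_, ?_, (hab x).2.2⟩
  · rw [← ker_stalkMap _ hx, hπ]
  · rw [← ker_stalkMap _ hx]
    exact (hab x).1
  · rw [← ker_stalkMap _ hx]
    exact (hab x).2.1

namespace TransversalCurve

variable (C : 𝓧.TransversalCurve)

theorem prime_height_eq_one : C.prime.height = 1 := C.height_eq_one

theorem mem_prime_iff {a : R} : a ∈ C.prime ↔
    (stalkHom 𝓧.f (C.point none)).hom a ∈ IsLocalRing.maximalIdeal (𝓧.X.presheaf.stalk (C.point none)) :=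
  mem_asIdeal_iff 𝓧.f (C.point none) a

variable [IsDomain R] [IsNoetherianRing R]

include C in
theorem isFractionRing :
    let _ := (stalkHom 𝓧.f (genericPoint 𝓧.X)).hom.toAlgebra
    IsFractionRing R 𝓧.X.functionField := by
  refine isFractionRing_functionField (S := CommRingCat.of R) 𝓧.f (puncturedSpec R) fun h => ?_
  have h1 : (⊥ : Ideal R) = IsLocalRing.maximalIdeal R := congrArg PrimeSpectrum.asIdeal h
  have h2 := IsLocalRing.le_maximalIdeal (J := C.prime) (Ideal.IsPrime.ne_top inferInstance)
  rw [← h1, le_bot_iff] at h2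
  exact C.prime.ne_bot_of_height_eq_one C.prime_height_eq_one h2

include C in
theorem stalkHom_injective : Function.Injective (stalkHom 𝓧.f (genericPoint 𝓧.X)).hom := by
  let _ := (stalkHom 𝓧.f (genericPoint 𝓧.X)).hom.toAlgebra
  have : IsFractionRing R 𝓧.X.functionField := C.isFractionRing
  exact IsFractionRing.injective R 𝓧.X.functionField

variable (hdim : ringKrullDim R = 2)

include hdim

theorem maximalIdeal_height : (IsLocalRing.maximalIdeal R).height = 2 := by
  have := IsLocalRing.maximalIdeal_height_eq_ringKrullDim (R := R)
  rw [hdim] at this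
  exact WithBot.coe_injective this

theorem f_point_none_ne : 𝓧.f (C.point none) ≠ IsLocalRing.closedPoint R := by
  intro h
  have h1 : C.prime = IsLocalRing.maximalIdeal R := congrArg PrimeSpectrum.asIdeal h
  have h2 := C.prime_height_eq_one
  rw [h1, maximalIdeal_height hdim] at h2
  norm_num at h2

theorem not_specializes_none (i : Fin (𝓧.r + 1)) : ¬ C.point (some i) ⤳ C.point none := by
  intro h
  have h1 := h.map 𝓧.f.continuous
  have h2 : 𝓧.f (C.point (some i)) = IsLocalRing.closedPoint R := 𝓧.f_E i _
  rw [h2] at h1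
  exact C.f_point_none_ne hdim (h1.mem_closed (IsLocalRing.isClosed_singleton_closedPoint R) rfl)

theorem isLocalization_prime :
    let _ := (stalkHom 𝓧.f (C.point none)).hom.toAlgebra
    IsLocalization.AtPrime (𝓧.X.presheaf.stalk (C.point none)) C.prime := by
  have := isIso_stalkMap_of_isIso_restrict 𝓧.f (puncturedSpec R) (C.f_point_none_ne hdim)
  exact isLocalization_of_isIso_stalkMap 𝓧.f (C.point none) (y := ⟨C.prime, inferInstance⟩) rfl

/-- Off the exceptional fibre the resolution is the punctured spectrum. There `w` vanishes only at
primes containing `q`, and in dimension two `q` is the only such prime other than the maximal ideal.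
-/
theorem exists_point_specializes {m : ℕ} {w : R} (hw : Ideal.span {w} = symbolicPower C.prime m) {η : 𝓧.X}
    (hη : w ∈ PrimeSpectrum.asIdeal (𝓧.f η)) : ∃ c, C.point c ⤳ η := by
  by_cases hcl : 𝓧.f η = IsLocalRing.closedPoint R
  · obtain ⟨i, hi⟩ := 𝓧.mem_of_f_eq_closedPoint hcl
    exact ⟨some i, hi⟩
  refine ⟨none, ?_⟩
  let y : PrimeSpectrum R := 𝓧.f η
  have hle : C.prime ≤ y.asIdeal := by
    intro a ha
    refine Ideal.IsPrime.mem_of_pow_mem inferInstance m ?_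
    have := pow_mem_symbolicPower ha m
    rw [← hw] at this
    exact (Ideal.span_singleton_le_iff_mem _).mpr hη this
  have heq : C.prime = y.asIdeal := by
    by_contra hne
    have h1 := Ideal.height_add_one_le_of_lt_of_isPrime (lt_of_le_of_ne hle hne)
    have h2 : y.asIdeal < IsLocalRing.maximalIdeal R :=
      lt_of_le_of_ne (IsLocalRing.le_maximalIdeal (Ideal.IsPrime.ne_top inferInstance))
        (fun h => hcl (PrimeSpectrum.ext (x := y) h))
    have h3 := Ideal.height_add_one_le_of_lt_of_isPrime h2
    rw [C.prime_height_eq_one] at h1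
    rw [maximalIdeal_height hdim] at h3
    have h4 := (add_le_add_left h1 1).trans h3
    norm_num at h4
  have h5 : 𝓧.f (C.point none) = 𝓧.f η := PrimeSpectrum.ext (y := y) heq
  rw [eq_of_isIso_restrict 𝓧.f (puncturedSpec R) (C.f_point_none_ne hdim) h5]

end TransversalCurve

end HirzebruchJungResolution

end Divisor

/-! ### A function with a simple zero along the transversal curve -/

section Divisor

open CategoryTheory Limits AlgebraicGeometry

universe u

namespace HirzebruchJungResolution

namespace TransversalCurve

variable {R : Type u} [CommRing R] [IsLocalRing R] {𝓧 : HirzebruchJungResolution R} (C : 𝓧.TransversalCurve)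
  [IsDomain R] [IsNoetherianRing R] [IsIntegrallyClosed R] (hdim : ringKrullDim R = 2)

include hdim

/-- An element `π` generating `q` at `q` serves as `h`. That the ideal of `E₀` is principal at a
point of an exceptional curve comes from the transversality of the intersection. -/
theorem exists_hasSimpleZero_none {m : ℕ} [NeZero m] {w : R} (hw : Ideal.span {w} = symbolicPower C.prime m) :
    ∃ h : 𝓧.X.functionField, h ≠ 0 ∧
      (∀ i x, C.point none ⤳ 𝓧.E i x → HasSimpleZero (C.point none) h (𝓧.E i x)) ∧
      HasOrder (C.point none) h ((stalkHom 𝓧.f (genericPoint 𝓧.X)).hom w) m := by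
  obtain ⟨π, hπ, r, hr, H⟩ := exists_local_generator_of_height_eq_one C.prime_height_eq_one
  have hr0 : r ≠ 0 := fun h => hr (h ▸ Ideal.zero_mem _)
  have hπ0 : π ≠ 0 := by
    rintro rfl
    obtain ⟨b, hb, hb0⟩ := C.prime.ne_bot_iff.mp (C.prime.ne_bot_of_height_eq_one C.prime_height_eq_one)
    obtain ⟨t, ht⟩ := H b hb
    rw [zero_mul] at ht
    exact mul_ne_zero hr0 hb0 ht
  have hunit : ∀ {d : R}, d ∉ C.prime → IsUnit ((stalkHom 𝓧.f (C.point none)).hom d) := fun hd =>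
    IsLocalRing.notMem_maximalIdeal.mp (mt C.mem_prime_iff.mpr hd)
  have hinj : Function.Injective (stalkHom 𝓧.f (C.point none)).hom := fun a b hab => by
    apply C.stalkHom_injective
    rw [← algebraMap_stalkHom 𝓧.f (C.point none), ← algebraMap_stalkHom 𝓧.f (C.point none), hab]
  refine ⟨(stalkHom 𝓧.f (genericPoint 𝓧.X)).hom π, ?_, fun i x hx => ?_, ?_⟩
  · exact (map_ne_zero_iff _ C.stalkHom_injective).mpr hπ0
  · have hadj : Adj (𝓧 := 𝓧) none i := by
      by_contra h
      exact nomatch C.eq_of_specializes h hx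
    obtain ⟨hi, πi, _, _, hπi, -⟩ := (exists_hasSimpleZero i).choose_spec x
    rw [← ker_stalkMap] at hπi
    obtain ⟨Z, ι, _, _, hξ, M⟩ := C.exists_meetsInRationalPoint hadj
    obtain ⟨y, hy⟩ := M.specializationIdeal_eq_span (projectiveLineCharts _) (hξ ▸ hx) hπi
      (hξ ▸ C.not_specializes_none hdim i)
    replace hy : specializationIdeal hx = Ideal.span {y} := by
      rw [← hy]
      congr 1
    have hmem : (stalkHom 𝓧.f (𝓧.E i x)).hom π ∈ specializationIdeal hx :=
      (stalkHom_mem_specializationIdeal 𝓧.f hx π).mpr hπ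
    rw [hy] at hmem
    obtain ⟨a, ha⟩ := Ideal.mem_span_singleton'.mp hmem
    refine ⟨hx, y, a, 1, hy, fun haI => ?_, fun h1 => Ideal.IsPrime.ne_top inferInstance
      (Ideal.eq_top_of_isUnit_mem _ h1 isUnit_one), ?_⟩
    -- In the local ring at the generic point of `E₀`, which is `R` localized at `q`, both `y` and
    -- `π` generate the maximal ideal. So the quotient `a` is a unit there.
    · have hsp : ∀ c, (𝓧.X.presheaf.stalkSpecializes hx).hom ((stalkHom 𝓧.f (𝓧.E i x)).hom c) =
          (stalkHom 𝓧.f (C.point none)).hom c := fun c =>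
        RingHom.congr_fun (congrArg CommRingCat.Hom.hom (stalkHom_stalkSpecializes 𝓧.f hx)) c
      let _ := (stalkHom 𝓧.f (C.point none)).hom.toAlgebra
      have hloc : IsLocalization.AtPrime (𝓧.X.presheaf.stalk (C.point none)) C.prime :=
        C.isLocalization_prime hdim
      let y' := (𝓧.X.presheaf.stalkSpecializes hx).hom y
      let a' := (𝓧.X.presheaf.stalkSpecializes hx).hom a
      have hya : a' * y' = (stalkHom 𝓧.f (C.point none)).hom π := by
        rw [← hsp, ← ha, map_mul]
      have hy0 : y' ≠ 0 := fun h0 => by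
        rw [h0, mul_zero, eq_comm, map_eq_zero_iff _ hinj] at hya
        exact hπ0 hya
      obtain ⟨⟨c, d⟩, hcd⟩ := IsLocalization.surj C.prime.primeCompl y'
      replace hcd : y' * (stalkHom 𝓧.f (C.point none)).hom d = (stalkHom 𝓧.f (C.point none)).hom c := hcd
      have hym : y' ∈ IsLocalRing.maximalIdeal (𝓧.X.presheaf.stalk (C.point none)) := by
        change y ∈ specializationIdeal hx
        rw [hy]
        exact Ideal.mem_span_singleton_self y
      have hc : c ∈ C.prime := C.mem_prime_iff.mpr (hcd ▸ Ideal.mul_mem_right _ _ hym)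
      obtain ⟨t, ht⟩ := H c hc
      have h1 : (stalkHom 𝓧.f (C.point none)).hom d * (stalkHom 𝓧.f (C.point none)).hom r =
          a' * (stalkHom 𝓧.f (C.point none)).hom t := by
        refine mul_left_cancel₀ hy0 ?_
        have h2 := congrArg (stalkHom 𝓧.f (C.point none)).hom ht
        rw [map_mul, map_mul, ← hcd, ← hya] at h2
        linear_combination h2
      have h2 : IsUnit (a' * (stalkHom 𝓧.f (C.point none)).hom t) := h1 ▸ (hunit d.2).mul (hunit hr)
      exact haI (isUnit_of_mul_isUnit_left h2)
    · rw [map_one, mul_one, mul_comm y, ha, algebraMap_stalkHom]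
  -- The quotient `t' = π ^ m / w` divides `r ^ m * s`, an element outside `q`. It is therefore a
  -- unit at `E₀`, and `w` has the order of `π ^ m`.
  · have hwm : w ∈ symbolicPower C.prime m := hw ▸ Ideal.mem_span_singleton_self w
    have hw0 : w ≠ 0 := ne_zero_of_span_eq_symbolicPower hw C.prime_height_eq_one
    obtain ⟨s, hs, hsw⟩ := mem_symbolicPower_iff.mp hwm
    obtain ⟨t, ht⟩ := exists_mul_eq_pow_mul H m _ hsw
    have hπm := pow_mem_symbolicPower hπ m
    rw [← hw] at hπm
    obtain ⟨t', ht'⟩ := Ideal.mem_span_singleton'.mp hπm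
    have h1 : r ^ m * s = t' * t := by
      refine mul_left_cancel₀ hw0 ?_
      rw [← ht'] at ht
      linear_combination ht
    have ht'q : t' ∉ C.prime := fun h => by
      have h2 : r ^ m * s ∈ C.prime := h1 ▸ Ideal.mul_mem_right _ _ h
      exact (Ideal.IsPrime.mem_or_mem inferInstance h2).elim
        (fun h => hr (Ideal.IsPrime.mem_of_pow_mem inferInstance _ h)) hs
    refine ⟨1, (stalkHom 𝓧.f (C.point none)).hom t', isUnit_one, hunit ht'q, ?_⟩
    rw [algebraMap_stalkHom, ← map_mul, mul_comm, ht', map_pow, map_one, mul_one]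

end TransversalCurve

end HirzebruchJungResolution

end Divisor

/-! ### The orders of `w` and the linear system they satisfy -/

section Divisor

open CategoryTheory Limits AlgebraicGeometry

universe u

namespace HirzebruchJungResolution

namespace TransversalCurve

variable {R : Type u} [CommRing R] [IsLocalRing R] {𝓧 : HirzebruchJungResolution R} (C : 𝓧.TransversalCurve)
  [IsDomain R] [IsNoetherianRing R] [IsIntegrallyClosed R]

theorem not_specializes_of_ne (hdim : ringKrullDim R = 2) {c c' : Option (Fin (𝓧.r + 1))} (h : c ≠ c') :
    ¬ C.point c' ⤳ C.point c := by
  intro hs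
  match c, c' with
  | none, none => exact h rfl
  | none, some i => exact C.not_specializes_none hdim i hs
  | some i, c' => exact h (C.eq_of_specializes_genericPoint hs).symm

/-- The orders of vanishing of `w` along the curves of the configuration, relative to rational
functions `h` with a simple zero along the respective curve. -/
structure IsOrderOf (m : ℕ) (w : R) (h : Option (Fin (𝓧.r + 1)) → 𝓧.X.functionField)
    (n : Option (Fin (𝓧.r + 1)) → ℕ) : Prop where
  ne_zero : ∀ c, h c ≠ 0
  hasSimpleZero : ∀ c i x, C.point c ⤳ 𝓧.E i x → HasSimpleZero (C.point c) (h c) (𝓧.E i x)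
  hasOrder : ∀ c, HasOrder (C.point c) (h c) ((stalkHom 𝓧.f (genericPoint 𝓧.X)).hom w) (n c)
  none_eq : n none = m
  some_ne_zero : ∀ i, n (some i) ≠ 0

theorem exists_isOrderOf (hdim : ringKrullDim R = 2) {m : ℕ} [NeZero m] {w : R}
    (hw : Ideal.span {w} = symbolicPower C.prime m) : ∃ h n, C.IsOrderOf m w h n := by
  classical
  obtain ⟨h₀, hh₀, hs₀, ho₀⟩ := C.exists_hasSimpleZero_none hdim hw
  have hw0 : w ≠ 0 := ne_zero_of_span_eq_symbolicPower hw C.prime_height_eq_one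
  have hwm : w ∈ IsLocalRing.maximalIdeal R := by
    refine IsLocalRing.le_maximalIdeal (J := C.prime) (Ideal.IsPrime.ne_top inferInstance) ?_
    have hwm : w ∈ symbolicPower C.prime m := hw ▸ Ideal.mem_span_singleton_self w
    obtain ⟨s, hs, hsw⟩ := mem_symbolicPower_iff.mp hwm
    exact (Ideal.IsPrime.mem_or_mem inferInstance (Ideal.pow_le_self (NeZero.ne m) hsw)).resolve_left hs
  choose h hh using exists_hasSimpleZero (𝓧 := 𝓧)
  have hmem : ∀ i, (stalkHom 𝓧.f (C.point (some i))).hom w ∈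
      IsLocalRing.maximalIdeal (𝓧.X.presheaf.stalk (C.point (some i))) := fun i => by
    rw [← mem_asIdeal_iff, show 𝓧.f (C.point (some i)) = IsLocalRing.closedPoint R from 𝓧.f_E i _]
    exact hwm
  have hinj : ∀ p, Function.Injective (algebraMap (𝓧.X.presheaf.stalk p) 𝓧.X.functionField) := fun p =>
    IsFractionRing.injective _ _
  -- If `h i` were zero, the local equation of the curve would be zero, although its ideal contains
  -- the nonzero element `w`.
  have hne : ∀ i, h i ≠ 0 := by
    intro i h0
    obtain ⟨hp, π, a, b, hπ, ha, hb, hab⟩ := hh i (genericPoint _)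
    rw [h0, zero_mul, eq_comm, map_eq_zero_iff _ (hinj _), mul_eq_zero] at hab
    have hπ0 : π = 0 := hab.resolve_right fun h => ha (h ▸ Ideal.zero_mem _)
    have h1 : (stalkHom 𝓧.f (𝓧.E i (genericPoint _))).hom w ∈ specializationIdeal hp :=
      (stalkHom_mem_specializationIdeal 𝓧.f hp w).mpr ((mem_asIdeal_iff 𝓧.f _ w).mpr (hmem i))
    rw [hπ, hπ0, Ideal.span_singleton_zero, Ideal.mem_bot] at h1
    have h2 := algebraMap_stalkHom 𝓧.f (𝓧.E i (genericPoint _)) w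
    rw [h1, map_zero, eq_comm, map_eq_zero_iff _ C.stalkHom_injective] at h2
    exact hw0 h2
  have hord : ∀ i, ∃ n, HasOrder (C.point (some i)) (h i) ((stalkHom 𝓧.f (genericPoint 𝓧.X)).hom w) n := by
    intro i
    -- At the generic point of an exceptional curve no other curve of the configuration passes, so
    -- the factorization with a single curve gives the order.
    obtain ⟨u, π, n, -, -, H⟩ := exists_factorization (ξ := fun _ : Unit => C.point (some i))
      (h := fun _ => h i) (p := C.point (some i)) {()} (fun _ _ => hh i _) (fun _ _ => hne i)
      (fun c _ c' _ hc => absurd rfl hc) ((stalkHom 𝓧.f (C.point (some i))).hom w) (fun η hη hwη => by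
        obtain ⟨c, hc⟩ := C.exists_point_specializes hdim hw
          ((stalkHom_mem_specializationIdeal 𝓧.f hη w).mp hwη)
        obtain rfl := C.eq_of_specializes_genericPoint (hc.trans hη)
        exact ⟨(), Finset.mem_singleton_self _, hc⟩)
    have := (H () (Finset.mem_singleton_self _)).2
    rw [algebraMap_stalkHom] at this
    exact ⟨_, this⟩
  choose n hn using hord
  refine ⟨fun c => c.elim h₀ h, fun c => c.elim m n, ⟨?_, ?_, ?_, rfl, ?_⟩⟩
  · rintro (_ | i)
    exacts [hh₀, hne i]
  · rintro (_ | j) i x hx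
    · exact hs₀ i x hx
    · obtain ⟨y, hy⟩ := mem_range_of_genericPoint_specializes (ι := 𝓧.E j) hx
      rw [← hy]
      exact hh j y
  · rintro (_ | i)
    exacts [ho₀, hn i]
  · intro i h0
    obtain ⟨s, t, hs, ht, hst⟩ := hn i
    rw [show n i = 0 from h0, pow_zero, one_mul, ← algebraMap_stalkHom 𝓧.f (C.point (some i)), ← map_mul] at hst
    exact hmem i (isUnit_of_mul_isUnit_left (hinj _ hst ▸ hs))

variable {C} {m : ℕ} [NeZero m] {w : R} {h : Option (Fin (𝓧.r + 1)) → 𝓧.X.functionField}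
  {n : Option (Fin (𝓧.r + 1)) → ℕ}

open Classical in
/-- The divisor of `w` has degree zero on the exceptional curves. -/
theorem IsOrderOf.sum_eq_zero (H : C.IsOrderOf m w h n) (hdim : ringKrullDim R = 2)
    (hw : Ideal.span {w} = symbolicPower C.prime m) (i : Fin (𝓧.r + 1)) :
    (n (some i) : ℤ) * 𝓧.selfInt i + ∑ c, (if Adj c i then (n c : ℤ) else 0) = 0 := by
  have hw0 : w ≠ 0 := ne_zero_of_span_eq_symbolicPower hw C.prime_height_eq_one
  -- The intersection multiplicities with the exceptional curve, weighted by the orders of `w`. By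
  -- transversality each neighbouring curve contributes its order at exactly one point.
  let N : Option (Fin (𝓧.r + 1)) → projectiveLine (IsLocalRing.ResidueField R) → ℤ :=
    fun c x => if Adj c i ∧ C.point c ⤳ 𝓧.E i x then (n c : ℤ) else 0
  have hN : ∀ c, (Function.support (N c)).Finite ∧ ∑ᶠ x, N c x = if Adj c i then (n c : ℤ) else 0 := by
    intro c
    by_cases hc : Adj c i
    · obtain ⟨x, hx⟩ := C.exists_specializes_iff hc
      have h1 : ∀ y, y ≠ x → N c y = 0 := fun y hy => by
        simp only [N, hx, hy, and_false, if_false]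
      refine ⟨(Set.finite_singleton x).subset fun y hy => by_contra fun hyx => hy (h1 y hyx), ?_⟩
      rw [finsum_eq_single _ x h1]
      simp only [N, hx, and_true]
    · have h1 : N c = 0 := funext fun y => by simp [N, hc]
      rw [h1, if_neg hc]
      simp
  have key := (𝓧.hasSelfInt i).mul_add_finsum_eq_zero (projectiveLineCharts _)
    (w := (stalkHom 𝓧.f (genericPoint 𝓧.X)).hom w)
    ((map_ne_zero_iff _ C.stalkHom_injective).mpr hw0) (H.some_ne_zero i) (fun x => ∑ c, N c x) ?_ ?_
  · rw [finsum_sum_comm _ _ fun c _ => (hN c).1] at key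
    rw [Finset.sum_congr rfl fun c _ => (hN c).2] at key
    exact key
  · refine (Set.finite_iUnion fun c => (hN c).1).subset fun x hx => ?_
    obtain ⟨c, -, hc⟩ := Finset.exists_ne_zero_of_sum_ne_zero hx
    exact Set.mem_iUnion.mpr ⟨c, hc⟩
  · intro x
    -- The curves of the configuration that pass through the given point. By the factorization of
    -- `w` there, the factor prime to the equation of `E i` is a product of equations of neighbours,
    -- each of local degree one on `E i`.
    let S : Finset (Option (Fin (𝓧.r + 1))) := {c | C.point c ⤳ 𝓧.E i x}
    have hS : ∀ c, c ∈ S ↔ C.point c ⤳ 𝓧.E i x := fun c => by simp [S]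
    have hi : C.point (some i) ⤳ 𝓧.E i x :=
      ((genericPoint_spec _).specializes trivial).map (𝓧.E i).continuous
    obtain ⟨u, π, hu, hwu, hπ⟩ := exists_factorization_of_hasOrder (ξ := C.point) (h := h) (p := 𝓧.E i x) S
      (fun c hc => H.hasSimpleZero c i x ((hS c).mp hc)) (fun c _ => H.ne_zero c)
      (fun c _ c' _ hcc' => C.not_specializes_of_ne hdim hcc') ((stalkHom 𝓧.f (𝓧.E i x)).hom w)
      (fun η hη hwη => by
        obtain ⟨c, hc⟩ := C.exists_point_specializes hdim hw
          ((stalkHom_mem_specializationIdeal 𝓧.f hη w).mp hwη)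
        exact ⟨c, (hS c).mpr (hc.trans hη), hc⟩) n
      (fun c _ => by
        rw [algebraMap_stalkHom]
        exact H.hasOrder c)
    have hker : RingHom.ker ((𝓧.E i).stalkMap x).hom = specializationIdeal hi := ker_stalkMap (𝓧.E i) hi
    have hadj : ∀ c ∈ S.erase (some i), Adj c i := fun c hc => by
      by_contra hc'
      exact Finset.ne_of_mem_erase hc (C.eq_of_specializes hc' ((hS c).mp (Finset.mem_of_mem_erase hc)))
    have hπ0 : ∀ c ∈ S.erase (some i), ((𝓧.E i).stalkMap x).hom (π c) ≠ 0 := by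
      intro c hc h0
      have hcx := (hS c).mp (Finset.mem_of_mem_erase hc)
      refine C.not_specializes_of_ne hdim (Finset.ne_of_mem_erase hc).symm
        (specializes_of_specializationIdeal_le hi hcx ?_)
      rw [hπ c (Finset.mem_of_mem_erase hc) hcx, Ideal.span_singleton_le_iff_mem, ← hker]
      exact h0
    have hprod : ∏ c ∈ S.erase (some i), ((𝓧.E i).stalkMap x).hom (π c) ^ n c ≠ 0 :=
      Finset.prod_ne_zero_iff.mpr fun c hc => pow_ne_zero _ (hπ0 c hc)
    refine ⟨u * ∏ c ∈ S.erase (some i), π c ^ n c, π (some i), ?_, ?_, ?_, ?_⟩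
    · rw [hker, hπ _ ((hS _).mpr hi) hi]
    · rw [mul_assoc, Finset.prod_erase_mul _ _ ((hS _).mpr hi), ← hwu, algebraMap_stalkHom]
    · rw [map_mul, map_prod]
      simp only [map_pow]
      exact mul_ne_zero (hu.map _).ne_zero hprod
    · rw [map_mul, map_prod]
      simp only [map_pow]
      rw [(projectiveLineCharts _).localDegree_mul (hu.map _).ne_zero hprod,
        localDegree_of_isUnit _ (hu.map _), zero_add,
        (projectiveLineCharts _).localDegree_prod _ fun c hc => pow_ne_zero _ (hπ0 c hc), Nat.cast_sum]
      have h1 : S.erase (some i) = Finset.univ.filter fun c => Adj c i ∧ C.point c ⤳ 𝓧.E i x := by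
        ext c
        simp only [Finset.mem_filter, Finset.mem_univ, true_and]
        refine ⟨fun hc => ⟨hadj c hc, (hS c).mp (Finset.mem_of_mem_erase hc)⟩, fun hc =>
          Finset.mem_erase.mpr ⟨?_, (hS c).mpr hc.2⟩⟩
        rintro rfl
        exact not_adj_self i hc.1
      simp only [N]
      rw [← Finset.sum_filter, ← h1]
      refine Finset.sum_congr rfl fun c hc => ?_
      have hcx := (hS c).mp (Finset.mem_of_mem_erase hc)
      rw [(projectiveLineCharts _).localDegree_pow (hπ0 c hc),
        C.localDegree_eq_one (hadj c hc) hcx (hπ c (Finset.mem_of_mem_erase hc) hcx), mul_one]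

theorem IsOrderOf.last_eq_one (H : C.IsOrderOf m w h n) (hdim : ringKrullDim R = 2)
    (hw : Ideal.span {w} = symbolicPower C.prime m) (hm : (m : ℤ) = 𝓧.det) :
    n (some (Fin.last 𝓧.r)) = 1 := by
  classical
  have := last_eq_one_of_string 𝓧.selfInt (fun i => (n (some i) : ℤ)) (m := m)
    (by exact_mod_cast NeZero.ne m) hm fun i => by
      have h1 := H.sum_eq_zero hdim hw i
      rw [Fintype.sum_option, H.none_eq] at h1
      have h2 : ∑ j, (if Adj (some j) i then (n (some j) : ℤ) else 0) =
          ∑ j, if i.val + 1 = j.val ∨ j.val + 1 = i.val then (n (some j) : ℤ) else 0 :=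
        Finset.sum_congr rfl fun j _ => by
          simp only [Adj]
          congr
      have h3 : (if Adj (𝓧 := 𝓧) none i then (m : ℤ) else 0) = if i = 0 then (m : ℤ) else 0 := by
        simp only [Adj]
        congr
      linarith
  exact_mod_cast this

end TransversalCurve

end HirzebruchJungResolution

end Divisor

/-! ### A function of order one generates the maximal ideal -/

section GenericPointOfTheLastCurve

open CategoryTheory Limits AlgebraicGeometry

universe u

theorem HasSimpleZero.maximalIdeal_eq_span {X : Scheme.{u}} [IsIntegral X] {ξ : X} {h : X.functionField}
    (H : HasSimpleZero ξ h ξ) {w : X.presheaf.stalk ξ} (hw : HasOrder ξ h (algebraMap _ X.functionField w) 1) :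
    IsLocalRing.maximalIdeal (X.presheaf.stalk ξ) = Ideal.span {w} := by
  obtain ⟨hp, π, a, b, hπ, ha, hb, hab⟩ := H
  obtain ⟨s, t, hs, ht, hst⟩ := hw
  have hI : specializationIdeal hp = IsLocalRing.maximalIdeal (X.presheaf.stalk ξ) := by
    ext x
    rw [mem_specializationIdeal, TopCat.Presheaf.stalkSpecializes_refl]
    rfl
  rw [hI] at hπ ha hb
  have h1 : w * (t * b) = π * (a * s) := by
    apply IsFractionRing.injective (X.presheaf.stalk ξ) X.functionField
    simp only [map_mul, pow_one] at hab hst ⊢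
    linear_combination algebraMap _ X.functionField b * hst + algebraMap _ X.functionField s * hab
  have ha' : IsUnit a := IsLocalRing.notMem_maximalIdeal.mp ha
  have hb' : IsUnit b := IsLocalRing.notMem_maximalIdeal.mp hb
  rw [hπ, ← Ideal.span_singleton_mul_right_unit (ha'.mul hs) π, ← h1,
    Ideal.span_singleton_mul_right_unit (ht.mul hb')]

theorem exists_eq_zpow_mul_of_maximalIdeal_eq_span {A K : Type*} [CommRing A] [IsDomain A] [IsLocalRing A]
    [IsNoetherianRing A] [Field K] [Algebra A K] [IsFractionRing A K] {w : A} (hw0 : w ≠ 0)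
    (hw : IsLocalRing.maximalIdeal A = Ideal.span {w}) {z : K} (hz : z ≠ 0) :
    ∃ (n : ℤ) (u : A), IsUnit u ∧ z = algebraMap A K w ^ n * algebraMap A K u := by
  have hfield : ¬ IsField A := fun hA => by
    have := IsLocalRing.isField_iff_maximalIdeal_eq.mp hA
    rw [hw, Ideal.span_singleton_eq_bot] at this
    exact hw0 this
  have hprinc : (IsLocalRing.maximalIdeal A).IsPrincipal := ⟨w, hw⟩
  have hdvr : IsDiscreteValuationRing A := ((IsDiscreteValuationRing.TFAE A hfield).out 0 4).mpr hprinc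
  have hirr := (IsDiscreteValuationRing.irreducible_iff_uniformizer w).mpr hw
  obtain ⟨a, b, hb, rfl⟩ := IsFractionRing.div_surjective (A := A) z
  have hb0 : b ≠ 0 := nonZeroDivisors.ne_zero hb
  have ha0 : a ≠ 0 := fun h => hz (by rw [h, map_zero, zero_div])
  obtain ⟨i, u, rfl⟩ := IsDiscreteValuationRing.eq_unit_mul_pow_irreducible ha0 hirr
  obtain ⟨j, v, rfl⟩ := IsDiscreteValuationRing.eq_unit_mul_pow_irreducible hb0 hirr
  have hwK : algebraMap A K w ≠ 0 := (map_ne_zero_iff _ (IsFractionRing.injective A K)).mpr hw0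
  have hvK : algebraMap A K v ≠ 0 := (map_ne_zero_iff _ (IsFractionRing.injective A K)).mpr v.ne_zero
  refine ⟨i - j, u * ↑v⁻¹, u.isUnit.mul v⁻¹.isUnit, ?_⟩
  have hv : algebraMap A K v * algebraMap A K ↑v⁻¹ = 1 := by
    rw [← map_mul, Units.mul_inv, map_one]
  rw [zpow_sub₀ hwK, zpow_natCast, zpow_natCast, map_mul, map_mul, map_mul, map_pow, map_pow]
  field_simp
  linear_combination -hv

end GenericPointOfTheLastCurve

/-! ### The valuation of the last exceptional curve, and the theorem -/

section Main

open CategoryTheory AlgebraicGeometry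

universe u

/-- The function `w` is a uniformizer at the generic point of the last exceptional curve, whose
residue field is the field of rational functions over the residue field of `R`. -/
theorem HirzebruchJungResolution.TransversalCurve.exists_valuationSubring
    {R : Type u} [CommRing R] [IsLocalRing R] [IsDomain R] [IsNoetherianRing R] [IsIntegrallyClosed R]
    (hdim : ringKrullDim R = 2) {𝓧 : HirzebruchJungResolution R} {m : ℕ} [NeZero m] (hm : (m : ℤ) = 𝓧.det)
    (C : 𝓧.TransversalCurve) {w : R} (hw : Ideal.span {w} = symbolicPower C.prime m) :
    ∃ (V : Subring (FractionRing R)) (ψ : V →+* RatFunc (IsLocalRing.ResidueField R))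
      (hRV : ∀ r : R, algebraMap R (FractionRing R) r ∈ V),
      (∀ r, ψ ⟨_, hRV r⟩ = RatFunc.C (IsLocalRing.residue R r)) ∧ ψ ⟨_, hRV w⟩ = 0 ∧
      ∀ z : FractionRing R, z ≠ 0 → ∃ (n : ℤ) (v : V), ψ v ≠ 0 ∧
        z = (algebraMap R (FractionRing R) w) ^ n * v := by
  let E := 𝓧.E (Fin.last 𝓧.r)
  let ξ := E (genericPoint _)
  let K := 𝓧.X.functionField
  let _ : Algebra R K := (stalkHom 𝓧.f (genericPoint 𝓧.X)).hom.toAlgebra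
  have hfrac : IsFractionRing R K := C.isFractionRing
  let A := 𝓧.X.presheaf.stalk ξ
  let j : R →+* A := (stalkHom 𝓧.f ξ).hom
  have hj : ∀ r, algebraMap A K (j r) = algebraMap R K r := algebraMap_stalkHom 𝓧.f ξ
  have hw0 : w ≠ 0 := ne_zero_of_span_eq_symbolicPower hw C.prime_height_eq_one
  have hjw0 : j w ≠ 0 := fun h => hw0 <| IsFractionRing.injective R K (by rw [← hj, h, map_zero, map_zero])
  obtain ⟨h, n, H⟩ := C.exists_isOrderOf hdim hw
  have hmax : IsLocalRing.maximalIdeal A = Ideal.span {j w} := by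
    refine (H.hasSimpleZero (some (Fin.last 𝓧.r)) (Fin.last 𝓧.r) (genericPoint _)
      specializes_rfl).maximalIdeal_eq_span ?_
    have h1 := H.hasOrder (some (Fin.last 𝓧.r))
    rw [H.last_eq_one hdim hw hm] at h1
    exact (hj w).symm ▸ h1
  -- The function field of the resolution is a fraction field of `R`. The image in `FractionRing R`
  -- of the local ring at the generic point of the last curve is the valuation ring.
  let ε : K ≃ₐ[R] FractionRing R := (FractionRing.algEquiv R K).symm
  let φ : A →+* FractionRing R := (ε : K →+* FractionRing R).comp (algebraMap A K)
  have hφ : Function.Injective φ := ε.injective.comp (IsFractionRing.injective A K)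
  have hφj : ∀ r, φ (j r) = algebraMap R (FractionRing R) r := fun r =>
    (congrArg ε (hj r)).trans (ε.commutes r)
  obtain ⟨e, he⟩ := (projectiveLineCharts (IsLocalRing.ResidueField R)).exists_ratFunc_ringHom
  -- Restriction to the last curve followed by the identification of its function field with the
  -- rational functions over `κ`.
  let ρ : A →+* RatFunc (IsLocalRing.ResidueField R) := e.comp (E.stalkMap (genericPoint _)).hom
  have hρ : ∀ r, ρ (j r) = RatFunc.C (IsLocalRing.residue R r) := fun r =>
    (congrArg e (𝓧.stalkHom_stalkMap_E _ _ r)).trans (he _)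
  let σ : A ≃+* φ.range := RingEquiv.ofBijective φ.rangeRestrict
    ⟨fun a b hab => hφ (congrArg Subtype.val hab), φ.rangeRestrict_surjective⟩
  have hσ : ∀ (a : A) (ha : φ a ∈ φ.range), σ.symm ⟨φ a, ha⟩ = a := fun a _ => σ.symm_apply_apply a
  have hRV : ∀ r : R, algebraMap R (FractionRing R) r ∈ φ.range := fun r => ⟨j r, hφj r⟩
  have hψ : ∀ r, (ρ.comp (σ.symm : φ.range →+* A)) ⟨_, hRV r⟩ = RatFunc.C (IsLocalRing.residue R r) := fun r => by
    rw [← hρ]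
    refine congrArg ρ ?_
    change σ.symm _ = _
    rw [σ.symm_apply_eq]
    exact Subtype.ext (hφj r).symm
  refine ⟨φ.range, ρ.comp (σ.symm : φ.range →+* A), hRV, hψ, ?_, fun z hz => ?_⟩
  · rw [hψ]
    have hwm : IsLocalRing.residue R w = 0 := by
      rw [IsLocalRing.residue_eq_zero_iff]
      intro hu
      refine (IsLocalRing.notMem_maximalIdeal (x := j w)).mpr (hu.map j) ?_
      rw [hmax]
      exact Ideal.mem_span_singleton_self _
    rw [hwm, map_zero]
  · obtain ⟨n, u, hu, hzu⟩ := exists_eq_zpow_mul_of_maximalIdeal_eq_span (K := K) hjw0 hmax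
      (z := ε.symm z) (by simpa using hz)
    refine ⟨n, ⟨φ u, u, rfl⟩, ?_, ?_⟩
    · exact (congrArg ρ (hσ u ⟨u, rfl⟩)).trans_ne (hu.map ρ).ne_zero
    · have h1 := congrArg ε hzu
      rw [ε.apply_symm_apply, map_mul, map_zpow₀, hj, ε.commutes] at h1
      exact h1

end Main

theorem mainTheorem8 {R : Type*} [CommRing R] [IsDomain R] [IsNoetherianRing R]
    [IsIntegrallyClosed R] [HenselianLocalRing R] (_hdim : ringKrullDim R = 2)
    -- the resolution of the singularity, its determinant `m`, and the curve `E₀`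
    (𝓧 : HirzebruchJungResolution R) {m : ℕ} [NeZero m] (_hm : (m : ℤ) = 𝓧.det)
    (_hζ : ∃ ζ : IsLocalRing.ResidueField R, IsPrimitiveRoot ζ m)
    (C : 𝓧.TransversalCurve)
    -- the toral function `w = t⁻ᵐ` with divisor `m f_* E₀` which defines the cyclic cover
    (w : R) (hw : Ideal.span {w} = symbolicPower C.prime m)
    -- the cyclic extension `L` of the residue field, and its lift `B`
    {L : Type*} [Field L] [Algebra (IsLocalRing.ResidueField R) L] [Algebra R L]
    [IsScalarTower R (IsLocalRing.ResidueField R) L]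
    [FiniteDimensional (IsLocalRing.ResidueField R) L] [IsGalois (IsLocalRing.ResidueField R) L]
    (τ : Multiplicative (ZMod m) ≃* (L ≃ₐ[IsLocalRing.ResidueField R] L))
    {B : Type*} [CommRing B] [Algebra R B] (ρ : Multiplicative (ZMod m) →* (B ≃ₐ[R] B))
    (red : B →ₐ[R] L) (_hB : IsCyclicEtaleLift τ ρ red) :
    IsMaximalOrderInDivisionRing R (SymbolAlgebra (cyclicCoverGrading C.prime hw) ρ) ∧
      IsAzumayaInCodimOne R (SymbolAlgebra (cyclicCoverGrading C.prime hw) ρ) := by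
  obtain ⟨V, ψ, hRV, hψ, hψw, hV⟩ := C.exists_valuationSubring _hdim _hm hw
  exact _hB.isMaximalOrder_and_isAzumayaInCodimOne C.prime_height_eq_one hw _hζ V ψ hRV hψ hψw hV
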